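/- **Setting.** Let $n\ge 2$, $T,H>0$, and write $x=(\bar x,x_n)\in\mathbb R^{n-1}\times\mathbb R$. Let $\Sigma\subset\mathbb R^{n-1}$ be a bounded Lipschitz domain, $\Omega=\Sigma\times(-H,H)$, $Y=(0,1)^{n-1}$, $Z=Y\times(-1,1)$, and let $Z^*\subset Z$ be a connected open Lipschitz set such that $S_*^\pm=\{y\in\partial Z^*: y_n=\pm1\}$ are $(n-1)$-dimensional Lipschitz domains of positive measure and $N=\partial Z^*\setminus(S_*^+\cup S_*^-)$ has positive distance to the lateral boundary of $Z$. For $\epsilon\in(0,H)$ with $\epsilon^{-1}\in\mathbb N$ put $\Omega_\epsilon^+=\Sigma\times(\epsilon,H)$, $\Omega_\epsilon^-=\Sigma\times(-H,-\epsilon)$, $I_\epsilon=\{\bar k\in\mathbb Z^{n-1}:\epsilon(Z+(\bar k,0))\subset\Sigma\times(-\epsilon,\epsilon)\}$, $\Omega_{*,\epsilon}^M=\bigcup_{\bar k\in I_\epsilon}\epsilon(Z^*+(\bar k,0))$, and let $N_\epsilon$, $S_{*,\epsilon}^\pm$ be the corresponding unions of copies of $N$, $S_*^\pm$. Let $\Omega_\epsilon$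 be the (interior of the) union of $\Omega_\epsilon^\pm$, $\Omega_{*,\epsilon}^M$ and $S_{*,\epsilon}^\pm$. The space $\mathcal L_\epsilon=L^2(\Omega_\epsilon)$ carries the inner product $(w,v)_{\Omega_\epsilon^+}+(w,v)_{\Omega_\epsilon^-}+\frac1\epsilon(w,v)_{\Omega_{*,\epsilon}^M}$, and $\mathcal H_\epsilon=H^1(\Omega_\epsilon)$ the inner product $(w,v)_{\mathcal L_\epsilon}+(\nabla w,\nabla v)_{\Omega_\epsilon^+}+(\nabla w,\nabla v)_{\Omega_\epsilon^-}+\epsilon(\nabla w,\nabla v)_{\Omega_{*,\epsilon}^M}$; $\mathcal H_\epsilon\hookrightarrow\mathcal L_\epsilon\hookrightarrow\mathcal H_\epsilon'$. **Data.** $D^\pm>0$; $D^M\in L^\infty(Z^*)^{n\times n}$ is coercive; $f^\pm\in C^0([0,T]\times\overline\Omega\times\mathbb R)$, $g\in C^0([0,T]\times\overline{Z^*}\times\mathbb R)$ and $h_N\in C^0([0,T]\times\overline N\times\mathbb R)$ are Lipschitz continuous in the last variable, uniformly in the others; $D^M,g,h_N$ are extended $Y$-periodically in $\bar y$. The initial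 values are $u_{\epsilon,i}=u_i^\pm$ in $\Omega_\epsilon^\pm$ and $u_{\epsilon,i}(x)=u_i^M(\bar x,x/\epsilon)$ in $\Omega_{*,\epsilon}^M$ ($Y$-periodic extension in the second variable), with $u_i^+\in L^2(\Sigma\times(0,H))$, $u_i^-\in L^2(\Sigma\times(-H,0))$, $u_i^M\in L^2(\Sigma,C^0(\overline{Z^*}))$. **Weak solution.** $u_\epsilon\in L^2((0,T),\mathcal H_\epsilon)\cap H^1((0,T),\mathcal H_\epsilon')$ such that, for all $\phi\in\mathcal H_\epsilon$ and a.e. $t\in(0,T)$, $$\langle\partial_tu_\epsilon,\phi\rangle+\sum_\pm D^\pm(\nabla u_\epsilon,\nabla\phi)_{\Omega_\epsilon^\pm}+\epsilon\big(D^M(\tfrac{\cdot}{\epsilon})\nabla u_\epsilon,\nabla\phi\big)_{\Omega_{*,\epsilon}^M}=\sum_\pm(f^\pm(t,\cdot,u_\epsilon),\phi)_{\Omega_\epsilon^\pm}+\tfrac1\epsilon\big(g(t,\tfrac{\cdot}{\epsilon},u_\epsilon),\phi\big)_{\Omega_{*,\epsilon}^M}-\big(h_N(t,\tfrac{\cdot}{\epsilon},u_\epsilon),\phi\big)_{N_\epsilon},$$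 with traces on $N_\epsilon$ in the last term, and $u_\epsilon(0)=u_{\epsilon,i}$. **Interior domains.** For $\eta>0$ let $\Sigma_\eta=\{x\in\Sigma:\operatorname{dist}(x,\partial\Sigma)>\eta\}$, $\Omega_{\epsilon,\eta}^\pm=\Omega_\epsilon^\pm\cap(\Sigma_\eta\times(-H,H))$, let $\widehat\Sigma_\eta$ be the interior of the union of all $\epsilon(\overline Y+\bar k)$, $\bar k\in\mathbb Z^{n-1}$, with $\epsilon(Y+\bar k)\subset\Sigma_\eta$, and $\widehat\Omega_{*,\epsilon,\eta}^M=\Omega_{*,\epsilon}^M\cap(\widehat\Sigma_\eta\times(-\epsilon,\epsilon))$. Let $\|\cdot\|_{\mathcal L_{\epsilon,\eta}}$ be the $\mathcal L_\epsilon$-norm over the part of $\Omega_\epsilon$ consisting of $\widehat\Sigma_\eta\times(\epsilon,H)$, $\widehat\Omega_{*,\epsilon,\eta}^M$ and $\widehat\Sigma_\eta\times(-H,-\epsilon)$. For $l\in\mathbb Z^{n-1}\times\{0\}$ put $\delta v(x)=v(x+\epsilon l)-v(x)$. **Lemma.** For every $h>0$ there is $C=C(h)>0$ (depending also on the data, but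 not on $\epsilon$ and $l$) such that for all $\epsilon\in(0,H)$ with $\epsilon^{-1}\in\mathbb N$, every weak solution $u_\epsilon$, and all $l\in\mathbb Z^{n-1}\times\{0\}$ with $|\epsilon l|<h$: (i) if $f^\pm$ do not depend on $\bar x$ (they depend on $x$ at most through $x_n$), then $$\frac1{\sqrt\epsilon}\|\delta u_\epsilon\|_{L^\infty((0,T),L^2(\widehat\Omega_{*,\epsilon,2h}^M))}+\sqrt\epsilon\,\|\nabla\delta u_\epsilon\|_{L^2((0,T)\times\widehat\Omega_{*,\epsilon,2h}^M)}\le C\Big(\epsilon+\|\delta u_\epsilon(0)\|_{\mathcal L_{\epsilon,h}}+\sum_\pm\|\delta u_\epsilon^\pm\|_{L^2((0,T)\times\Omega_{\epsilon,h}^\pm)}\Big);$$ (ii) for general $f^\pm$ the same estimate holds with the additional term $\sum_\pm\|f^\pm(t,x+\epsilon l,u_\epsilon^\pm(t,x))-f^\pm(t,x,u_\epsilon^\pm(t,x))\|_{L^2((0,T)\times\Omega_{\epsilon,h}^\pm)}$ inside the parentheses on the right. -/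

import Mathlib

open MeasureTheory Set
open scoped ENNReal NNReal ContDiff

namespace Channels

noncomputable section

/-- The Euclidean space `ℝ^m`.  The space dimension of the problem is `n = d + 1`. -/
abbrev E (m : ℕ) := EuclideanSpace ℝ (Fin m)

/-- The horizontal part `x̄ ∈ ℝ^d` of `x = (x̄, x_n) ∈ ℝ^(d+1)`. -/
def bar {d : ℕ} (x : E (d + 1)) : E d := WithLp.toLp 2 fun i => x i.castSucc

/-- The vertical coordinate `x_n` of `x = (x̄, x_n) ∈ ℝ^(d+1)`. -/
def vert {d : ℕ} (x : E (d + 1)) : ℝ := x (Fin.last d)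

/-- The point `(x̄, s) ∈ ℝ^(d+1)`. -/
def mkPt {d : ℕ} (x : E d) (s : ℝ) : E (d + 1) :=
  WithLp.toLp 2 (Fin.snoc (α := fun _ => ℝ) (fun i => x i) s)

/-- The set `B × I ⊆ ℝ^d × ℝ`. -/
def cyl {d : ℕ} (B : Set (E d)) (I : Set ℝ) : Set (E (d + 1)) := {x | bar x ∈ B ∧ vert x ∈ I}

/-- An integer vector as an element of `ℝ^d`. -/
def intVec {d : ℕ} (k : Fin d → ℤ) : E d := WithLp.toLp 2 fun i => (k i : ℝ)

/-- An open set that is, near each of its boundary points, the strict epigraph of a Lipschitz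
function in suitable Cartesian coordinates (`e` is the vertical direction of the coordinates). -/
def IsLipschitzDomain {m : ℕ} (U : Set (E m)) : Prop :=
  IsOpen U ∧ ∀ p ∈ frontier U, ∃ (e : E m) (γ : (Submodule.span ℝ {e})ᗮ → ℝ) (K : ℝ≥0) (r : ℝ),
    ‖e‖ = 1 ∧ LipschitzWith K γ ∧ 0 < r ∧
      ∀ x ∈ Metric.ball p r,
        (x ∈ U ↔ γ ((Submodule.span ℝ {e})ᗮ.orthogonalProjectionOnto x) < inner ℝ e x)

/-- The horizontal unit cell `Y = (0,1)^d`. -/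
def cellY (d : ℕ) : Set (E d) := {y | ∀ i, y i ∈ Ioo (0 : ℝ) 1}

/-- The standard cell `Z = Y × (-1,1)`. -/
def cellZ (d : ℕ) : Set (E (d + 1)) := cyl (cellY d) (Ioo (-1) 1)

/-- The value `+1` or `-1` of a sign (`true` stands for `+`, `false` for `-`). -/
def sgn (s : Bool) : ℝ := if s then 1 else -1

/-- The top (`+`) or bottom (`-`) `{y ∈ ∂Zs : y_n = ±1}` of a channel domain `Zs`. -/
def topBot {d : ℕ} (Zs : Set (E (d + 1))) (s : Bool) : Set (E (d + 1)) :=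
  {y | y ∈ frontier Zs ∧ vert y = sgn s}

/-- The lateral boundary `N` of a channel domain `Zs`. -/
def lateral {d : ℕ} (Zs : Set (E (d + 1))) : Set (E (d + 1)) :=
  frontier Zs \ (topBot Zs true ∪ topBot Zs false)

/-- The representative in the periodicity cell: horizontal coordinates are reduced modulo `1`.
A function `F` on (the closure of) `Zs` is extended `Y`-periodically by `y ↦ F (perRep y)`. -/
def perRep {d : ℕ} (y : E (d + 1)) : E (d + 1) :=
  mkPt (WithLp.toLp 2 fun i => Int.fract (bar y i)) (vert y)

/-- The data of the microscopic problem in space dimension `n = d + 1`. -/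
structure Problem (d : ℕ) where
  /-- final time -/
  T : ℝ
  /-- half height of the macroscopic domain -/
  H : ℝ
  /-- the cross section `Σ` -/
  Sig : Set (E d)
  /-- the standard channel domain -/
  Zs : Set (E (d + 1))
  /-- the bulk diffusion coefficients `D^±` -/
  D : Bool → ℝ
  /-- the diffusion matrix in the channels -/
  DM : E (d + 1) → Matrix (Fin (d + 1)) (Fin (d + 1)) ℝ
  /-- the bulk reaction rates `f^±(t, x, z)` -/
  f : Bool → ℝ → E (d + 1) → ℝ → ℝ
  /-- the reaction rate `g(t, y, z)` in the channels -/
  g : ℝ → E (d + 1) → ℝ → ℝ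
  /-- the reaction rate `h(t, y, z)` on the lateral surface of the channels -/
  hN : ℝ → E (d + 1) → ℝ → ℝ
  /-- the bulk initial values `u_i^±` -/
  uB : Bool → E (d + 1) → ℝ
  /-- the channel initial value `u_i^M`, a function on `Σ` with values in `C^0` of the closure of
  the standard channel (which is compact, so that continuous functions on it are bounded) -/
  uM : E d → BoundedContinuousFunction (closure Zs) ℝ

namespace Problem

variable {d : ℕ} (P : Problem d)

/-! ### Geometry -/

/-- The macroscopic domain `Ω = Σ × (-H,H)`. -/
def Om : Set (E (d + 1)) := cyl P.Sig (Ioo (-P.H) P.H)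

/-- The macroscopic bulk domains `Ω^+ = Σ × (0,H)` and `Ω^- = Σ × (-H,0)`. -/
def OmB (s : Bool) : Set (E (d + 1)) := cyl P.Sig (if s then Ioo 0 P.H else Ioo (-P.H) 0)

/-- The vertical extent `(ε,H)` or `(-H,-ε)` of the microscopic bulk domains. -/
def bulkIoo (ε : ℝ) (s : Bool) : Set ℝ := if s then Ioo ε P.H else Ioo (-P.H) (-ε)

/-- The microscopic bulk domains `Ω_ε^±`. -/
def bulk (ε : ℝ) (s : Bool) : Set (E (d + 1)) := cyl P.Sig (P.bulkIoo ε s)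

/-- The scaled and shifted copy `ε (A + (k,0))` of `A`. -/
def _root_.Channels.copy {d : ℕ} (ε : ℝ) (k : Fin d → ℤ) (A : Set (E (d + 1))) :
    Set (E (d + 1)) := (fun y => ε • (y + mkPt (intVec k) 0)) '' A

/-- The index set `I_ε`: the cells `ε (Z + (k,0))` inside the layer `Σ × (-ε,ε)`. -/
def idx (ε : ℝ) : Set (Fin d → ℤ) := {k | copy ε k (cellZ d) ⊆ cyl P.Sig (Ioo (-ε) ε)}

/-- The channel domain `Ω_{*,ε}^M`. -/
def chan (ε : ℝ) : Set (E (d + 1)) := ⋃ k ∈ P.idx ε, copy ε k P.Zs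

/-- The interfaces `S_{*,ε}^±`. -/
def iface (ε : ℝ) (s : Bool) : Set (E (d + 1)) := ⋃ k ∈ P.idx ε, copy ε k (topBot P.Zs s)

/-- The lateral boundary `N_ε` of the channels. -/
def chanN (ε : ℝ) : Set (E (d + 1)) := ⋃ k ∈ P.idx ε, copy ε k (lateral P.Zs)

/-- The microscopic domain `Ω_ε`: the interior of the union of the bulk domains, the channels and
the interfaces.  (Taking the interior only removes the edges of the interfaces.) -/
def Oe (ε : ℝ) : Set (E (d + 1)) :=
  interior (P.bulk ε true ∪ P.bulk ε false ∪ P.chan ε ∪ (P.iface ε true ∪ P.iface ε false))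

/-! ### Assumptions on the data -/

/-- The assumptions on the geometry and on the data. -/
structure Admissible : Prop where
  T_pos : 0 < P.T
  H_pos : 0 < P.H
  sig_bounded : Bornology.IsBounded P.Sig
  sig_connected : IsConnected P.Sig
  sig_lipschitz : IsLipschitzDomain P.Sig
  zs_subset : P.Zs ⊆ cellZ d
  zs_connected : IsConnected P.Zs
  zs_lipschitz : IsLipschitzDomain P.Zs
  /-- top and bottom of the channel are `d`-dimensional Lipschitz domains of positive measure -/
  topBot_lipschitz : ∀ s, IsLipschitzDomain (interior {x : E d | mkPt x (sgn s) ∈ topBot P.Zs s})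
  topBot_pos : ∀ s, 0 < volume {x : E d | mkPt x (sgn s) ∈ topBot P.Zs s}
  /-- the lateral boundary has positive distance to the lateral boundary of the cell -/
  lateral_dist : ∃ ρ > 0, ∀ y ∈ lateral P.Zs, ∀ z ∈ frontier (cellZ d),
    z ∉ cyl (cellY d) {1} ∪ cyl (cellY d) {-1} → ρ ≤ dist y z
  D_pos : ∀ s, 0 < P.D s
  DM_bounded : ∀ i j, MemLp (fun y => P.DM y i j) ∞ (volume.restrict P.Zs)
  DM_coercive : ∃ c₀ > 0, ∀ᵐ y ∂volume.restrict P.Zs, ∀ ξ : E (d + 1),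
    c₀ * ‖ξ‖ ^ 2 ≤ inner ℝ ((P.DM y).toEuclideanLin ξ) ξ
  f_cont : ∀ s, ContinuousOn (fun p : ℝ × E (d + 1) × ℝ => P.f s p.1 p.2.1 p.2.2)
    (Icc 0 P.T ×ˢ closure P.Om ×ˢ univ)
  f_lipschitz : ∀ s, ∃ L : ℝ≥0, ∀ t ∈ Icc 0 P.T, ∀ x ∈ closure P.Om, LipschitzWith L (P.f s t x)
  g_cont : ContinuousOn (fun p : ℝ × E (d + 1) × ℝ => P.g p.1 p.2.1 p.2.2)
    (Icc 0 P.T ×ˢ closure P.Zs ×ˢ univ)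
  g_lipschitz : ∃ L : ℝ≥0, ∀ t ∈ Icc 0 P.T, ∀ y ∈ closure P.Zs, LipschitzWith L (P.g t y)
  hN_cont : ContinuousOn (fun p : ℝ × E (d + 1) × ℝ => P.hN p.1 p.2.1 p.2.2)
    (Icc 0 P.T ×ˢ closure (lateral P.Zs) ×ˢ univ)
  hN_lipschitz : ∃ L : ℝ≥0, ∀ t ∈ Icc 0 P.T, ∀ y ∈ closure (lateral P.Zs),
    LipschitzWith L (P.hN t y)
  uB_memLp : ∀ s, MemLp (P.uB s) 2 (volume.restrict (P.OmB s))
  uM_memLp : MemLp P.uM 2 (volume.restrict P.Sig)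

open Classical in
/-- The initial value `u_{ε,i}`: `u_i^±(x)` in the bulk domains and `u_i^M(x̄, x/ε)` in the channels
(with `u_i^M(x̄, ·)` extended `Y`-periodically), zero elsewhere. -/
def init (ε : ℝ) (x : E (d + 1)) : ℝ :=
  if x ∈ P.bulk ε true then P.uB true x
  else if x ∈ P.bulk ε false then P.uB false x
  else if x ∈ P.chan ε then
    if hy : perRep (ε⁻¹ • x) ∈ closure P.Zs then P.uM (bar x) ⟨_, hy⟩ else 0
  else 0

/-! ### Function spaces -/

/-- Lebesgue measure on `Ω_ε`, multiplied by the constant `c` in the channels.  The interfaces are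
null sets, and `L²` of this measure is the product of the `L²` spaces of the three compartments. -/
def wvol (ε c : ℝ) : Measure (E (d + 1)) :=
  volume.restrict (P.bulk ε true) + volume.restrict (P.bulk ε false) +
    ENNReal.ofReal c • volume.restrict (P.chan ε)

/-- The space `𝓛_ε = L²(Ω_ε)` with the inner product
`(w,v)_{Ω_ε^+} + (w,v)_{Ω_ε^-} + ε⁻¹ (w,v)_{Ω_{*,ε}^M}`. -/
abbrev Leps (ε : ℝ) := Lp ℝ 2 (P.wvol ε ε⁻¹)

/-- The space of gradients, with the inner product
`(w,v)_{Ω_ε^+} + (w,v)_{Ω_ε^-} + ε (w,v)_{Ω_{*,ε}^M}`. -/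
abbrev Geps (ε : ℝ) := Lp (E (d + 1)) 2 (P.wvol ε ε)

/-- `G` is the weak gradient of `v` in the open set `U`. -/
def _root_.Channels.IsWeakGradient {m : ℕ} (U : Set (E m)) (v : E m → ℝ) (G : E m → E m) : Prop :=
  ∀ φ : E m → ℝ, ContDiff ℝ ∞ φ → HasCompactSupport φ → tsupport φ ⊆ U → ∀ e : E m,
    ∫ x in U, v x * fderiv ℝ φ x e = - ∫ x in U, φ x * inner ℝ (G x) e

lemma volume_vert_eq {d : ℕ} (c : ℝ) : volume {x : E (d + 1) | vert x = c} = 0 := by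
  have h := (PiLp.volume_preserving_ofLp (Fin (d + 1))).measure_preimage
    (s := {y : Fin (d + 1) → ℝ | y (Fin.last d) = c})
    (measurableSet_eq_fun (measurable_pi_apply _) measurable_const).nullMeasurableSet
  have h0 : volume {y : Fin (d + 1) → ℝ | y (Fin.last d) = c} = 0 :=
    Measure.pi_hyperplane (fun _ : Fin (d + 1) => (volume : Measure ℝ)) (Fin.last d) c
  rw [h0] at h
  exact h

lemma iface_null (ε : ℝ) (s : Bool) : volume (P.iface ε s) = 0 := by
  refine measure_mono_null ?_ (volume_vert_eq (d := d) (ε * sgn s))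
  intro x hx
  simp only [iface, copy, mem_iUnion, mem_image] at hx
  obtain ⟨k, _, y, hy, rfl⟩ := hx
  have h : vert y = sgn s := hy.2
  simp only [mem_ofPred_eq, ← h]
  simp [vert, mkPt]

lemma restrict_Oe_le (ε c : ℝ) (hc : 0 < c) :
    volume.restrict (P.Oe ε) ≤ (1 + (ENNReal.ofReal c)⁻¹) • P.wvol ε c := by
  have hS : volume.restrict (P.iface ε true ∪ P.iface ε false) = 0 := by
    rw [Measure.restrict_eq_zero]
    exact measure_union_null (P.iface_null ε true) (P.iface_null ε false)
  have hc0 : ENNReal.ofReal c ≠ 0 := by simpa using hc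
  have h1 : volume.restrict (P.Oe ε) ≤ volume.restrict (P.bulk ε true) +
      volume.restrict (P.bulk ε false) + volume.restrict (P.chan ε) := by
    refine (Measure.restrict_mono interior_subset le_rfl).trans ?_
    refine (Measure.restrict_union_le _ _).trans ?_
    rw [hS, add_zero]
    refine (Measure.restrict_union_le _ _).trans ?_
    gcongr
    exact Measure.restrict_union_le _ _
  refine h1.trans ?_
  rw [wvol, smul_add, smul_smul, add_mul, ENNReal.inv_mul_cancel hc0 ENNReal.ofReal_ne_top]
  gcongr
  · intro A
    simp only [Measure.smul_apply, smul_eq_mul]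
    exact le_mul_of_one_le_left zero_le (le_self_add)
  · intro A
    simp only [Measure.smul_apply, smul_eq_mul]
    exact le_mul_of_one_le_left zero_le (le_add_self)

lemma memLp_Oe {F : Type*} [NormedAddCommGroup F] {ε c : ℝ} (hc : 0 < c) {v : E (d + 1) → F}
    (hv : MemLp v 2 (P.wvol ε c)) : MemLp v 2 (volume.restrict (P.Oe ε)) :=
  hv.of_measure_le_smul (by simp [hc]) (P.restrict_Oe_le ε c hc)

lemma ae_Oe {ε c : ℝ} (hc : 0 < c) {p : E (d + 1) → Prop} (h : ∀ᵐ x ∂P.wvol ε c, p x) :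
    ∀ᵐ x ∂volume.restrict (P.Oe ε), p x :=
  ((Measure.absolutelyContinuous_of_le (P.restrict_Oe_le ε c hc)).trans
    Measure.smul_absolutelyContinuous).ae_le h

lemma _root_.Channels.IsWeakGradient.congr {m : ℕ} {U : Set (E m)} {v v' : E m → ℝ}
    {G G' : E m → E m} (h : IsWeakGradient U v G) (hv : v' =ᵐ[volume.restrict U] v)
    (hG : G' =ᵐ[volume.restrict U] G) : IsWeakGradient U v' G' := by
  intro φ h1 h2 h3 e
  have e1 : ∫ x in U, v' x * fderiv ℝ φ x e = ∫ x in U, v x * fderiv ℝ φ x e :=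
    integral_congr_ae (hv.mono fun x hx => by simp only [hx])
  have e2 : ∫ x in U, φ x * inner ℝ (G' x) e = ∫ x in U, φ x * inner ℝ (G x) e :=
    integral_congr_ae (hG.mono fun x hx => by simp only [hx])
  rw [e1, e2]
  exact h φ h1 h2 h3 e

lemma _root_.Channels.IsWeakGradient.zero {m : ℕ} {U : Set (E m)} :
    IsWeakGradient U (fun _ => 0) (fun _ => 0) := by
  intro φ _ _ _ e
  simp

lemma _root_.Channels.IsWeakGradient.smul {m : ℕ} {U : Set (E m)} {v : E m → ℝ} {G : E m → E m}
    (h : IsWeakGradient U v G) (a : ℝ) :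
    IsWeakGradient U (fun x => a * v x) (fun x => a • G x) := by
  intro φ h1 h2 h3 e
  have := h φ h1 h2 h3 e
  simp only [inner_smul_left, RCLike.conj_to_real, mul_assoc, mul_left_comm _ a]
  rw [integral_const_mul, integral_const_mul, this, mul_neg]

lemma _root_.Channels.IsWeakGradient.add {m : ℕ} {U : Set (E m)} {v v' : E m → ℝ}
    {G G' : E m → E m} (h : IsWeakGradient U v G) (h' : IsWeakGradient U v' G')
    (hv : MemLp v 2 (volume.restrict U)) (hv' : MemLp v' 2 (volume.restrict U))
    (hG : MemLp G 2 (volume.restrict U)) (hG' : MemLp G' 2 (volume.restrict U)) :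
    IsWeakGradient U (fun x => v x + v' x) (fun x => G x + G' x) := by
  intro φ h1 h2 h3 e
  have hφ : MemLp φ 2 (volume.restrict U) := h1.continuous.memLp_of_hasCompactSupport h2
  have hdc : Continuous fun x => fderiv ℝ φ x e :=
    (h1.continuous_fderiv (by simp)).clm_apply continuous_const
  have hd : MemLp (fun x => fderiv ℝ φ x e) 2 (volume.restrict U) :=
    hdc.memLp_of_hasCompactSupport (h2.fderiv_apply ℝ e)
  simp only [add_mul, inner_add_left, mul_add]
  have e1 : ∫ x in U, (v x * fderiv ℝ φ x e + v' x * fderiv ℝ φ x e) =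
      (∫ x in U, v x * fderiv ℝ φ x e) + ∫ x in U, v' x * fderiv ℝ φ x e :=
    integral_add (hv.integrable_mul hd) (hv'.integrable_mul hd)
  have e2 : ∫ x in U, (φ x * inner ℝ (G x) e + φ x * inner ℝ (G' x) e) =
      (∫ x in U, φ x * inner ℝ (G x) e) + ∫ x in U, φ x * inner ℝ (G' x) e :=
    integral_add (hφ.integrable_mul (hG.inner_const e)) (hφ.integrable_mul (hG'.inner_const e))
  rw [e1, e2, h φ h1 h2 h3 e, h' φ h1 h2 h3 e, neg_add]

/-- The space `𝓗_ε = H¹(Ω_ε)`: pairs of a function and its weak gradient, with the inner product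
`(w,v)_{𝓛_ε} + (∇w,∇v)_{Ω_ε^+} + (∇w,∇v)_{Ω_ε^-} + ε (∇w,∇v)_{Ω_{*,ε}^M}`. -/
def Heps (ε : ℝ) (hε : 0 < ε) : Submodule ℝ (WithLp 2 (P.Leps ε × P.Geps ε)) where
  carrier := {p | IsWeakGradient (P.Oe ε) p.fst p.snd}
  zero_mem' := by
    refine IsWeakGradient.zero.congr ?_ ?_
    · exact P.ae_Oe (inv_pos.2 hε) (Lp.coeFn_zero ℝ 2 _)
    · exact P.ae_Oe hε (Lp.coeFn_zero (E (d + 1)) 2 _)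
  add_mem' := by
    intro p q hp hq
    refine (IsWeakGradient.add hp hq (P.memLp_Oe (inv_pos.2 hε) (Lp.memLp _))
      (P.memLp_Oe (inv_pos.2 hε) (Lp.memLp _)) (P.memLp_Oe hε (Lp.memLp _))
      (P.memLp_Oe hε (Lp.memLp _))).congr ?_ ?_
    · exact P.ae_Oe (inv_pos.2 hε) (Lp.coeFn_add p.fst q.fst)
    · exact P.ae_Oe hε (Lp.coeFn_add p.snd q.snd)
  smul_mem' := by
    intro a p hp
    refine (IsWeakGradient.smul hp a).congr ?_ ?_
    · exact P.ae_Oe (inv_pos.2 hε) (Lp.coeFn_smul a p.fst)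
    · exact P.ae_Oe hε (Lp.coeFn_smul a p.snd)

variable {P} in
/-- The function underlying an element of `𝓗_ε`, as an element of `𝓛_ε`. -/
def val {ε : ℝ} {hε : 0 < ε} (v : P.Heps ε hε) : P.Leps ε := v.1.fst

variable {P} in
/-- The weak gradient of an element of `𝓗_ε`. -/
def grad {ε : ℝ} {hε : 0 < ε} (v : P.Heps ε hε) : P.Geps ε := v.1.snd

/-- `b` is the trace on `N` of the function `v ∈ H¹(U)` with weak gradient `G`: the pair `(v, b)` is
a limit, in `H¹(U) × L²(N)`, of pairs `(φ|_U, φ|_N)` with `φ` smooth.  On `N` the measure is the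
`(m-1)`-dimensional surface measure. -/
def _root_.Channels.IsTrace {m : ℕ} (U N : Set (E m)) (v : E m → ℝ) (G : E m → E m)
    (b : E m → ℝ) : Prop :=
  MemLp b 2 (μHE[m - 1].restrict N) ∧ ∀ δ : ℝ≥0∞, 0 < δ → ∃ φ : E m → ℝ, ContDiff ℝ ∞ φ ∧
    eLpNorm (fun x => φ x - v x) 2 (volume.restrict U) < δ ∧
    eLpNorm (fun x => gradient φ x - G x) 2 (volume.restrict U) < δ ∧
    eLpNorm (fun x => φ x - b x) 2 (μHE[m - 1].restrict N) < δ

variable {P} in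
open Classical in
/-- The trace on `N_ε` of an element of `𝓗_ε`. -/
def trN {ε : ℝ} {hε : 0 < ε} (v : P.Heps ε hε) : E (d + 1) → ℝ :=
  if h : ∃ b, IsTrace (P.chan ε) (P.chanN ε) (val v) (grad v) b then h.choose else 0

/-! ### Weak solutions -/

/-- `w` is the weak time derivative of `u` on `(0,T)` with values in the dual of `𝓗_ε`, with respect
to the embedding `𝓗_ε ↪ 𝓛_ε ↪ 𝓗_ε'` given by the inner product of `𝓛_ε`. -/
def IsTimeDeriv {ε : ℝ} {hε : 0 < ε} (u : ℝ → P.Heps ε hε)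
    (w : ℝ → StrongDual ℝ (P.Heps ε hε)) : Prop :=
  ∀ ψ : ℝ → ℝ, ContDiff ℝ ∞ ψ → HasCompactSupport ψ → tsupport ψ ⊆ Ioo 0 P.T →
    ∀ φ : P.Heps ε hε,
      ∫ t in Ioo 0 P.T, deriv ψ t * inner ℝ (val (u t)) (val φ) =
        - ∫ t in Ioo 0 P.T, ψ t * w t φ

/-- `u` is a weak solution of the microscopic problem:
`u ∈ L²((0,T),𝓗_ε) ∩ H¹((0,T),𝓗_ε')`, the variational equation holds for every test function at
almost every time, and `u(0) = u_{ε,i}` for the representative of `u` in `C⁰([0,T],𝓛_ε)`. -/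
def IsWeakSolution (ε : ℝ) (hε : 0 < ε) (u : ℝ → P.Heps ε hε) : Prop :=
  MemLp u 2 (volume.restrict (Ioo 0 P.T)) ∧
  (∃ w : ℝ → StrongDual ℝ (P.Heps ε hε),
    MemLp w 2 (volume.restrict (Ioo 0 P.T)) ∧ P.IsTimeDeriv u w ∧
    ∀ φ : P.Heps ε hε, ∀ᵐ t ∂volume.restrict (Ioo 0 P.T),
      w t φ + (∑ s, P.D s * (∫ x in P.bulk ε s, inner ℝ (grad (u t) x) (grad φ x)))
        + ε * (∫ x in P.chan ε,
            inner ℝ ((P.DM (perRep (ε⁻¹ • x))).toEuclideanLin (grad (u t) x)) (grad φ x))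
      = (∑ s, (∫ x in P.bulk ε s, P.f s t x (val (u t) x) * val φ x))
        + ε⁻¹ * (∫ x in P.chan ε, P.g t (perRep (ε⁻¹ • x)) (val (u t) x) * val φ x)
        - (∫ x in P.chanN ε, P.hN t (perRep (ε⁻¹ • x)) (trN (u t) x) * trN φ x ∂μHE[d])) ∧
  ∃ v : ℝ → P.Leps ε, ContinuousOn v (Icc 0 P.T) ∧
    (∀ᵐ t ∂volume.restrict (Ioo 0 P.T), v t = val (u t)) ∧
    v 0 =ᵐ[P.wvol ε ε⁻¹] P.init ε

/-! ### Shifts, interior domains and norms -/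

variable {P} in
/-- A representative of `u ∈ 𝓗_ε`, extended by zero outside `Ω_ε`. -/
def ext {ε : ℝ} {hε : 0 < ε} (u : P.Heps ε hε) : E (d + 1) → ℝ := (P.Oe ε).indicator (val u)

variable {P} in
/-- A representative of `∇u`, `u ∈ 𝓗_ε`, extended by zero outside `Ω_ε`. -/
def extGrad {ε : ℝ} {hε : 0 < ε} (u : P.Heps ε hε) : E (d + 1) → E (d + 1) :=
  (P.Oe ε).indicator (grad u)

/-- The shift vector `ε l`, for `l ∈ ℤ^d × {0}`. -/
def _root_.Channels.shiftVec {d : ℕ} (ε : ℝ) (l : Fin d → ℤ) : E (d + 1) :=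
  ε • mkPt (intVec l) 0

/-- The difference `δv(x) = v(x + ε l) - v(x)`, for `l ∈ ℤ^d × {0}`. -/
def _root_.Channels.shiftDiff {d : ℕ} {F : Type*} [Sub F] (ε : ℝ) (l : Fin d → ℤ)
    (v : E (d + 1) → F) (x : E (d + 1)) : F := v (x + shiftVec ε l) - v x

/-- `Σ_η`: the points of `Σ` whose distance to `∂Σ` exceeds `η`. -/
def SigI (η : ℝ) : Set (E d) := {x | x ∈ P.Sig ∧ η < Metric.infDist x (frontier P.Sig)}

/-- `Ω_{ε,η}^± = Ω_ε^± ∩ (Σ_η × (-H,H))`. -/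
def bulkI (ε η : ℝ) (s : Bool) : Set (E (d + 1)) :=
  P.bulk ε s ∩ cyl (P.SigI η) (Ioo (-P.H) P.H)

/-- The set `ε (A + k)`, for `A ⊆ ℝ^d` and `k ∈ ℤ^d`. -/
def _root_.Channels.copyBar {d : ℕ} (ε : ℝ) (k : Fin d → ℤ) (A : Set (E d)) : Set (E d) :=
  (fun y => ε • (y + intVec k)) '' A

/-- `Σ̂_η` (depending on `ε`): the interior of the union of the closures of the cells `ε (Y + k)` that
are contained in `Σ_η`. -/
def SigHat (ε η : ℝ) : Set (E d) :=
  interior (⋃ k ∈ {k : Fin d → ℤ | copyBar ε k (cellY d) ⊆ P.SigI η},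
    copyBar ε k (closure (cellY d)))

/-- `Ω̂_{*,ε,η}^M`: the channels in `Σ̂_η × (-ε,ε)`. -/
def chanHat (ε η : ℝ) : Set (E (d + 1)) := P.chan ε ∩ cyl (P.SigHat ε η) (Ioo (-ε) ε)

/-- `Ω̂_{ε,η}^±`. -/
def bulkHat (ε η : ℝ) (s : Bool) : Set (E (d + 1)) := cyl (P.SigHat ε η) (P.bulkIoo ε s)

/-- The norm of `𝓛_{ε,η} = L²(Ω̂_{ε,η}^+) × L²(Ω̂_{*,ε,η}^M) × L²(Ω̂_{ε,η}^-)`, with the scaled inner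
product of `𝓛_ε`. -/
def normLI (ε η : ℝ) (v : E (d + 1) → ℝ) : ℝ≥0∞ :=
  eLpNorm v 2 ((P.wvol ε ε⁻¹).restrict
    (P.bulkHat ε η true ∪ P.chanHat ε η ∪ P.bulkHat ε η false))

/-- The norm of `L^p((0,T), L²(U))`; for `p = 2` this is the norm of `L²((0,T) × U)`. -/
def normLpL2 {F : Type*} [NormedAddCommGroup F] (p : ℝ≥0∞) (U : Set (E (d + 1)))
    (v : ℝ → E (d + 1) → F) : ℝ≥0∞ :=
  eLpNorm (fun t => eLpNorm (v t) 2 (volume.restrict U)) p (volume.restrict (Ioo 0 P.T))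

/-- The bulk reaction rates do not depend on the horizontal variable: `f^±(t,x,z)` depends on `x`
only through `x_n`. -/
def HorizontallyHomogeneous : Prop :=
  ∀ s, ∀ t ∈ Icc 0 P.T, ∀ x ∈ closure P.Om, ∀ y ∈ closure P.Om, vert x = vert y →
    P.f s t x = P.f s t y

variable {P} in
/-- `ε^{-1/2} ‖δu‖_{L^∞((0,T), L²(Ω̂_{*,ε,2η}^M))} + ε^{1/2} ‖∇δu‖_{L²((0,T) × Ω̂_{*,ε,2η}^M)}`. -/
def chanShiftNorm (η : ℝ) {ε : ℝ} {hε : 0 < ε} (u : ℝ → P.Heps ε hε) (l : Fin d → ℤ) : ℝ≥0∞ :=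
  ENNReal.ofReal (1 / √ε) *
      P.normLpL2 ∞ (P.chanHat ε (2 * η)) (fun t => shiftDiff ε l (ext (u t))) +
    ENNReal.ofReal (√ε) *
      P.normLpL2 2 (P.chanHat ε (2 * η)) (fun t => shiftDiff ε l (extGrad (u t)))

variable {P} in
/-- `∑_± ‖δu^±‖_{L²((0,T) × Ω_{ε,η}^±)}`. -/
def bulkShiftNorm (η : ℝ) {ε : ℝ} {hε : 0 < ε} (u : ℝ → P.Heps ε hε) (l : Fin d → ℤ) : ℝ≥0∞ :=
  ∑ s, P.normLpL2 2 (P.bulkI ε η s) (fun t => shiftDiff ε l (ext (u t)))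

variable {P} in
/-- `∑_± ‖f^±(t, x + ε l, u^±(t,x)) - f^±(t, x, u^±(t,x))‖_{L²((0,T) × Ω_{ε,η}^±)}`. -/
def rateShiftNorm (η : ℝ) {ε : ℝ} {hε : 0 < ε} (u : ℝ → P.Heps ε hε) (l : Fin d → ℤ) : ℝ≥0∞ :=
  ∑ s, P.normLpL2 2 (P.bulkI ε η s) (fun t x =>
    P.f s t (x + shiftVec ε l) (ext (u t) x) - P.f s t x (ext (u t) x))

end Problem
end
end Channels

/-!
The estimate is an energy estimate for the difference `δu(x) = u(x + εl) - u(x)`, localized away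
from the lateral boundary of `Ω_ε`.

Let `η` be a cut-off function that depends on `x̄` only, equals one on the channels over `Σ_{2h}`,
lives on cells in `Σ_h`, has a gradient bounded uniformly in `ε`, and is constant on each channel
(`Cutoff`, `Problem.exists_cutoff`).  Such a function exists because the channels keep a positive
distance from the lateral faces of their cells (`Problem.Admissible.exists_margin`): one chooses a
slowly varying function on the lattice and interpolates it smoothly near the faces
(`exists_lattice_cutoff`).  On the support of `η`, the bulk domains, the channels, their lateral
surfaces and the coefficients are invariant under the translation by `εl`, so differences can be
summed by parts: for `δ* q(x) = q(x - εl) - q(x)`, one has `∫ f δ* q = ∫ δf q` if `q` vanishes where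
`η` does (`ShiftInv.integral_inner_backDiff`).

The weak formulation is tested with the second difference `δ*(η² δu)`, which belongs to `H¹(Ω_ε)`
(`IsWeakGradient.backDiff`, `Problem.Cutoff.exists_testOperators`).  Summing by parts, the terms are
the following.

* The time derivative gives half the derivative of the energy `‖η δu‖²` in `𝓛_ε`
  (`inner_sub_inner_eq_two_mul_integral`).
* The diffusion in the channels bounds `ε ‖η ∇δu‖²` by coercivity, without any error, since `∇η = 0`
  there.  In the bulk, `∇η` produces the error `C ‖δu‖²`, which the right-hand side of the estimate
  permits.
* The reaction terms are bounded by the energy, because of the Lipschitz continuity of the rates,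
  and by the oscillation of `f^±` in the direction of the shift
  (`ShiftInv.abs_integral_mul_backDiff_le`).
* The term on the lateral surfaces is bounded by `‖η δu‖²` on `N_ε`.  The scaled trace inequality
  `‖v‖²_{N_ε} ≤ C_θ ε⁻¹ ‖v‖² + θ² ε ‖∇v‖²` in the channels, with `θ` arbitrarily small
  (`Problem.Admissible.exists_isTrace_le`), lets the coercivity absorb the gradient.

This is `Problem.Admissible.exists_tested_le`, and Grönwall's inequality concludes
(`energy_dissipation_le`, `Problem.Admissible.exists_energy_estimate`).  The first part of the
theorem is the second one for rates whose oscillation vanishes.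

Two points need care.  The weak formulation holds, for each fixed test function, at almost every
time, while the test function here depends on time; as `u` has an essentially separable range, a
countable set of test functions suffices (`ae_apply_eq_zero`).  And the trace on `N_ε` is defined to
be zero for functions that have none; either every function in `H¹(Ω_ε)` has a trace, or the
boundary term vanishes for all test functions (`Problem.Admissible.tested_equation`), and the
estimate holds in both cases.
-/

set_option linter.unusedSectionVars false

namespace Channels

noncomputable section

section

/-! ### Translations of measures and of square integrable functions -/

section Shift

variable {X : Type*} [NormedAddCommGroup X] [MeasurableSpace X] [BorelSpace X]

/-- The translation by `s` carries the part of `m` on `S` to the part of `m` on `S + s`. -/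
def ShiftInv (m : Measure X) (S : Set X) (s : X) : Prop :=
  (m.restrict S).map (· + s) = m.restrict {x | x - s ∈ S}

lemma measurableSet_sub_mem {S : Set X} (hS : MeasurableSet S) (s : X) :
    MeasurableSet {x | x - s ∈ S} :=
  (Homeomorph.subRight s).measurableEmbedding.measurable hS

lemma ShiftInv.add {m m' : Measure X} {S : Set X} {s : X} (h : ShiftInv m S s)
    (h' : ShiftInv m' S s) : ShiftInv (m + m') S s := by
  unfold ShiftInv at *
  rw [Measure.restrict_add, Measure.map_add _ _ (measurable_add_const s), h, h',
    Measure.restrict_add]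

lemma ShiftInv.smul {m : Measure X} {S : Set X} {s : X} (h : ShiftInv m S s) (c : ℝ≥0∞) :
    ShiftInv (c • m) S s := by
  unfold ShiftInv at *
  rw [Measure.restrict_smul, Measure.map_smul, h, Measure.restrict_smul]

lemma shiftInv_zero (m : Measure X) (S : Set X) : ShiftInv m S 0 := by
  simp [ShiftInv]

lemma ShiftInv.symm {m : Measure X} {S : Set X} {s : X} (h : ShiftInv m S s) :
    ShiftInv m {x | x - s ∈ S} (-s) := by
  unfold ShiftInv at *
  rw [← h, Measure.map_map (measurable_add_const _) (measurable_add_const _)]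
  have e1 : ((fun x => x + -s) ∘ fun x : X => x + s) = id := by ext x; simp
  rw [e1, Measure.map_id]
  simp

/-- If `A` is, inside `S`, invariant under the translation by `s`, then so is the restriction to `A` of
a translation invariant measure. -/
lemma shiftInv_restrict {m : Measure X} [m.IsAddRightInvariant] {A S : Set X} {s : X}
    (hA : MeasurableSet A) (hS : MeasurableSet S) (h : ∀ x ∈ S, (x + s ∈ A ↔ x ∈ A)) :
    ShiftInv (m.restrict A) S s := by
  unfold ShiftInv
  rw [Measure.restrict_restrict hS, Measure.restrict_restrict (measurableSet_sub_mem hS s)]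
  have e : S ∩ A = (fun x => x + s) ⁻¹' ({x | x - s ∈ S} ∩ A) := by
    ext x
    simp only [mem_inter_iff, mem_preimage, mem_ofPred_eq, add_sub_cancel_right]
    exact ⟨fun hx => ⟨hx.1, (h x hx.1).2 hx.2⟩, fun hx => ⟨hx.1, (h x hx.1).1 hx.2⟩⟩
  rw [e, ← Measure.restrict_map (measurable_add_const s)
    ((measurableSet_sub_mem hS s).inter hA), map_add_right_eq_self]

lemma ShiftInv.ae {m : Measure X} {S : Set X} {s : X} (h : ShiftInv m S s)
    (hS : MeasurableSet S) {p : X → Prop} (hp : ∀ᵐ x ∂m, p x) :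
    ∀ᵐ x ∂m, x ∈ S → p (x + s) := by
  rw [← ae_restrict_iff' hS]
  have h1 : ∀ᵐ x ∂(m.restrict S).map (· + s), p x := by
    rw [h]
    exact ae_restrict_of_ae hp
  exact ae_of_ae_map (measurable_add_const s).aemeasurable h1

lemma ShiftInv.setLIntegral_shift {m : Measure X} {S : Set X} {s : X} (h : ShiftInv m S s)
    (f : X → ℝ≥0∞) : ∫⁻ x in S, f (x + s) ∂m = ∫⁻ x in {x | x - s ∈ S}, f x ∂m := by
  rw [← h]
  exact (lintegral_map_equiv f (MeasurableEquiv.addRight s)).symm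

lemma ShiftInv.setIntegral_shift {m : Measure X} {S : Set X} {s : X} (h : ShiftInv m S s)
    {F : Type*} [NormedAddCommGroup F] [NormedSpace ℝ F] (f : X → F) :
    ∫ x in S, f (x + s) ∂m = ∫ x in {x | x - s ∈ S}, f x ∂m := by
  rw [← h]
  exact (integral_map_equiv (MeasurableEquiv.addRight s) f).symm

variable {F F' : Type*} [NormedAddCommGroup F] [NormedAddCommGroup F']

/-- A function that vanishes off `S` and is controlled by a translate of `f` there is controlled by
`f` in `L²`. -/
lemma ShiftInv.eLpNorm_le {m : Measure X} {S : Set X} {s : X} (h : ShiftInv m S s)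
    (hS : MeasurableSet S) {M : ℝ} {f : X → F} {q : X → F'} (h0 : ∀ x ∉ S, q x = 0)
    (hq : ∀ x, ‖q x‖ ≤ M * ‖f (x + s)‖) :
    eLpNorm q 2 m ≤ ENNReal.ofReal M * eLpNorm f 2 m := by
  have e1 : eLpNorm q 2 m ≤ ENNReal.ofReal M * eLpNorm (fun x => f (x + s)) 2 (m.restrict S) := by
    have : eLpNorm q 2 m = eLpNorm q 2 (m.restrict S) := by
      rw [← eLpNorm_indicator_eq_eLpNorm_restrict hS]
      congr 1
      ext x
      by_cases hx : x ∈ S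
      · simp [hx]
      · simp [hx, h0 x hx]
    rw [this]
    exact eLpNorm_le_mul_eLpNorm_of_ae_le_mul (Filter.Eventually.of_forall hq) 2
  refine e1.trans (mul_le_mul_right ?_ _)
  have e2 : eLpNorm (fun x => f (x + s)) 2 (m.restrict S) =
      eLpNorm f 2 (m.restrict {x | x - s ∈ S}) := by
    simp only [eLpNorm_eq_lintegral_rpow_enorm_toReal (p := 2) (by norm_num) (by norm_num)]
    rw [h.setLIntegral_shift (fun x => ‖f x‖ₑ ^ (2 : ℝ≥0∞).toReal)]
  rw [e2]
  exact eLpNorm_mono_measure _ Measure.restrict_le_self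

lemma ShiftInv.aestronglyMeasurable {m : Measure X} {S : Set X} {s : X} (h : ShiftInv m S s)
    (hS : MeasurableSet S) {f : X → F} (hf : AEStronglyMeasurable f m) :
    AEStronglyMeasurable (fun x => f (x + s)) (m.restrict S) := by
  refine ⟨fun x => hf.mk f (x + s),
    hf.stronglyMeasurable_mk.comp_measurable (measurable_add_const s), ?_⟩
  exact (ae_restrict_iff' hS).2 (h.ae hS hf.ae_eq_mk)

variable [NormedSpace ℝ F] [NormedSpace ℝ F']

/-- The function `a(x) (f(x + s) - f(x))`, for a coefficient `a` with values in linear maps. -/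
def locDiff (a : X → F →L[ℝ] F') (s : X) (f : X → F) (x : X) : F' := a x (f (x + s) - f x)

/-- The function `q(x - s) - q(x)`, that is, the adjoint of the difference operator applied to `q`. -/
def backDiff (s : X) (q : X → F) (x : X) : F := q (x - s) - q x

lemma ShiftInv.memLp_shiftMul [SecondCountableTopology X] {m : Measure X} {S : Set X} {s : X}
    (h : ShiftInv m S s)
    (hS : MeasurableSet S) {M : ℝ} {a : X → F →L[ℝ] F'} (ha : StronglyMeasurable a)
    (h0 : ∀ x ∉ S, a x = 0) (hM : ∀ x, ‖a x‖ ≤ M) {f : X → F} (hf : MemLp f 2 m) :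
    MemLp (fun x => a x (f (x + s))) 2 m := by
  refine ⟨?_, ?_⟩
  · have h1 : AEStronglyMeasurable (fun x => a x (f (x + s))) (m.restrict S) :=
      (ContinuousLinearMap.apply ℝ F').flip.aestronglyMeasurable_comp₂
        ha.aestronglyMeasurable (h.aestronglyMeasurable hS hf.1)
    have h2 := (aestronglyMeasurable_indicator_iff hS).2 h1
    refine h2.congr (Filter.Eventually.of_forall fun x => ?_)
    by_cases hx : x ∈ S
    · simp [hx]
    · simp [hx, h0 x hx]
  · refine (h.eLpNorm_le hS (M := M) (f := f) (fun x hx => by simp [h0 x hx])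
      fun x => ?_).trans_lt (ENNReal.mul_lt_top ENNReal.ofReal_lt_top hf.2)
    exact ((a x).le_opNorm _).trans (mul_le_mul_of_nonneg_right (hM x) (norm_nonneg _))

lemma ShiftInv.memLp_locDiff [SecondCountableTopology X] {m : Measure X} {S : Set X} {s : X}
    (h : ShiftInv m S s)
    (hS : MeasurableSet S) {M : ℝ} {a : X → F →L[ℝ] F'} (ha : StronglyMeasurable a)
    (h0 : ∀ x ∉ S, a x = 0) (hM : ∀ x, ‖a x‖ ≤ M) {f : X → F} (hf : MemLp f 2 m) :
    MemLp (locDiff a s f) 2 m := by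
  have h1 := h.memLp_shiftMul hS ha h0 hM hf
  have h2 := (shiftInv_zero m S).memLp_shiftMul hS ha h0 hM hf
  refine (h1.sub h2).ae_eq (Filter.Eventually.of_forall fun x => ?_)
  simp [locDiff]

lemma ShiftInv.memLp_sub_shift {m : Measure X} {S : Set X} {s : X} (h : ShiftInv m S s)
    (hS : MeasurableSet S) {q : X → F} (h0 : ∀ x ∉ S, q x = 0) (hq : MemLp q 2 m) :
    MemLp (fun x => q (x - s)) 2 m := by
  have hS' := measurableSet_sub_mem hS s
  refine ⟨?_, ?_⟩
  · have h2 := (aestronglyMeasurable_indicator_iff hS').2 (h.symm.aestronglyMeasurable hS' hq.1)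
    refine h2.congr (Filter.Eventually.of_forall fun x => ?_)
    by_cases hx : x - s ∈ S
    · rw [indicator_of_mem (show x ∈ {x | x - s ∈ S} from hx)]
      simp only [sub_eq_add_neg]
    · rw [indicator_of_notMem (show x ∉ {x | x - s ∈ S} from hx)]
      exact (h0 _ hx).symm
  · refine (h.symm.eLpNorm_le hS' (M := 1) (f := q) (fun x hx => h0 _ hx)
      fun x => ?_).trans_lt (ENNReal.mul_lt_top ENNReal.ofReal_lt_top hq.2)
    simp [sub_eq_add_neg]

lemma ShiftInv.memLp_backDiff {m : Measure X} {S : Set X} {s : X} (h : ShiftInv m S s)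
    (hS : MeasurableSet S) {q : X → F} (h0 : ∀ x ∉ S, q x = 0) (hq : MemLp q 2 m) :
    MemLp (backDiff s q) 2 m :=
  (h.memLp_sub_shift hS h0 hq).sub hq

/-- Multiplication by a bounded coefficient after a translation, as an operator on `L²`. -/
lemma ShiftInv.exists_clm_shiftMul [SecondCountableTopology X] {μ ν : Measure X} {S : Set X}
    {s : X} (h : ShiftInv ν S s)
    (hS : MeasurableSet S) {C : ℝ≥0∞} (hC : C ≠ ⊤) (hμν : ν ≤ C • μ) {M : ℝ}
    {a : X → F →L[ℝ] F'} (ha : StronglyMeasurable a)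
    (h0 : ∀ x ∉ S, a x = 0) (hM : ∀ x, ‖a x‖ ≤ M) :
    ∃ T : Lp F 2 μ →L[ℝ] Lp F' 2 ν, ∀ f, T f =ᵐ[ν] fun x => a x (f (x + s)) := by
  have hmem : ∀ f : Lp F 2 μ, MemLp f 2 ν := fun f => (Lp.memLp f).of_measure_le_smul hC hμν
  have hac : ν ≪ μ := (Measure.absolutelyContinuous_of_le hμν).trans
    Measure.smul_absolutelyContinuous
  let T0 : Lp F 2 μ →ₗ[ℝ] Lp F' 2 ν :=
    { toFun := fun f => (h.memLp_shiftMul hS ha h0 hM (hmem f)).toLp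
      map_add' := by
        intro f g
        rw [← MemLp.toLp_add]
        rw [MemLp.toLp_eq_toLp_iff]
        filter_upwards [h.ae hS (hac.ae_le (Lp.coeFn_add f g))] with x hx
        by_cases hxS : x ∈ S
        · rw [hx hxS, Pi.add_apply, map_add, Pi.add_apply]
        · simp [h0 x hxS]
      map_smul' := by
        intro c f
        rw [RingHom.id_apply, ← MemLp.toLp_const_smul]
        rw [MemLp.toLp_eq_toLp_iff]
        filter_upwards [h.ae hS (hac.ae_le (Lp.coeFn_smul c f))] with x hx
        by_cases hxS : x ∈ S
        · rw [hx hxS, Pi.smul_apply, map_smul, Pi.smul_apply]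
        · simp [h0 x hxS] }
  refine ⟨T0.mkContinuous ((ENNReal.ofReal M * C ^ (1 / (2 : ℝ≥0∞)).toReal).toReal) fun f => ?_,
    fun f => MemLp.coeFn_toLp (h.memLp_shiftMul hS ha h0 hM (hmem f))⟩
  have e1 : eLpNorm (fun x => a x (f (x + s))) 2 ν ≤
      ENNReal.ofReal M * C ^ (1 / (2 : ℝ≥0∞)).toReal * eLpNorm f 2 μ := by
    refine (h.eLpNorm_le hS (M := M) (f := f) (fun x hx => by simp [h0 x hx])
      fun x => ?_).trans ?_
    · exact ((a x).le_opNorm _).trans (mul_le_mul_of_nonneg_right (hM x) (norm_nonneg _))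
    · rw [mul_assoc]
      gcongr
      refine (eLpNorm_mono_measure _ hμν).trans ?_
      rw [eLpNorm_smul_measure_of_ne_top (by norm_num), smul_eq_mul]
  change ‖(h.memLp_shiftMul hS ha h0 hM (hmem f)).toLp‖ ≤ _
  rw [Lp.norm_toLp, Lp.norm_def, ← ENNReal.toReal_mul]
  refine ENNReal.toReal_mono ?_ e1
  have : C ^ (1 / (2 : ℝ≥0∞)).toReal ≠ ⊤ := ENNReal.rpow_ne_top_of_nonneg ENNReal.toReal_nonneg hC
  exact ENNReal.mul_ne_top (ENNReal.mul_ne_top ENNReal.ofReal_ne_top this) (Lp.eLpNorm_ne_top f)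

lemma ShiftInv.exists_clm_locDiff [SecondCountableTopology X] {μ ν : Measure X} {S : Set X}
    {s : X} (h : ShiftInv ν S s)
    (hS : MeasurableSet S) {C : ℝ≥0∞} (hC : C ≠ ⊤) (hμν : ν ≤ C • μ) {M : ℝ}
    {a : X → F →L[ℝ] F'} (ha : StronglyMeasurable a)
    (h0 : ∀ x ∉ S, a x = 0) (hM : ∀ x, ‖a x‖ ≤ M) :
    ∃ T : Lp F 2 μ →L[ℝ] Lp F' 2 ν, ∀ f, T f =ᵐ[ν] locDiff a s f := by
  obtain ⟨T1, h1⟩ := h.exists_clm_shiftMul hS hC hμν ha h0 hM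
  obtain ⟨T2, h2⟩ := (shiftInv_zero ν S).exists_clm_shiftMul hS hC hμν ha h0 hM
  refine ⟨T1 - T2, fun f => ?_⟩
  filter_upwards [h1 f, h2 f, Lp.coeFn_sub (T1 f) (T2 f)] with x e1 e2 e3
  rw [_root_.sub_apply, e3, Pi.sub_apply, e1, e2]
  simp [locDiff]

/-- The operator `q ↦ q(x - s) - q(x)`, on functions vanishing off `S`. -/
lemma ShiftInv.exists_clm_backDiff [SecondCountableTopology X] {μ : Measure X} {S : Set X} {s : X}
    (h : ShiftInv μ S s) (hS : MeasurableSet S) :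
    ∃ T : Lp F 2 μ →L[ℝ] Lp F 2 μ, ∀ f : Lp F 2 μ, ∀ q : X → F, (∀ x ∉ S, q x = 0) →
      f =ᵐ[μ] q → T f =ᵐ[μ] backDiff s q := by
  have hS' := measurableSet_sub_mem hS s
  have hμ : μ ≤ (1 : ℝ≥0∞) • μ := by simp
  have key : ∀ A : Set X, MeasurableSet A →
      StronglyMeasurable (A.indicator fun _ => ContinuousLinearMap.id ℝ F) ∧
      (∀ x ∉ A, A.indicator (fun _ => ContinuousLinearMap.id ℝ F) x = 0) ∧
      (∀ x, ‖A.indicator (fun _ => ContinuousLinearMap.id ℝ F) x‖ ≤ 1) := by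
    intro A hA
    refine ⟨stronglyMeasurable_const.indicator hA, fun x hx => by simp [hx], fun x => ?_⟩
    exact (norm_indicator_le_norm_self _ _).trans ContinuousLinearMap.norm_id_le
  obtain ⟨a1, b1, c1⟩ := key _ hS'
  obtain ⟨a2, b2, c2⟩ := key _ hS
  obtain ⟨T1, h1⟩ := h.symm.exists_clm_shiftMul hS' ENNReal.one_ne_top hμ a1 b1 c1
  obtain ⟨T2, h2⟩ := (shiftInv_zero μ S).exists_clm_shiftMul hS ENNReal.one_ne_top hμ a2 b2 c2
  refine ⟨T1 - T2, fun f q hq hfq => ?_⟩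
  filter_upwards [h1 f, h2 f, Lp.coeFn_sub (T1 f) (T2 f), h.symm.ae hS' hfq, hfq]
    with x e1 e2 e3 e4 e5
  rw [_root_.sub_apply, e3, Pi.sub_apply, e1, e2, backDiff, add_zero, e5]
  congr 1
  · by_cases hx : x - s ∈ S
    · have := e4 hx
      rw [← sub_eq_add_neg] at this ⊢
      rw [this]
      simp [hx]
    · simp [hx, hq _ hx]
  · by_cases hx : x ∈ S
    · simp [hx]
    · simp [hx, hq _ hx]

end Shift

section Parts

variable {X : Type*} [NormedAddCommGroup X] [MeasurableSpace X] [BorelSpace X]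
variable {F : Type*} [NormedAddCommGroup F] [InnerProductSpace ℝ F]

lemma integrable_inner_of_memLp {α : Type*} [MeasurableSpace α] {m : Measure α} {f g : α → F}
    (hf : MemLp f 2 m) (hg : MemLp g 2 m) : Integrable (fun x => inner ℝ (f x) (g x)) m := by
  rw [← memLp_one_iff_integrable]
  refine MemLp.of_bilin (fun x y : F => (inner ℝ x y : ℝ)) 1 hf hg (hf.1.inner hg.1)
    (Filter.Eventually.of_forall fun x => ?_)
  rw [one_mul]
  exact norm_inner_le_norm _ _

/-- Summation by parts for differences. -/
lemma ShiftInv.integral_inner_backDiff {m : Measure X} {S : Set X} {s : X} (h : ShiftInv m S s)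
    (hS : MeasurableSet S) {f q : X → F} (h0 : ∀ x ∉ S, q x = 0) (hf : MemLp f 2 m)
    (hq : MemLp q 2 m) :
    ∫ x, inner ℝ (f x) (backDiff s q x) ∂m = ∫ x, inner ℝ (f (x + s) - f x) (q x) ∂m ∧
      Integrable (fun x => inner ℝ (f (x + s) - f x) (q x)) m := by
  have hS' := measurableSet_sub_mem hS s
  have i1 : Integrable (fun x => inner ℝ (f x) (q x)) m := integrable_inner_of_memLp hf hq
  have i2 : Integrable (fun x => inner ℝ (f x) (q (x - s))) m :=
    integrable_inner_of_memLp hf (h.memLp_sub_shift hS h0 hq)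
  have i3 : Integrable (fun x => inner ℝ (f (x + s)) (q x)) m := by
    have a1 : IntegrableOn (fun x => inner ℝ (f x) (q (x - s))) {x | x - s ∈ S} m :=
      i2.integrableOn
    unfold IntegrableOn at a1
    rw [← h] at a1
    have a2 := (MeasurableEquiv.addRight s).measurableEmbedding.integrable_map_iff.1 a1
    have a3 := (integrable_indicator_iff hS).2 (show IntegrableOn _ S m from a2)
    refine a3.congr (Filter.Eventually.of_forall fun x => ?_)
    by_cases hx : x ∈ S
    · simp [hx]
    · simp [hx, h0 x hx]
  have e1 : ∫ x, inner ℝ (f x) (q (x - s)) ∂m = ∫ x, inner ℝ (f (x + s)) (q x) ∂m := by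
    rw [← setIntegral_eq_integral_of_forall_compl_eq_zero (s := {x | x - s ∈ S})
      (fun x hx => by rw [h0 _ hx, inner_zero_right]),
      ← setIntegral_eq_integral_of_forall_compl_eq_zero (s := S)
      (f := fun x => inner ℝ (f (x + s)) (q x))
      (fun x hx => by rw [h0 _ hx, inner_zero_right]),
      ← h.setIntegral_shift (fun x => inner ℝ (f x) (q (x - s)))]
    simp
  simp only [backDiff, inner_sub_left, inner_sub_right]
  exact ⟨by rw [integral_sub i2 i1, integral_sub i3 i1, e1], i3.sub i1⟩

end Parts

end

section

/-! ### A cut-off function adapted to the lattice -/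

section Lattice

open scoped Convolution

variable {d : ℕ}

/-- The index of the unit cell containing `x`. -/
def floorVec (x : E d) : Fin d → ℤ := fun i => ⌊x i⌋

/-- The smallest value of the lattice function `a` on the cells met by the corners of the cube with
centre `x` and side `ρ`. -/
def cornerInf (a : (Fin d → ℤ) → ℝ) (ρ : ℝ) (x : E d) : ℝ :=
  ⨅ v : Fin d → Bool, a fun i => ⌊x i + ρ / 2 * sgn (v i)⌋

lemma abs_coord_le (x : E d) (i : Fin d) : |x i| ≤ ‖x‖ := PiLp.norm_apply_le x i

lemma cornerInf_le (a : (Fin d → ℤ) → ℝ) (ρ : ℝ) (x : E d) (v : Fin d → Bool) :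
    cornerInf a ρ x ≤ a fun i => ⌊x i + ρ / 2 * sgn (v i)⌋ :=
  ciInf_le (finite_range _).bddBelow v

lemma measurable_cornerInf (a : (Fin d → ℤ) → ℝ) (ρ : ℝ) : Measurable (cornerInf a ρ) := by
  refine Measurable.iInf fun v => ?_
  refine (measurable_of_countable a).comp ?_
  refine measurable_pi_iff.2 fun i => ?_
  refine Int.measurable_floor.comp ?_
  fun_prop

lemma sgn_cases (b : Bool) : sgn b = 1 ∨ sgn b = -1 := by cases b <;> simp [sgn]

lemma cornerInf_osc {a : (Fin d → ℤ) → ℝ} {κ ρ : ℝ}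
    (hκ : ∀ k k', (∀ i, |k i - k' i| ≤ 1) → |a k - a k'| ≤ κ) {x y : E d} (hxy : ‖x - y‖ < 1) :
    cornerInf a ρ x ≤ cornerInf a ρ y + κ := by
  rw [← sub_le_iff_le_add]
  refine le_ciInf fun v => ?_
  have h1 := cornerInf_le a ρ x v
  have h2 := hκ (fun i => ⌊x i + ρ / 2 * sgn (v i)⌋) (fun i => ⌊y i + ρ / 2 * sgn (v i)⌋) fun i => by
    have h3 := (abs_coord_le (x - y) i).trans_lt hxy
    have h4 : (x - y) i = (x i + ρ / 2 * sgn (v i)) - (y i + ρ / 2 * sgn (v i)) := by simp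
    rw [h4] at h3
    rw [← Int.lt_add_one_iff]
    have a1 := Int.floor_le (x i + ρ / 2 * sgn (v i))
    have a2 := Int.lt_floor_add_one (x i + ρ / 2 * sgn (v i))
    have a3 := Int.floor_le (y i + ρ / 2 * sgn (v i))
    have a4 := Int.lt_floor_add_one (y i + ρ / 2 * sgn (v i))
    rw [abs_lt] at h3 ⊢
    constructor
    · have : (-(1 + 1) : ℝ) < ⌊x i + ρ / 2 * sgn (v i)⌋ - ⌊y i + ρ / 2 * sgn (v i)⌋ := by linarith
      exact_mod_cast this
    · have : (⌊x i + ρ / 2 * sgn (v i)⌋ - ⌊y i + ρ / 2 * sgn (v i)⌋ : ℝ) < 1 + 1 := by linarith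
      exact_mod_cast this
  rw [abs_le] at h2
  linarith [h2.2]

/-- In the interior part of a cell, `cornerInf a` takes the value of `a` in this cell. -/
lemma cornerInf_eq {a : (Fin d → ℤ) → ℝ} {ρ : ℝ} {k : Fin d → ℤ} {x : E d}
    (hx : ∀ i, k i + ρ / 2 ≤ x i ∧ x i + ρ / 2 < k i + 1) (hρ : 0 < ρ) :
    cornerInf a ρ x = a k := by
  have : ∀ v : Fin d → Bool, (a fun i => ⌊x i + ρ / 2 * sgn (v i)⌋) = a k := by
    intro v
    congr 1
    ext i
    obtain ⟨h1, h2⟩ := hx i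
    rw [Int.floor_eq_iff]
    rcases sgn_cases (v i) with h | h <;> rw [h] <;> constructor <;> linarith
  simp [cornerInf, this]

/-- If `cornerInf a` is positive at `x`, then `a` is positive in each cell that meets the cube with
centre `x` and side `ρ`: since `ρ < 1`, such a cell contains a corner of the cube. -/
lemma pos_of_cornerInf_pos {a : (Fin d → ℤ) → ℝ} {ρ : ℝ} (hρ : ρ ≤ 1 / 2)
    {x y : E d} (h : 0 < cornerInf a ρ x) (hy : ‖y - x‖ ≤ ρ / 2) : 0 < a (floorVec y) := by
  have : ∃ v : Fin d → Bool, floorVec y = fun i => ⌊x i + ρ / 2 * sgn (v i)⌋ := by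
    have : ∀ i, ∃ b : Bool, ⌊y i⌋ = ⌊x i + ρ / 2 * sgn b⌋ := by
      intro i
      have h3 := (abs_coord_le (y - x) i).trans hy
      rw [PiLp.sub_apply, abs_le] at h3
      by_cases hb : ⌊y i⌋ = ⌊x i + ρ / 2 * sgn true⌋
      · exact ⟨true, hb⟩
      · refine ⟨false, ?_⟩
        simp only [sgn, if_true, mul_one, Bool.false_eq_true, if_false] at hb ⊢
        have h5 : ⌊y i⌋ ≤ ⌊x i + ρ / 2⌋ := Int.floor_le_floor (by linarith)
        have h6 : ⌊y i⌋ < ⌊x i + ρ / 2⌋ := lt_of_le_of_ne h5 hb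
        have h7 : ((⌊y i⌋ + 1 : ℤ) : ℝ) ≤ x i + ρ / 2 := Int.le_floor.1 h6
        push_cast at h7
        have a3 := Int.floor_le (y i)
        have a4 := Int.lt_floor_add_one (y i)
        symm
        rw [Int.floor_eq_iff]
        constructor <;> linarith
    choose v hv using this
    exact ⟨v, funext hv⟩
  obtain ⟨v, hv⟩ := this
  rw [hv]
  exact h.trans_le (cornerInf_le a ρ x v)

/-- A slowly varying function `a` on the lattice is the restriction of a smooth function with small
gradient, which is constant well inside of each cell and lives on the cells where `a` is positive:
one mollifies `cornerInf a`. -/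
lemma exists_lattice_cutoff (d : ℕ) {ρ : ℝ} (hρ : 0 < ρ) (hρ2 : ρ ≤ 1 / 2) :
    ∃ M : ℝ, 0 ≤ M ∧ ∀ (a : (Fin d → ℤ) → ℝ) (κ : ℝ), 0 ≤ κ → (∀ k, 0 ≤ a k ∧ a k ≤ 1) →
      (∀ k k', (∀ i, |k i - k' i| ≤ 1) → |a k - a k'| ≤ κ) →
      ∃ η : E d → ℝ, ContDiff ℝ ∞ η ∧ (∀ x, 0 ≤ η x ∧ η x ≤ 1) ∧
        (∀ x, ‖fderiv ℝ η x‖ ≤ M * κ) ∧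
        (∀ k x, (∀ i, k i + ρ ≤ x i ∧ x i ≤ k i + 1 - ρ) → η x = a k) ∧
        tsupport η ⊆ interior {x | 0 < a (floorVec x)} := by
  let b : ContDiffBump (0 : E d) := ⟨ρ / 8, ρ / 4, by positivity, by linarith⟩
  set β : E d → ℝ := b.normed volume with hβ
  have hβc : HasCompactSupport β := b.hasCompactSupport_normed
  have hβs : ContDiff ℝ ∞ β := b.contDiff_normed
  refine ⟨∫ t, ‖fderiv ℝ β t‖, integral_nonneg fun _ => norm_nonneg _, ?_⟩
  intro a κ hκ0 ha hκ
  set A := cornerInf a ρ with hA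
  have hA01 : ∀ x, 0 ≤ A x ∧ A x ≤ 1 := fun x =>
    ⟨le_ciInf fun v => (ha _).1, (cornerInf_le a ρ x (fun _ => true)).trans (ha _).2⟩
  have hAm : AEStronglyMeasurable A volume := (measurable_cornerInf a ρ).aestronglyMeasurable
  have hAloc : ∀ c : ℝ, LocallyIntegrable (fun x => A x - c) (volume : Measure (E d)) := by
    intro c
    refine LocallyIntegrable.mono (f := fun _ => 1 + |c|) (locallyIntegrable_const _)
      (hAm.sub aestronglyMeasurable_const) (Filter.Eventually.of_forall fun x => ?_)
    have := abs_sub (A x) c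
    rw [abs_of_nonneg (hA01 x).1] at this
    rw [Real.norm_eq_abs, Real.norm_eq_abs, abs_of_nonneg (by positivity : 0 ≤ 1 + |c|)]
    linarith [(hA01 x).2]
  have hAloc0 : LocallyIntegrable A (volume : Measure (E d)) := by simpa using hAloc 0
  set L := ContinuousLinearMap.lsmul ℝ ℝ (E := ℝ) with hL
  set η : E d → ℝ := β ⋆[L, volume] A with hη
  have hconst : ∀ x c, (∀ y ∈ Metric.ball x (ρ / 4), A y = c) → η x = c := by
    intro x c h
    have hx : A x = c := h x (Metric.mem_ball_self (by positivity))
    rw [← hx]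
    exact b.normed_convolution_eq_right fun y hy => by rw [hx]; exact h y hy
  have hsupp : ∀ x, η x ≠ 0 → ∀ y, ‖y - x‖ < ρ / 4 → 0 < a (floorVec y) := by
    intro x hx y hy
    obtain ⟨z, hz, hz0⟩ : ∃ z ∈ Metric.ball x (ρ / 4), A z ≠ 0 := by
      by_contra! hcon
      exact hx (hconst x 0 hcon)
    refine pos_of_cornerInf_pos hρ2 (lt_of_le_of_ne (hA01 z).1 (Ne.symm hz0)) ?_
    rw [Metric.mem_ball, dist_comm, dist_eq_norm] at hz
    calc ‖y - z‖ = ‖(y - x) + (x - z)‖ := by abel_nf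
      _ ≤ ρ / 2 := (norm_add_le _ _).trans (by linarith)
  have i1 : ∀ y, Integrable (fun t => β t • A (y - t)) volume := fun y =>
    hβc.convolutionExists_left L hβs.continuous hAloc0 y
  have hβi : Integrable β volume := hβs.continuous.integrable_of_hasCompactSupport hβc
  refine ⟨η, hβc.contDiff_convolution_left L hβs hAloc0, ?_, ?_, ?_, ?_⟩
  · intro x
    refine ⟨integral_nonneg fun t => mul_nonneg (b.nonneg_normed t) (hA01 _).1, ?_⟩
    refine (integral_mono (i1 x) hβi fun t => ?_).trans b.integral_normed.le
    exact mul_le_of_le_one_right (b.nonneg_normed t) (hA01 _).2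
  · intro x
    -- the gradient is not changed by subtracting from `A` its value `c` at `x`, and `|A - c| ≤ κ` nearby
    set c := A x
    have e1 : η = fun y => (β ⋆[L, volume] fun z => A z - c) y + c := by
      ext y
      have i2 : Integrable (fun t => β t • c) volume := hβi.smul_const c
      have e2 : ∫ t, β t • c = c := by
        rw [integral_smul_const, b.integral_normed, one_smul]
      change ∫ t, β t • A (y - t) = (∫ t, β t • (A (y - t) - c)) + c
      simp only [smul_sub]
      rw [integral_sub (i1 y) i2, e2, sub_add_cancel]
    have h1 := hβc.hasFDerivAt_convolution_left L (hβs.of_le (by simp)) (hAloc c) x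
    have h2 : HasFDerivAt η ((fderiv ℝ β ⋆[L.precompL (E d), volume] fun z => A z - c) x) x := by
      rw [e1]
      exact h1.add_const c
    rw [h2.fderiv]
    have h3 : Integrable (fun t => ‖fderiv ℝ β t‖) (volume : Measure (E d)) :=
      ((hβs.continuous_fderiv (by simp)).integrable_of_hasCompactSupport
        (hβc.fderiv ℝ)).norm
    refine (norm_integral_le_of_norm_le (h3.mul_const κ)
      (Filter.Eventually.of_forall fun t => ?_)).trans (le_of_eq (integral_mul_const _ _))
    by_cases ht : t ∈ tsupport β
    · have ht' : ‖t‖ ≤ ρ / 4 := by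
        have : tsupport β = Metric.closedBall 0 b.rOut := b.tsupport_normed_eq
        rw [this] at ht
        simpa [b] using ht
      have hA1 : ‖A (x - t) - c‖ ≤ κ := by
        have u1 := cornerInf_osc (ρ := ρ) hκ (x := x) (y := x - t) (by
          rw [sub_sub_cancel]; linarith)
        have u2 := cornerInf_osc (ρ := ρ) hκ (x := x - t) (y := x) (by
          rw [norm_sub_rev, sub_sub_cancel]; linarith)
        rw [Real.norm_eq_abs, abs_le]
        constructor <;> linarith
      refine ContinuousLinearMap.opNorm_le_bound _ (by positivity) fun v => ?_
      rw [ContinuousLinearMap.precompL_apply]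
      change ‖fderiv ℝ β t v * (A (x - t) - c)‖ ≤ _
      rw [norm_mul]
      calc ‖fderiv ℝ β t v‖ * ‖A (x - t) - c‖ ≤ (‖fderiv ℝ β t‖ * ‖v‖) * κ := by
            gcongr
            exact (fderiv ℝ β t).le_opNorm v
        _ = _ := by ring
    · have : fderiv ℝ β t = 0 := by
        by_contra h
        exact ht (support_fderiv_subset ℝ h)
      rw [this]
      simp
  · intro k x hx
    refine hconst x (a k) fun y hy => cornerInf_eq (fun i => ?_) hρ
    have h3 := (abs_coord_le (y - x) i).trans_lt (by simpa [dist_eq_norm] using hy)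
    rw [PiLp.sub_apply, abs_lt] at h3
    obtain ⟨h4, h5⟩ := hx i
    constructor <;> linarith [h3.1, h3.2]
  · intro x hx
    rw [mem_interior]
    refine ⟨Metric.ball x (ρ / 8), fun y hy => ?_, Metric.isOpen_ball,
      Metric.mem_ball_self (by positivity)⟩
    obtain ⟨z, hz, hz2⟩ := Metric.mem_closure_iff.1 hx (ρ / 8) (by positivity)
    refine hsupp z hz y ?_
    rw [Metric.mem_ball] at hy
    rw [← dist_eq_norm]
    linarith [dist_triangle y x z]

end Lattice

end

section

/-! ### Coordinates and cells -/

section Coordinates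

variable {d : ℕ}

@[simp] lemma bar_apply (x : E (d + 1)) (i : Fin d) : bar x i = x i.castSucc := rfl
@[simp] lemma mkPt_castSucc (x : E d) (s : ℝ) (i : Fin d) : mkPt x s i.castSucc = x i := by
  simp [mkPt]
@[simp] lemma mkPt_last (x : E d) (s : ℝ) : mkPt x s (Fin.last d) = s := by simp [mkPt]
lemma bar_add (x y : E (d + 1)) : bar (x + y) = bar x + bar y := by ext i; simp
lemma bar_smul (c : ℝ) (x : E (d + 1)) : bar (c • x) = c • bar x := by ext i; simp
lemma bar_sub (x y : E (d + 1)) : bar (x - y) = bar x - bar y := by ext i; simp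
@[simp] lemma bar_mkPt (x : E d) (s : ℝ) : bar (mkPt x s) = x := by ext i; simp
@[simp] lemma vert_mkPt (x : E d) (s : ℝ) : vert (mkPt x s) = s := by simp [vert]
@[simp] lemma vert_add (x y : E (d + 1)) : vert (x + y) = vert x + vert y := by simp [vert]
@[simp] lemma vert_smul (c : ℝ) (x : E (d + 1)) : vert (c • x) = c * vert x := by simp [vert]
@[simp] lemma vert_sub (x y : E (d + 1)) : vert (x - y) = vert x - vert y := by simp [vert]
lemma ext_bar_vert {x y : E (d + 1)} (h : bar x = bar y) (h' : vert x = vert y) : x = y := by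
  ext i
  refine Fin.lastCases h' (fun j => ?_) i
  rw [← bar_apply, h, bar_apply]

/-- The horizontal projection as a continuous linear map. -/
def barL : E (d + 1) →L[ℝ] E d :=
  LinearMap.mkContinuous ⟨⟨bar, bar_add⟩, bar_smul⟩ 1 fun x => by
    change ‖bar x‖ ≤ 1 * ‖x‖
    rw [one_mul, EuclideanSpace.norm_eq, EuclideanSpace.norm_eq]
    refine Real.sqrt_le_sqrt ?_
    rw [Fin.sum_univ_castSucc]
    exact le_add_of_nonneg_right (sq_nonneg _)

@[simp] lemma barL_apply (x : E (d + 1)) : barL x = bar x := rfl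

lemma norm_barL_le : ‖(barL : E (d + 1) →L[ℝ] E d)‖ ≤ 1 :=
  LinearMap.mkContinuous_norm_le _ zero_le_one _

lemma norm_bar_le (x : E (d + 1)) : ‖bar x‖ ≤ ‖x‖ := by
  simpa using barL.le_of_opNorm_le norm_barL_le x

lemma continuous_bar : Continuous (bar : E (d + 1) → E d) := barL.continuous
lemma continuous_vert : Continuous (vert : E (d + 1) → ℝ) := by unfold vert; fun_prop

lemma isOpen_cyl {B : Set (E d)} {I : Set ℝ} (hB : IsOpen B) (hI : IsOpen I) :
    IsOpen (cyl B I) := (hB.preimage continuous_bar).inter (hI.preimage continuous_vert)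

lemma closure_cellY : closure (cellY d) = {y : E d | ∀ i, y i ∈ Icc (0 : ℝ) 1} := by
  have h := (EuclideanSpace.equiv (Fin d) ℝ).toHomeomorph.preimage_closure
    (pi univ fun _ => Ioo (0 : ℝ) 1)
  rw [closure_pi_set] at h
  simp only [closure_Ioo (zero_ne_one' ℝ)] at h
  have e1 : cellY d = (EuclideanSpace.equiv (Fin d) ℝ).toHomeomorph ⁻¹' (pi univ fun _ => Ioo 0 1) := by
    ext; simp [cellY]
  rw [e1, ← h]
  ext x
  simp only [mem_preimage, mem_pi, mem_univ, true_implies]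
  rfl

@[simp] lemma intVec_apply (k : Fin d → ℤ) (i : Fin d) : intVec k i = k i := rfl

lemma intVec_add (k l : Fin d → ℤ) : intVec (k + l) = intVec k + intVec l := by ext; simp

lemma mem_copy {ε : ℝ} (hε : 0 < ε) {k : Fin d → ℤ} {A : Set (E (d + 1))} {x : E (d + 1)} :
    x ∈ copy ε k A ↔ ε⁻¹ • x - mkPt (intVec k) 0 ∈ A := by
  constructor
  · rintro ⟨y, hy, rfl⟩
    simpa [smul_smul, hε.ne'] using hy
  · intro h
    exact ⟨_, h, by simp [smul_smul, hε.ne']⟩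

lemma mem_copyBar {ε : ℝ} (hε : 0 < ε) {k : Fin d → ℤ} {A : Set (E d)} {x : E d} :
    x ∈ copyBar ε k A ↔ ε⁻¹ • x - intVec k ∈ A := by
  constructor
  · rintro ⟨y, hy, rfl⟩
    simpa [smul_smul, hε.ne'] using hy
  · intro h
    exact ⟨_, h, by simp [smul_smul, hε.ne']⟩

lemma coord_iff {ε : ℝ} (hε : 0 < ε) (a x : ℝ) :
    (a ≤ ε⁻¹ * x ↔ ε * a ≤ x) ∧ (a < ε⁻¹ * x ↔ ε * a < x) ∧ (ε⁻¹ * x ≤ a ↔ x ≤ ε * a) ∧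
      (ε⁻¹ * x < a ↔ x < ε * a) := by
  rw [inv_mul_eq_div]
  refine ⟨by rw [le_div_iff₀' hε], by rw [lt_div_iff₀' hε], by rw [div_le_iff₀' hε],
    by rw [div_lt_iff₀' hε]⟩

lemma mem_copyBar_cellY {ε : ℝ} (hε : 0 < ε) {k : Fin d → ℤ} {x : E d} :
    x ∈ copyBar ε k (cellY d) ↔ ∀ i, ε * k i < x i ∧ x i < ε * (k i + 1) := by
  rw [mem_copyBar hε]
  refine forall_congr' fun i => ?_
  rw [← (coord_iff hε _ _).2.1, ← (coord_iff hε _ _).2.2.2]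
  simp [mem_Ioo, add_comm, sub_lt_iff_lt_add]

lemma mem_copyBar_closure_cellY {ε : ℝ} (hε : 0 < ε) {k : Fin d → ℤ} {x : E d} :
    x ∈ copyBar ε k (closure (cellY d)) ↔ ∀ i, ε * k i ≤ x i ∧ x i ≤ ε * (k i + 1) := by
  rw [mem_copyBar hε, closure_cellY]
  refine forall_congr' fun i => ?_
  rw [← (coord_iff hε _ _).1, ← (coord_iff hε _ _).2.2.1]
  simp [mem_Icc, add_comm]

lemma copyBar_closure_subset {ε : ℝ} (k : Fin d → ℤ) :
    copyBar ε k (closure (cellY d)) ⊆ closure (copyBar ε k (cellY d)) :=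
  image_closure_subset_closure_image (by fun_prop)

@[simp] lemma bar_shiftVec (ε : ℝ) (l : Fin d → ℤ) : bar (shiftVec ε l) = ε • intVec l := by
  simp [shiftVec, bar_smul]
@[simp] lemma vert_shiftVec (ε : ℝ) (l : Fin d → ℤ) : vert (shiftVec ε l) = 0 := by
  simp [shiftVec]

lemma add_shiftVec_mem_copy {ε : ℝ} (hε : 0 < ε) {k l : Fin d → ℤ} {A : Set (E (d + 1))}
    {x : E (d + 1)} : x + shiftVec ε l ∈ copy ε (k + l) A ↔ x ∈ copy ε k A := by
  rw [mem_copy hε, mem_copy hε]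
  have : ε⁻¹ • (x + shiftVec ε l) - mkPt (intVec (k + l)) 0 = ε⁻¹ • x - mkPt (intVec k) 0 := by
    refine ext_bar_vert ?_ ?_
    · rw [bar_sub, bar_sub, bar_smul, bar_smul, bar_add, bar_shiftVec, bar_mkPt, bar_mkPt,
        intVec_add, smul_add, smul_smul, inv_mul_cancel₀ hε.ne', one_smul]
      abel
    · simp
  rw [this]

end Coordinates

/-! ### Interior subdomains of the cross section -/

namespace Problem

variable {d : ℕ} (P : Problem d)

lemma isPreconnected_inter_frontier {X : Type*} [TopologicalSpace X] {C t : Set X}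
    (hC : IsPreconnected C) (h1 : (C ∩ t).Nonempty) (h2 : (C ∩ tᶜ).Nonempty) :
    (C ∩ frontier t).Nonempty := by
  by_contra hcon
  have hd : ∀ x ∈ C, x ∈ interior t ∨ x ∈ interior tᶜ := by
    intro x hx
    by_contra h
    rw [not_or, interior_compl, mem_compl_iff, not_not] at h
    exact hcon ⟨x, hx, h.2, h.1⟩
  obtain ⟨x, hx, hxt⟩ := h1
  obtain ⟨y, hy, hyt⟩ := h2
  obtain ⟨z, _, hz1, hz2⟩ := hC _ _ isOpen_interior isOpen_interior hd
    ⟨x, hx, (hd x hx).resolve_right fun h => interior_subset h hxt⟩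
    ⟨y, hy, (hd y hy).resolve_left fun h => hyt (interior_subset h)⟩
  exact interior_subset hz2 (interior_subset hz1)

/-- The ball around a point of `U` with radius its distance to the boundary is contained in `U`, being
connected. -/
lemma ball_subset_of_infDist {X : Type*} [NormedAddCommGroup X] [NormedSpace ℝ X] {U : Set X}
    {x : X} (hx : x ∈ U) : Metric.ball x (Metric.infDist x (frontier U)) ⊆ U := by
  by_contra hcon
  obtain ⟨y, hy, hyU⟩ := not_subset.1 hcon
  have hc : IsPreconnected (Metric.ball x (Metric.infDist x (frontier U))) :=
    (convex_ball _ _).isPreconnected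
  have hpos : 0 < Metric.infDist x (frontier U) := lt_of_le_of_lt dist_nonneg hy
  obtain ⟨z, hz1, hz2⟩ := isPreconnected_inter_frontier hc (t := U)
    ⟨x, Metric.mem_ball_self hpos, hx⟩ ⟨y, hy, hyU⟩
  have := Metric.infDist_le_dist_of_mem (x := x) hz2
  rw [Metric.mem_ball, dist_comm] at hz1
  linarith

variable {P}

lemma SigI.add_mem {η : ℝ} {x z : E d} (hx : x ∈ P.SigI η) (hz : ‖z‖ ≤ η) : x + z ∈ P.Sig :=
  ball_subset_of_infDist hx.1 (by simpa [Metric.mem_ball] using hz.trans_lt hx.2)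

lemma SigI.add_mem_SigI {η τ : ℝ} {x z : E d} (hx : x ∈ P.SigI (η + τ)) (hη : 0 ≤ η)
    (hz : ‖z‖ ≤ τ) : x + z ∈ P.SigI η := by
  refine ⟨SigI.add_mem hx (hz.trans (by linarith)), ?_⟩
  have h1 := Metric.infDist_le_infDist_add_dist (s := frontier P.Sig) (x := x) (y := x + z)
  have h2 := hx.2
  rw [dist_self_add_right] at h1
  linarith

lemma SigI.add_mem_of_mem_closure {h r : ℝ} {x z : E d} (hh : 0 ≤ h) (hr : r < h)
    (hx : x ∈ closure (P.SigI (2 * h))) (hz : ‖z‖ ≤ r) : x + z ∈ P.SigI h := by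
  obtain ⟨y, hy, hxy⟩ := Metric.mem_closure_iff.1 hx (h - r) (by linarith)
  have : x + z = y + (x - y + z) := by abel
  rw [this]
  refine SigI.add_mem_SigI (by rwa [← two_mul]) hh ((norm_add_le _ _).trans ?_)
  rw [dist_eq_norm] at hxy
  linarith

/-- A cut-off function for the shift estimate with parameter `h` at scale `ε`: it is constant on
the part of each cell that may be occupied by a channel, equals one in the cells in `Σ_{2h}`, and
lives on cells in `Σ_h`. -/
structure Cutoff (P : Problem d) (h ε ρ M : ℝ) where
  /-- the cut-off function -/
  η : E (d + 1) → ℝ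
  /-- an open set whose cylinder contains the support -/
  S : Set (E d)
  isOpen_S : IsOpen S
  smooth : ContDiff ℝ ∞ η
  nonneg : ∀ x, 0 ≤ η x
  le_one : ∀ x, η x ≤ 1
  /-- the gradient is bounded, with a bound that does not depend on `ε` -/
  fderiv_le : ∀ x, ‖fderiv ℝ η x‖ ≤ M
  tsupport_subset : tsupport η ⊆ cyl S univ
  /-- the closed cell of each point of `S` is contained in `Σ_h` -/
  cell : ∀ x ∈ S, ∀ k : Fin d → ℤ, (∀ i, ε * k i ≤ x i ∧ x i < ε * (k i + 1)) →
    copyBar ε k (closure (cellY d)) ⊆ P.SigI h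
  /-- the function is constant at distance at least `ερ` from the lateral faces of each cell -/
  eq_const : ∀ k : Fin d → ℤ, ∃ c, ∀ x : E (d + 1),
    (∀ i, ε * (k i + ρ) ≤ bar x i ∧ bar x i ≤ ε * (k i + 1 - ρ)) → η x = c
  /-- the constant is one in the cells in `Σ_{2h}` -/
  eq_one : ∀ k : Fin d → ℤ, copyBar ε k (cellY d) ⊆ P.SigI (2 * h) → ∀ x : E (d + 1),
    (∀ i, ε * (k i + ρ) ≤ bar x i ∧ bar x i ≤ ε * (k i + 1 - ρ)) → η x = 1

lemma norm_intVec_le {k : Fin d → ℤ} (hk : ∀ i, |k i| ≤ 1) : ‖intVec k‖ ≤ √d := by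
  rw [EuclideanSpace.norm_eq]
  refine Real.sqrt_le_sqrt ?_
  calc ∑ i, ‖intVec k i‖ ^ 2 ≤ ∑ _i : Fin d, (1 : ℝ) := by
        refine Finset.sum_le_sum fun i _ => ?_
        have : |(k i : ℝ)| ≤ 1 := by exact_mod_cast hk i
        rw [intVec_apply, Real.norm_eq_abs]
        exact pow_le_one₀ (abs_nonneg _) this
    _ = d := by simp

/-- There is a cut-off function with a gradient bound `M` that does not depend on `ε`.  Its value in
the cell `k` is `max(0, 1 - 2 dist / h)`, where `dist` is the distance, on the lattice `ε ℤ^d`, of `k`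
to the cells in `Σ_{2h}`; it varies by at most `C ε / h` between neighbouring cells. -/
lemma exists_cutoff (P : Problem d) {h ρ : ℝ} (hh : 0 < h) (hρ : 0 < ρ) (hρ2 : ρ ≤ 1 / 2) :
    ∃ M : ℝ, 0 ≤ M ∧ ∀ ε : ℝ, 0 < ε → Nonempty (Cutoff P h ε ρ M) := by
  obtain ⟨M, hM, H⟩ := exists_lattice_cutoff d hρ hρ2
  set r := h / 2 with hr
  have hr0 : 0 < r := by positivity
  refine ⟨M * (√d / r), by positivity, fun ε hε => ?_⟩
  set K : Set (Fin d → ℤ) := {k | copyBar ε k (cellY d) ⊆ P.SigI (2 * h)} with hK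
  -- without cells in `Σ_{2h}`, the zero function will do
  rcases K.eq_empty_or_nonempty with hKe | hKne
  · refine ⟨⟨fun _ => 0, ∅, isOpen_empty, contDiff_const, fun _ => le_rfl, fun _ => zero_le_one,
      fun x => ?_, ?_, fun x hx => hx.elim, fun k => ⟨0, fun _ _ => rfl⟩, fun k hk => ?_⟩⟩
    · simp only [fderiv_fun_const, Pi.zero_apply, norm_zero]
      positivity
    · simp [tsupport]
    · exact absurd (show k ∈ K from hk) (by simp [hKe])
  set D : (Fin d → ℤ) → ℝ := fun k => Metric.infDist (intVec k) (intVec '' K) with hD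
  have hD0 : ∀ k, 0 ≤ D k := fun k => Metric.infDist_nonneg
  have hDlip : ∀ k k', (∀ i, |k i - k' i| ≤ 1) → D k ≤ D k' + √d := by
    intro k k' hkk
    refine (Metric.infDist_le_infDist_add_dist (y := intVec k')).trans ?_
    gcongr
    rw [dist_eq_norm]
    have : intVec k - intVec k' = intVec (k - k') := by ext; simp
    rw [this]
    exact norm_intVec_le hkk
  set a : (Fin d → ℤ) → ℝ := fun k => max 0 (1 - ε * D k / r) with ha
  have ha_nbr : ∀ k k', (∀ i, |k i - k' i| ≤ 1) → |a k - a k'| ≤ ε * √d / r := by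
    have : ∀ k k', (∀ i, |k i - k' i| ≤ 1) → a k - a k' ≤ ε * √d / r := by
      intro k k' hkk
      have h1 : D k' ≤ D k + √d := hDlip k' k fun i => by rw [abs_sub_comm]; exact hkk i
      have h2 : ε * D k' / r ≤ ε * D k / r + ε * √d / r := by
        rw [← add_div, ← mul_add]; gcongr
      have h3 : 0 ≤ ε * √d / r := by positivity
      rw [sub_le_iff_le_add]
      refine max_le ?_ ?_
      · have : 0 ≤ a k' := le_max_left _ _
        linarith
      · have : 1 - ε * D k' / r ≤ a k' := le_max_right _ _
        linarith
    intro k k' hkk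
    rw [abs_le]
    constructor
    · have := this k' k fun i => by rw [abs_sub_comm]; exact hkk i
      linarith
    · exact this k k' hkk
  obtain ⟨η, h1, h2, h3, h4, h5⟩ := H a (ε * √d / r) (by positivity) (fun k =>
    ⟨le_max_left _ _, max_le zero_le_one (by
      have : 0 ≤ ε * D k / r := by have := hD0 k; positivity
      linarith)⟩) ha_nbr
  -- the cut-off function lives on the lattice `ε ℤ^d` and does not depend on the height
  set L : E (d + 1) →L[ℝ] E d := ε⁻¹ • barL with hL
  have hLa : ∀ x, L x = ε⁻¹ • bar x := fun x => rfl
  have hLi : ∀ x i, L x i = ε⁻¹ * bar x i := fun x i => rfl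
  have hin : ∀ (k : Fin d → ℤ) (x : E (d + 1)),
      (∀ i, ε * (k i + ρ) ≤ bar x i ∧ bar x i ≤ ε * (k i + 1 - ρ)) → η (L x) = a k := by
    intro k x hx
    refine h4 k (L x) fun i => ?_
    rw [hLi, (coord_iff hε _ _).1, (coord_iff hε _ _).2.2.1]
    exact hx i
  refine ⟨⟨fun x => η (L x), (fun x : E d => ε⁻¹ • x) ⁻¹' interior {x | 0 < a (floorVec x)},
    isOpen_interior.preimage (by fun_prop), h1.comp L.contDiff, fun x => (h2 _).1,
    fun x => (h2 _).2, ?_, ?_, ?_, fun k => ⟨a k, hin k⟩, ?_⟩⟩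
  · intro x
    have e : fderiv ℝ (fun x => η (L x)) x = (fderiv ℝ η (L x)).comp L :=
      ((h1.differentiable (by simp)).differentiableAt.hasFDerivAt.comp x L.hasFDerivAt).fderiv
    rw [e]
    refine (ContinuousLinearMap.opNorm_comp_le _ _).trans ?_
    have hLn : ‖L‖ ≤ ε⁻¹ := by
      rw [hL, norm_smul, Real.norm_eq_abs, abs_of_pos (inv_pos.2 hε)]
      exact mul_le_of_le_one_right (inv_pos.2 hε).le norm_barL_le
    calc ‖fderiv ℝ η (L x)‖ * ‖L‖ ≤ (M * (ε * √d / r)) * ε⁻¹ := by gcongr; exact h3 _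
      _ = M * (√d / r) := by field_simp
  · intro x hx
    refine ⟨?_, mem_univ _⟩
    exact h5 (tsupport_comp_subset_preimage η L.continuous hx)
  · intro x hx k hk y hy
    have hfl : floorVec (ε⁻¹ • x) = k := by
      ext i
      rw [floorVec, Int.floor_eq_iff]
      change (k i : ℝ) ≤ ε⁻¹ * x i ∧ ε⁻¹ * x i < k i + 1
      rw [(coord_iff hε _ _).1, (coord_iff hε _ _).2.2.2]
      exact hk i
    have hak : 0 < a k := by
      have : ε⁻¹ • x ∈ {x | 0 < a (floorVec x)} := interior_subset hx
      have : 0 < a (floorVec (ε⁻¹ • x)) := this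
      rwa [hfl] at this
    have hlt : ε * D k < r := by
      rcases lt_max_iff.1 hak with h | h
      · exact absurd h (lt_irrefl _)
      · rw [sub_pos, div_lt_one hr0] at h
        exact h
    have hlt' : D k < r / ε := by rwa [lt_div_iff₀' hε]
    -- a cell where `a` is positive is the translate by less than `h` of a cell in `Σ_{2h}`
    obtain ⟨_, ⟨k', hk', rfl⟩, hkk⟩ := (Metric.infDist_lt_iff (hKne.image _)).1 hlt'
    have e : y = (y + ε • intVec (k' - k)) + ε • intVec (k - k') := by
      rw [add_assoc, ← smul_add, ← intVec_add]
      ext i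
      simp
    rw [e]
    refine SigI.add_mem_of_mem_closure (r := r) hh.le (by linarith) ?_ ?_
    · refine closure_mono hk' (copyBar_closure_subset k' ?_)
      rw [mem_copyBar_closure_cellY hε] at hy ⊢
      intro i
      have := hy i
      simp only [PiLp.add_apply, PiLp.smul_apply, intVec_apply, smul_eq_mul, Pi.sub_apply,
        Int.cast_sub]
      constructor <;> linarith [this.1, this.2]
    · have : intVec (k - k') = intVec k - intVec k' := by ext; simp
      rw [norm_smul, Real.norm_eq_abs, abs_of_pos hε, this, ← dist_eq_norm]
      rw [lt_div_iff₀' hε] at hkk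
      exact hkk.le
  · intro k hk x hx
    rw [hin k x hx]
    have : D k = 0 := Metric.infDist_zero_of_mem (mem_image_of_mem _ hk)
    simp [a, this]

/-! ### The channels and translations by lattice vectors -/

/-- The channel keeps a positive distance from the lateral faces of its cell, as its lateral boundary
does. -/
lemma Admissible.exists_margin (hP : P.Admissible) :
    ∃ ρ : ℝ, 0 < ρ ∧ ρ ≤ 1 / 2 ∧ ∀ y ∈ closure P.Zs, ∀ i, ρ ≤ bar y i ∧ bar y i ≤ 1 - ρ := by
  obtain ⟨ρ, hρ, H⟩ := hP.lateral_dist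
  -- moving a point of the channel horizontally to the boundary of the cell, one meets the
  -- lateral boundary of the channel
  have key : ∀ y ∈ P.Zs, ∀ i : Fin d, ∀ c : ℝ, (c = 0 ∨ c = 1) → ρ ≤ |bar y i - c| := by
    intro y hy i c hc
    have hyZ := hP.zs_subset hy
    set z : E (d + 1) := y + (c - bar y i) • EuclideanSpace.single i.castSucc 1 with hz
    have hzi : bar z i = c := by simp [hz]
    have hzY : bar z ∉ cellY d := fun h => by
      have := h i
      rw [hzi] at this
      rcases hc with rfl | rfl <;> simp at this
    have hzZ : z ∉ cellZ d := fun h => hzY h.1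
    have hzs : z ∉ P.Zs := fun h => hzZ (hP.zs_subset h)
    have hseg : ∀ t : ℝ, y + t • (z - y) = y + (t * (c - bar y i)) • EuclideanSpace.single i.castSucc 1 := by
      intro t; simp [hz, smul_smul]
    have hvert : ∀ t : ℝ, vert (y + t • (z - y)) = vert y := by
      intro t
      rw [hseg]
      simp [vert, (Fin.castSucc_lt_last i).ne']
    have hopen : openSegment ℝ y z ⊆ cellZ d := by
      intro p hp
      rw [openSegment_eq_image'] at hp
      obtain ⟨t, ht, rfl⟩ := hp
      refine ⟨fun j => ?_, ?_⟩
      · simp only [hseg]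
        have hj := hyZ.1 j
        have hi := hyZ.1 i
        by_cases hji : j = i
        · subst hji
          simp only [bar_apply, mem_Ioo, PiLp.add_apply, PiLp.smul_apply, smul_eq_mul,
            PiLp.single_apply, if_true, mul_one] at *
          rcases hc with rfl | rfl <;> constructor <;> nlinarith [ht.1, ht.2, hj.1, hj.2]
        · have : (j.castSucc : Fin (d + 1)) ≠ i.castSucc := fun h => hji (Fin.castSucc_injective _ h)
          simpa [this] using hj
      · simp only [hvert]
        exact hyZ.2
    have hzf : z ∈ frontier (cellZ d) := by
      refine ⟨closure_mono hopen ?_, fun h => hzZ (interior_subset h)⟩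
      rw [closure_openSegment]
      exact right_mem_segment ℝ y z
    obtain ⟨p, hp1, hp2⟩ := isPreconnected_inter_frontier (convex_segment y z).isPreconnected (t := P.Zs)
      ⟨y, left_mem_segment ℝ y z, hy⟩ ⟨z, right_mem_segment ℝ y z, hzs⟩
    rw [segment_eq_image'] at hp1
    obtain ⟨t, ht, rfl⟩ := hp1
    have hlat : y + t • (z - y) ∈ lateral P.Zs := by
      refine ⟨hp2, ?_⟩
      have := hyZ.2
      rintro (h | h)
      · have h' := h.2
        rw [hvert] at h'
        rw [h'] at this
        simp [sgn] at this
      · have h' := h.2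
        rw [hvert] at h'
        rw [h'] at this
        simp [sgn] at this
    have h1 := H _ hlat z hzf (by rintro (h | h) <;> exact hzY h.1)
    refine h1.trans ?_
    have : y + t • (z - y) - z = (-((1 - t) * (c - bar y i))) • EuclideanSpace.single i.castSucc (1 : ℝ) := by
      rw [hseg, hz, add_sub_add_left_eq_sub, ← sub_smul]
      congr 1
      ring
    rw [dist_eq_norm, this, norm_smul, PiLp.norm_single, norm_one, mul_one, norm_neg,
      Real.norm_eq_abs, abs_mul, abs_of_nonneg (by linarith [ht.2]), abs_sub_comm]
    exact mul_le_of_le_one_left (abs_nonneg _) (by linarith [ht.1])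
  refine ⟨min ρ (1 / 2), by positivity, min_le_right _ _, ?_⟩
  have hclosed : IsClosed {y : E (d + 1) | ∀ i : Fin d, min ρ (1 / 2) ≤ bar y i ∧
      bar y i ≤ 1 - min ρ (1 / 2)} := by
    simp only [ofPred_forall, bar_apply]
    refine isClosed_iInter fun i => ?_
    have hc : Continuous fun y : E (d + 1) => y i.castSucc := by fun_prop
    exact (isClosed_le continuous_const hc).inter (isClosed_le hc continuous_const)
  intro y hy
  refine (hclosed.closure_subset_iff.2 fun y hy i => ?_) hy
  have h1 := key y hy i 0 (Or.inl rfl)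
  have h2 := key y hy i 1 (Or.inr rfl)
  have h3 := (hP.zs_subset hy).1 i
  rw [sub_zero, abs_of_pos h3.1] at h1
  rw [abs_sub_comm, abs_of_pos (by linarith [h3.2])] at h2
  have := min_le_left ρ (1 / 2)
  constructor <;> linarith

end Problem

end

section

namespace Problem

variable {d : ℕ} {P : Problem d}

/-! ### Invariance of the microscopic domain under lattice translations -/

/-- Every point of the closed channel has distance at least `ρ` to the lateral faces of the cell. -/
def Margin (P : Problem d) (ρ : ℝ) : Prop :=
  ∀ y ∈ closure P.Zs, ∀ i, ρ ≤ bar y i ∧ bar y i ≤ 1 - ρ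

/-- The union of the copies of `A` in the cells of the layer. -/
def copies (P : Problem d) (ε : ℝ) (A : Set (E (d + 1))) : Set (E (d + 1)) :=
  ⋃ k ∈ P.idx ε, copy ε k A

lemma mem_copies {ε : ℝ} {A : Set (E (d + 1))} {x : E (d + 1)} :
    x ∈ P.copies ε A ↔ ∃ k ∈ P.idx ε, x ∈ copy ε k A := by simp [copies]

lemma mem_idx_iff {ε : ℝ} (hε : 0 < ε) {k : Fin d → ℤ} :
    k ∈ P.idx ε ↔ copyBar ε k (cellY d) ⊆ P.Sig := by
  constructor
  · intro h x hx
    rw [mem_copyBar hε] at hx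
    have : mkPt x 0 ∈ copy ε k (cellZ d) := by
      rw [mem_copy hε]
      refine ⟨?_, by simp⟩
      rw [bar_sub, bar_smul, bar_mkPt, bar_mkPt]
      exact hx
    simpa using (h this).1
  · intro h x hx
    rw [mem_copy hε] at hx
    refine ⟨h ?_, ?_⟩
    · rw [mem_copyBar hε]
      have := hx.1
      rwa [bar_sub, bar_smul, bar_mkPt] at this
    · have := hx.2
      rw [vert_sub, vert_smul, vert_mkPt, sub_zero, mem_Ioo, (coord_iff hε _ _).2.1,
        (coord_iff hε _ _).2.2.2] at this
      exact ⟨by linarith [this.1], by linarith [this.2]⟩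

lemma Margin.copy_coord {ρ : ℝ} (hm : P.Margin ρ) {ε : ℝ} (hε : 0 < ε) {k : Fin d → ℤ}
    {x : E (d + 1)} (hx : x ∈ copy ε k (closure P.Zs)) (i : Fin d) :
    ε * (k i + ρ) ≤ bar x i ∧ bar x i ≤ ε * (k i + 1 - ρ) := by
  rw [mem_copy hε] at hx
  have h := hm _ hx i
  rw [bar_sub, bar_smul, bar_mkPt] at h
  simp only [PiLp.sub_apply, PiLp.smul_apply, smul_eq_mul, intVec_apply] at h
  rw [← (coord_iff hε _ _).1, ← (coord_iff hε _ _).2.2.1]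
  constructor <;> linarith

lemma Margin.copy_coord' {ρ : ℝ} (hm : P.Margin ρ) (hρ : 0 < ρ) {ε : ℝ} (hε : 0 < ε)
    {k : Fin d → ℤ} {x : E (d + 1)} (hx : x ∈ copy ε k (closure P.Zs)) (i : Fin d) :
    ε * k i < bar x i ∧ bar x i < ε * (k i + 1) := by
  have h := hm.copy_coord hε hx i
  have : 0 < ε * ρ := by positivity
  constructor <;> nlinarith

lemma copy_mono {ε : ℝ} {k : Fin d → ℤ} {A B : Set (E (d + 1))} (h : A ⊆ B) :
    copy ε k A ⊆ copy ε k B := image_mono h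

lemma eq_of_coord {ε : ℝ} (hε : 0 < ε) {x : E d} {k k' : Fin d → ℤ}
    (h : ∀ i, ε * k i < x i ∧ x i < ε * (k i + 1))
    (h' : ∀ i, ε * k' i ≤ x i ∧ x i ≤ ε * (k' i + 1)) : k = k' := by
  ext i
  have h1 := h i
  have h2 := h' i
  have a1 : (k i : ℝ) < k' i + 1 := lt_of_mul_lt_mul_left (h1.1.trans_le h2.2) hε.le
  have a2 : (k' i : ℝ) < k i + 1 := lt_of_mul_lt_mul_left (h2.1.trans_lt h1.2) hε.le
  have a3 : k i < k' i + 1 := by exact_mod_cast a1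
  have a4 : k' i < k i + 1 := by exact_mod_cast a2
  omega

lemma topBot_subset_closure (s : Bool) : topBot P.Zs s ⊆ closure P.Zs :=
  fun _ h => frontier_subset_closure h.1

lemma lateral_subset_closure : lateral P.Zs ⊆ closure P.Zs :=
  fun _ h => frontier_subset_closure h.1

lemma isOpen_copy {ε : ℝ} (hε : 0 < ε) (k : Fin d → ℤ) {A : Set (E (d + 1))} (hA : IsOpen A) :
    IsOpen (copy ε k A) := by
  have : copy ε k A = (fun x => ε⁻¹ • x - mkPt (intVec k) 0) ⁻¹' A := by
    ext x; exact mem_copy hε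
  rw [this]
  exact hA.preimage (by fun_prop)

lemma measurableSet_copy {ε : ℝ} (hε : 0 < ε) (k : Fin d → ℤ) {A : Set (E (d + 1))}
    (hA : MeasurableSet A) : MeasurableSet (copy ε k A) := by
  have : copy ε k A = (fun x => ε⁻¹ • x - mkPt (intVec k) 0) ⁻¹' A := by
    ext x; exact mem_copy hε
  rw [this]
  exact hA.preimage (by fun_prop)

lemma measurableSet_copies {ε : ℝ} (hε : 0 < ε) {A : Set (E (d + 1))}
    (hA : MeasurableSet A) : MeasurableSet (P.copies ε A) :=
  MeasurableSet.biUnion (to_countable _) fun k _ => measurableSet_copy hε k hA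

lemma Admissible.isOpen_zs (hP : P.Admissible) : IsOpen P.Zs := hP.zs_lipschitz.1
lemma Admissible.isOpen_chan (hP : P.Admissible) {ε : ℝ} (hε : 0 < ε) : IsOpen (P.chan ε) :=
  isOpen_biUnion fun k _ => isOpen_copy hε k hP.isOpen_zs
lemma Admissible.isOpen_bulk (hP : P.Admissible) (ε : ℝ) (s : Bool) : IsOpen (P.bulk ε s) :=
  isOpen_cyl hP.sig_lipschitz.1 (by cases s <;> simp [bulkIoo, isOpen_Ioo])

lemma measurableSet_topBot (s : Bool) : MeasurableSet (topBot P.Zs s) :=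
  isClosed_frontier.measurableSet.inter
    ((isClosed_eq continuous_vert continuous_const).measurableSet)

lemma measurableSet_lateral : MeasurableSet (lateral P.Zs) :=
  isClosed_frontier.measurableSet.diff ((measurableSet_topBot _).union (measurableSet_topBot _))

lemma measurableSet_chanN {ε : ℝ} (hε : 0 < ε) : MeasurableSet (P.chanN ε) :=
  measurableSet_copies hε measurableSet_lateral

lemma measurableSet_Oe (ε : ℝ) : MeasurableSet (P.Oe ε) := isOpen_interior.measurableSet

lemma Admissible.bulk_subset_Oe (hP : P.Admissible) (ε : ℝ) (s : Bool) : P.bulk ε s ⊆ P.Oe ε := by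
  refine interior_maximal ?_ (hP.isOpen_bulk ε s)
  intro x hx
  cases s
  · exact Or.inl (Or.inl (Or.inr hx))
  · exact Or.inl (Or.inl (Or.inl hx))

lemma Admissible.chan_subset_Oe (hP : P.Admissible) {ε : ℝ} (hε : 0 < ε) : P.chan ε ⊆ P.Oe ε :=
  interior_maximal (fun _ hx => Or.inl (Or.inr hx)) (hP.isOpen_chan hε)

lemma Admissible.chan_vert (hP : P.Admissible) {ε : ℝ} {x : E (d + 1)}
    (hx : x ∈ P.chan ε) : vert x ∈ Ioo (-ε) ε := by
  obtain ⟨k, hk, hx⟩ := mem_copies.1 hx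
  exact (hk (copy_mono hP.zs_subset hx)).2

namespace Cutoff

variable {h ε ρ M : ℝ} (c : Cutoff P h ε ρ M)

/-- The open cylinder containing the support of the cut-off function. -/
def cS : Set (E (d + 1)) := cyl c.S univ

lemma isOpen_cS : IsOpen c.cS := isOpen_cyl c.isOpen_S isOpen_univ

lemma mem_cS {x : E (d + 1)} : x ∈ c.cS ↔ bar x ∈ c.S := by simp [cS, cyl]

lemma η_zero {x : E (d + 1)} (hx : x ∉ c.cS) : c.η x = 0 := by
  by_contra h0
  exact hx (c.tsupport_subset (subset_tsupport _ h0))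

lemma exists_cell (hε : 0 < ε) (x : E d) :
    ∃ k : Fin d → ℤ, ∀ i, ε * k i ≤ x i ∧ x i < ε * (k i + 1) := by
  refine ⟨floorVec (ε⁻¹ • x), fun i => ?_⟩
  rw [← (coord_iff hε _ _).1, ← (coord_iff hε _ _).2.2.2]
  exact ⟨Int.floor_le _, Int.lt_floor_add_one _⟩

lemma S_subset_SigI (hε : 0 < ε) : c.S ⊆ P.SigI h := by
  intro x hx
  obtain ⟨k, hk⟩ := exists_cell hε x
  exact c.cell x hx k hk ((mem_copyBar_closure_cellY hε).2 fun i => ⟨(hk i).1, (hk i).2.le⟩)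

lemma S_subset_SigHat (hε : 0 < ε) : c.S ⊆ P.SigHat ε h := by
  refine interior_maximal (fun x hx => ?_) c.isOpen_S
  obtain ⟨k, hk⟩ := exists_cell hε x
  refine mem_biUnion (x := k) ?_
    ((mem_copyBar_closure_cellY hε).2 fun i => ⟨(hk i).1, (hk i).2.le⟩)
  exact (image_mono subset_closure).trans (c.cell x hx k hk)

lemma add_mem_idx (hε : 0 < ε) {x : E d} (hx : x ∈ c.S) {k l : Fin d → ℤ}
    (hk : ∀ i, ε * k i ≤ x i ∧ x i < ε * (k i + 1)) (hl : ‖shiftVec ε l‖ ≤ h) :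
    k + l ∈ P.idx ε := by
  rw [mem_idx_iff hε]
  intro y hy
  have hl' : ‖ε • intVec l‖ ≤ h := by
    rw [← bar_shiftVec]
    exact (norm_bar_le _).trans hl
  have : y = (y - ε • intVec l) + ε • intVec l := by abel
  rw [this]
  refine SigI.add_mem (c.cell x hx k hk ?_) hl'
  rw [mem_copyBar_closure_cellY hε]
  rw [mem_copyBar_cellY hε] at hy
  intro i
  have := hy i
  simp only [PiLp.sub_apply, PiLp.smul_apply, intVec_apply, smul_eq_mul, Pi.add_apply,
    Int.cast_add] at this ⊢
  constructor <;> linarith [this.1, this.2]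

/-- Inside the support of the cut-off function, the family of the copies of `A` is invariant under
admissible lattice translations.  The index set of the cells is, since a cell and its translate both
lie in `Σ`. -/
lemma copies_shift (hm : P.Margin ρ) (hρ : 0 < ρ) (hε : 0 < ε) {l : Fin d → ℤ}
    (hl : ‖shiftVec ε l‖ ≤ h) {A : Set (E (d + 1))} (hA : A ⊆ closure P.Zs) :
    ∀ x ∈ c.cS, (x + shiftVec ε l ∈ P.copies ε A ↔ x ∈ P.copies ε A) := by
  intro x hx
  rw [mem_cS] at hx
  have h0 : (0 : ℝ) ≤ h := (norm_nonneg _).trans hl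
  simp only [mem_copies]
  constructor
  · rintro ⟨k, hk, hxk⟩
    have hk' : k = (k - l) + l := by abel
    rw [hk', add_shiftVec_mem_copy hε] at hxk
    refine ⟨k - l, ?_, hxk⟩
    have := c.add_mem_idx hε hx (k := k - l) (l := 0) (fun i => ?_) (by
      simpa [shiftVec, intVec, mkPt, EuclideanSpace.norm_eq, Fin.sum_univ_castSucc] using h0)
    · simpa using this
    · have := hm.copy_coord' hρ hε (copy_mono hA hxk) i
      exact ⟨this.1.le, this.2⟩
  · rintro ⟨k, hk, hxk⟩
    refine ⟨k + l, c.add_mem_idx hε hx (fun i => ?_) hl, (add_shiftVec_mem_copy hε).2 hxk⟩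
    have := hm.copy_coord' hρ hε (copy_mono hA hxk) i
    exact ⟨this.1.le, this.2⟩

lemma bulk_shift (hε : 0 < ε) {l : Fin d → ℤ} (hl : ‖shiftVec ε l‖ ≤ h) (s : Bool) :
    ∀ x ∈ c.cS, (x + shiftVec ε l ∈ P.bulk ε s ↔ x ∈ P.bulk ε s) := by
  intro x hx
  rw [mem_cS] at hx
  have hS := c.S_subset_SigI hε hx
  have hl' : ‖ε • intVec l‖ ≤ h := by
    rw [← bar_shiftVec]
    exact (norm_bar_le _).trans hl
  have h1 : bar x + ε • intVec l ∈ P.Sig := SigI.add_mem hS hl'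
  simp only [bulk, cyl, mem_ofPred_eq, bar_add, bar_shiftVec, vert_add, vert_shiftVec, add_zero]
  exact ⟨fun hh => ⟨hS.1, hh.2⟩, fun hh => ⟨h1, hh.2⟩⟩

lemma _root_.Channels.interior_shift {X : Type*} [NormedAddCommGroup X] {U S : Set X} {s : X}
    (hS : IsOpen S) (h : ∀ x ∈ S, (x + s ∈ U ↔ x ∈ U)) :
    ∀ x ∈ S, (x + s ∈ interior U ↔ x ∈ interior U) := by
  intro x hx
  have e : interior ((· + s) ⁻¹' U) = (· + s) ⁻¹' interior U :=
    ((Homeomorph.addRight s).preimage_interior U).symm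
  have e2 : interior (S ∩ (· + s) ⁻¹' U) = interior (S ∩ U) := by
    congr 1
    ext y
    exact and_congr_right fun hy => h y hy
  rw [interior_inter, interior_inter, hS.interior_eq, e] at e2
  have := Set.ext_iff.1 e2 x
  simpa [hx] using this

lemma Oe_shift (hm : P.Margin ρ) (hρ : 0 < ρ) (hε : 0 < ε) {l : Fin d → ℤ}
    (hl : ‖shiftVec ε l‖ ≤ h) :
    ∀ x ∈ c.cS, (x + shiftVec ε l ∈ P.Oe ε ↔ x ∈ P.Oe ε) := by
  refine interior_shift c.isOpen_cS fun x hx => ?_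
  have h1 := c.bulk_shift hε hl true x hx
  have h2 := c.bulk_shift hε hl false x hx
  have h3 := c.copies_shift hm hρ hε hl subset_closure x hx
  have h4 := c.copies_shift hm hρ hε hl (topBot_subset_closure true) x hx
  have h5 := c.copies_shift hm hρ hε hl (topBot_subset_closure false) x hx
  unfold chan iface
  unfold copies at h3 h4 h5
  simp only [mem_union, h1, h2, h3, h4, h5]

lemma shiftInv_bulk (hP : P.Admissible) (hε : 0 < ε) {l : Fin d → ℤ}
    (hl : ‖shiftVec ε l‖ ≤ h) (s : Bool) :
    ShiftInv (volume.restrict (P.bulk ε s)) c.cS (shiftVec ε l) :=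
  shiftInv_restrict (hP.isOpen_bulk ε s).measurableSet c.isOpen_cS.measurableSet
    (c.bulk_shift hε hl s)

lemma shiftInv_chan (hP : P.Admissible) (hm : P.Margin ρ) (hρ : 0 < ρ) (hε : 0 < ε)
    {l : Fin d → ℤ} (hl : ‖shiftVec ε l‖ ≤ h) :
    ShiftInv (volume.restrict (P.chan ε)) c.cS (shiftVec ε l) :=
  shiftInv_restrict (hP.isOpen_chan hε).measurableSet c.isOpen_cS.measurableSet
    (c.copies_shift hm hρ hε hl subset_closure)

lemma shiftInv_chanN (hm : P.Margin ρ) (hρ : 0 < ρ) (hε : 0 < ε)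
    {l : Fin d → ℤ} (hl : ‖shiftVec ε l‖ ≤ h) :
    ShiftInv ((μHE[d] : Measure (E (d + 1))).restrict (P.chanN ε)) c.cS (shiftVec ε l) :=
  shiftInv_restrict (measurableSet_chanN hε) c.isOpen_cS.measurableSet
    (c.copies_shift hm hρ hε hl lateral_subset_closure)

lemma shiftInv_Oe (hm : P.Margin ρ) (hρ : 0 < ρ) (hε : 0 < ε)
    {l : Fin d → ℤ} (hl : ‖shiftVec ε l‖ ≤ h) :
    ShiftInv (volume.restrict (P.Oe ε)) c.cS (shiftVec ε l) :=
  shiftInv_restrict (measurableSet_Oe ε) c.isOpen_cS.measurableSet (c.Oe_shift hm hρ hε hl)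

lemma shiftInv_wvol (hP : P.Admissible) (hm : P.Margin ρ) (hρ : 0 < ρ) (hε : 0 < ε)
    {l : Fin d → ℤ} (hl : ‖shiftVec ε l‖ ≤ h) (a : ℝ) :
    ShiftInv (P.wvol ε a) c.cS (shiftVec ε l) :=
  ((c.shiftInv_bulk hP hε hl true).add (c.shiftInv_bulk hP hε hl false)).add
    ((c.shiftInv_chan hP hm hρ hε hl).smul _)

lemma eventually_const (hP : P.Admissible) (hm : P.Margin ρ) (hε : 0 < ε) {x : E (d + 1)}
    (hx : x ∈ P.chan ε) : ∃ a, ∀ᶠ y in nhds x, c.η y = a := by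
  obtain ⟨k, hk, hx⟩ := mem_copies.1 hx
  obtain ⟨a, ha⟩ := c.eq_const k
  refine ⟨a, Filter.eventually_of_mem ((isOpen_copy hε k hP.isOpen_zs).mem_nhds hx) fun y hy => ?_⟩
  exact ha y (hm.copy_coord hε (copy_mono subset_closure hy))

lemma fderiv_eq_zero (hP : P.Admissible) (hm : P.Margin ρ) (hε : 0 < ε) {x : E (d + 1)}
    (hx : x ∈ P.chan ε) : fderiv ℝ c.η x = 0 := by
  obtain ⟨a, ha⟩ := c.eventually_const hP hm hε hx
  have : c.η =ᶠ[nhds x] fun _ => a := ha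
  rw [this.fderiv_eq, fderiv_fun_const, Pi.zero_apply]

lemma eq_one_of_mem_chanHat (hm : P.Margin ρ) (hρ : 0 < ρ) (hε : 0 < ε)
    {x : E (d + 1)} (hx : x ∈ P.chanHat ε (2 * h)) : c.η x = 1 := by
  obtain ⟨hx1, hx2⟩ := hx
  obtain ⟨k, hk, hx1⟩ := mem_copies.1 hx1
  have hx3 := copy_mono subset_closure hx1
  obtain ⟨k', hk', hx4⟩ := mem_iUnion₂.1 (interior_subset hx2.1)
  have : k = k' := eq_of_coord hε (hm.copy_coord' hρ hε hx3)
    ((mem_copyBar_closure_cellY hε).1 hx4)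
  subst this
  exact c.eq_one k hk' x (hm.copy_coord hε hx3)

lemma chan_inter_subset (hP : P.Admissible) (hε : 0 < ε) :
    c.cS ∩ P.chan ε ⊆ P.chanHat ε h := fun _ hx =>
  ⟨hx.2, c.S_subset_SigHat hε (c.mem_cS.1 hx.1), hP.chan_vert hx.2⟩

lemma bulk_inter_subset (hε : 0 < ε) (s : Bool) :
    c.cS ∩ P.bulk ε s ⊆ P.bulkHat ε h s := fun _ hx =>
  ⟨c.S_subset_SigHat hε (c.mem_cS.1 hx.1), hx.2.2⟩

lemma bulk_inter_subset_bulkI (hε : 0 < ε) (s : Bool) :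
    c.cS ∩ P.bulk ε s ⊆ P.bulkI ε h s := fun x hx =>
  ⟨hx.2, c.S_subset_SigI hε (c.mem_cS.1 hx.1), by
    have := hx.2.2
    cases s <;> simp only [bulkIoo, if_true, Bool.false_eq_true, if_false, mem_Ioo] at this ⊢ <;>
      constructor <;> linarith [this.1, this.2]⟩

end Cutoff
end Problem

end

section

/-! ### The trace inequality on Lipschitz domains -/

section Trace

/-- The value at the start of a segment is controlled by the values and the derivative along it. -/
lemma sq_le_integral_segment {X : Type*} [NormedAddCommGroup X] [NormedSpace ℝ X] {φ : X → ℝ}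
    (hφ : ContDiff ℝ 1 φ) (z : X) {e : X} (he : ‖e‖ = 1) {t θ : ℝ} (ht : 0 < t) (hθ : 0 < θ) :
    φ z ^ 2 ≤ ∫ τ in (0 : ℝ)..t, ((1 / t + 1 / θ) * φ (z + τ • e) ^ 2 +
      θ * ‖fderiv ℝ φ (z + τ • e)‖ ^ 2) := by
  have hline : ∀ τ : ℝ, HasDerivAt (fun τ : ℝ => z + τ • e) e τ := fun τ => by
    simpa using ((hasDerivAt_id τ).smul_const e).const_add z
  have hφd : ∀ τ : ℝ, HasDerivAt (fun τ : ℝ => φ (z + τ • e)) (fderiv ℝ φ (z + τ • e) e) τ :=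
    fun τ => ((hφ.differentiable one_ne_zero _).hasFDerivAt).comp_hasDerivAt τ (hline τ)
  have hd : ∀ τ : ℝ, HasDerivAt (fun τ : ℝ => (τ / t - 1) * φ (z + τ • e) ^ 2)
      (1 / t * φ (z + τ • e) ^ 2 +
        (τ / t - 1) * (2 * φ (z + τ • e) * fderiv ℝ φ (z + τ • e) e)) τ := by
    intro τ
    have h1 : HasDerivAt (fun τ : ℝ => τ / t - 1) (1 / t) τ :=
      ((hasDerivAt_id τ).div_const t).sub_const 1
    have h2 := h1.mul ((hφd τ).pow 2)
    refine h2.congr_deriv ?_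
    simp
  have hc1 : Continuous fun τ : ℝ => φ (z + τ • e) := hφ.continuous.comp (by fun_prop)
  have hc2 : Continuous fun τ : ℝ => fderiv ℝ φ (z + τ • e) :=
    (hφ.continuous_fderiv one_ne_zero).comp (by fun_prop)
  have hc3 : Continuous fun τ : ℝ => fderiv ℝ φ (z + τ • e) e := hc2.clm_apply continuous_const
  have hft := intervalIntegral.integral_eq_sub_of_hasDerivAt (a := 0) (b := t) (fun τ _ => hd τ)
    (Continuous.intervalIntegrable (by fun_prop) _ _)
  have e1 : φ z ^ 2 = ∫ τ in (0 : ℝ)..t, (1 / t * φ (z + τ • e) ^ 2 +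
        (τ / t - 1) * (2 * φ (z + τ • e) * fderiv ℝ φ (z + τ • e) e)) := by
    rw [hft]
    simp [ht.ne']
  rw [e1]
  refine intervalIntegral.integral_mono_on ht.le (Continuous.intervalIntegrable (by fun_prop) _ _)
    (Continuous.intervalIntegrable (by fun_prop) _ _) fun τ hτ => ?_
  have h1 : |fderiv ℝ φ (z + τ • e) e| ≤ ‖fderiv ℝ φ (z + τ • e)‖ := by
    have := (fderiv ℝ φ (z + τ • e)).le_opNorm e
    rwa [he, mul_one] at this
  have h2 : |τ / t - 1| ≤ 1 := by
    rw [abs_le]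
    have := div_nonneg hτ.1 ht.le
    have := (div_le_one ht).2 hτ.2
    constructor <;> linarith
  set a := φ (z + τ • e)
  set b := fderiv ℝ φ (z + τ • e) e
  set n := ‖fderiv ℝ φ (z + τ • e)‖
  have h3 : (τ / t - 1) * (2 * a * b) ≤ 2 * |a| * n := by
    calc (τ / t - 1) * (2 * a * b) ≤ |(τ / t - 1) * (2 * a * b)| := le_abs_self _
      _ = |τ / t - 1| * (2 * |a| * |b|) := by rw [abs_mul, abs_mul, abs_mul, abs_two]
      _ ≤ 1 * (2 * |a| * n) := by gcongr
      _ = _ := one_mul _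
  have h4 : 2 * |a| * n ≤ 1 / θ * a ^ 2 + θ * n ^ 2 := by
    have : 0 ≤ (1 / θ) * (|a| - θ * n) ^ 2 := by positivity
    have e : (1 / θ) * (|a| - θ * n) ^ 2 = 1 / θ * |a| ^ 2 + θ * n ^ 2 - 2 * |a| * n := by
      field_simp; ring
    rw [e, sq_abs] at this
    linarith
  linarith [add_mul (1 / t) (1 / θ) (a ^ 2)]

variable {d : ℕ}

/-- The hyperplane orthogonal to `e`. -/
abbrev hyp (e : E (d + 1)) : Submodule ℝ (E (d + 1)) := (Submodule.span ℝ {e})ᗮ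

lemma inner_hyp {e : E (d + 1)} (y : hyp e) : inner ℝ e (y : E (d + 1)) = 0 :=
  Submodule.mem_orthogonal_singleton_iff_inner_right.1 y.2

lemma proj_add_inner {e : E (d + 1)} (he : ‖e‖ = 1) (x : E (d + 1)) :
    (((hyp e).orthogonalProjectionOnto x : hyp e) : E (d + 1)) + (inner ℝ e x : ℝ) • e = x := by
  have h := (Submodule.span ℝ {e}).starProjection_add_starProjection_orthogonal x
  rw [Submodule.starProjection_unit_singleton ℝ he] at h
  exact (add_comm _ _).trans h

lemma proj_graph {e : E (d + 1)} (y : hyp e) (τ : ℝ) :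
    (hyp e).orthogonalProjectionOnto ((y : E (d + 1)) + τ • e) = y := by
  rw [map_add, Submodule.orthogonalProjectionOnto_mem_subspace_eq_self, map_smul,
    Submodule.orthogonalProjectionOnto_orthogonalComplement_singleton_eq_zero, smul_zero, add_zero]

/-- The coordinates `x = y + τ e` with `y ⟂ e`. -/
def coordE {e : E (d + 1)} (he : ‖e‖ = 1) : (hyp e × ℝ) ≃L[ℝ] E (d + 1) :=
  LinearEquiv.toContinuousLinearEquiv
    { toFun := fun p => (p.1 : E (d + 1)) + p.2 • e
      map_add' := fun p q => by simp [add_smul]; abel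
      map_smul' := fun c p => by simp [mul_smul]
      invFun := fun x => ((hyp e).orthogonalProjectionOnto x, inner ℝ e x)
      left_inv := fun p => by
        refine Prod.ext (proj_graph p.1 p.2) ?_
        simp [inner_add_right, inner_smul_right, inner_hyp, he]
      right_inv := fun x => proj_add_inner he x }

/-- Fubini's theorem in the coordinates `x = y + τ e`, up to a constant factor. -/
lemma exists_lintegral_coord {e : E (d + 1)} (he : ‖e‖ = 1) : ∃ c : ℝ≥0,
    ∀ g : E (d + 1) → ℝ≥0∞, Measurable g →
      ∫⁻ y : hyp e, ∫⁻ τ : ℝ, g ((y : E (d + 1)) + τ • e) = c * ∫⁻ x, g x := by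
  set μ : Measure (E (d + 1)) := Measure.map (coordE he) (volume.prod volume) with hμ
  have : μ.IsAddHaarMeasure := (coordE he).isAddHaarMeasure_map _
  refine ⟨μ.addHaarScalarFactor volume, fun g hg => ?_⟩
  have h1 : ∫⁻ x, g x ∂μ = ∫⁻ y : hyp e, ∫⁻ τ : ℝ, g ((y : E (d + 1)) + τ • e) := by
    rw [hμ, lintegral_map hg (coordE he).continuous.measurable,
      lintegral_prod (fun p => g (coordE he p))
        (hg.comp (coordE he).continuous.measurable).aemeasurable]
    rfl
  rw [← h1]
  conv_lhs => rw [Measure.isAddLeftInvariant_eq_smul μ volume]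
  rw [lintegral_smul_measure]
  rfl

lemma finrank_hyp {e : E (d + 1)} (he : ‖e‖ = 1) : Module.finrank ℝ (hyp e) = d := by
  have : Fact (Module.finrank ℝ (E (d + 1)) = d + 1) := ⟨by simp⟩
  exact Submodule.finrank_orthogonal_span_singleton (by
    intro h; rw [h, norm_zero] at he; exact zero_ne_one he)

lemma euclideanHausdorffMeasure_image_le {X Y : Type*} [EMetricSpace X] [MeasurableSpace X]
    [BorelSpace X] [EMetricSpace Y] [MeasurableSpace Y] [BorelSpace Y] {f : X → Y} {L : ℝ≥0}
    (hf : LipschitzWith L f) (n : ℕ) (s : Set X) :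
    (μHE[n] : Measure Y) (f '' s) ≤ (L : ℝ≥0∞) ^ n * (μHE[n] : Measure X) s := by
  have h := hf.hausdorffMeasure_image_le (d := (n : ℝ)) (Nat.cast_nonneg n) s
  rw [ENNReal.rpow_natCast] at h
  rw [Measure.euclideanHausdorffMeasure_def, Measure.euclideanHausdorffMeasure_def,
    Measure.smul_apply, Measure.smul_apply, ENNReal.smul_def, ENNReal.smul_def, smul_eq_mul,
    smul_eq_mul, mul_left_comm]
  gcongr

/-- Integrals over a piece of a Lipschitz graph are controlled by integrals over the hyperplane. -/
lemma lintegral_graph_le {e : E (d + 1)} (he : ‖e‖ = 1) {γ : hyp e → ℝ} {K : ℝ≥0}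
    (hγ : LipschitzWith K γ) {A : Set (E (d + 1))}
    (hAg : ∀ x ∈ A, γ ((hyp e).orthogonalProjectionOnto x) = inner ℝ e x)
    (g : E (d + 1) → ℝ≥0∞) (hg : Measurable g) :
    ∫⁻ x in A, g x ∂μHE[d] ≤ ((1 + K : ℝ≥0) : ℝ≥0∞) ^ d *
      ∫⁻ y in (fun y : hyp e => (y : E (d + 1)) + γ y • e) ⁻¹' A, g ((y : E (d + 1)) + γ y • e) := by
  set Φ : hyp e → E (d + 1) := fun y => (y : E (d + 1)) + γ y • e with hΦ
  have hΦl : LipschitzWith (1 + K) Φ := by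
    have h1 : LipschitzWith 1 fun y : hyp e => (y : E (d + 1)) := LipschitzWith.subtype_val _
    refine h1.add (LipschitzWith.of_dist_le_mul fun x y => ?_)
    rw [dist_eq_norm, ← sub_smul, norm_smul, he, mul_one, ← dist_eq_norm]
    exact hγ.dist_le_mul x y
  have hΦm : Measurable Φ := hΦl.continuous.measurable
  have hvol : (volume : Measure (hyp e)) = μHE[d] := by
    rw [← InnerProductSpace.euclideanHausdorffMeasure_eq_volume, finrank_hyp he]
  have hle : (μHE[d] : Measure (E (d + 1))).restrict A ≤ (((1 + K : ℝ≥0) : ℝ≥0∞) ^ d) •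
      Measure.map Φ ((volume : Measure (hyp e)).restrict (Φ ⁻¹' A)) := by
    rw [Measure.le_iff]
    intro B hB
    rw [Measure.restrict_apply hB, Measure.smul_apply, Measure.map_apply hΦm hB,
      Measure.restrict_apply (hΦm hB), smul_eq_mul, ← preimage_inter, hvol]
    have : B ∩ A ⊆ Φ '' (Φ ⁻¹' (B ∩ A)) := by
      intro x hx
      have hxe : Φ ((hyp e).orthogonalProjectionOnto x) = x := by
        rw [hΦ]
        simp only
        rw [hAg x hx.2]
        exact proj_add_inner he x
      exact ⟨_, by rw [mem_preimage, hxe]; exact hx, hxe⟩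
    exact (measure_mono this).trans (euclideanHausdorffMeasure_image_le hΦl d _)
  refine (lintegral_mono' hle le_rfl).trans ?_
  rw [lintegral_smul_measure, lintegral_map hg hΦm, smul_eq_mul]

/-- The trace inequality near a boundary point: the value on the boundary is estimated by the values on
a segment of fixed length in the direction `e`, which points into the domain. -/
lemma exists_trace_local {U : Set (E (d + 1))} (hU : IsLipschitzDomain U) {p : E (d + 1)}
    (hp : p ∈ frontier U) : ∃ r > 0, ∃ C : ℝ≥0, ∃ t > 0, ∀ θ : ℝ, 0 < θ → ∀ φ : E (d + 1) → ℝ,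
      ContDiff ℝ 1 φ → ∫⁻ x in frontier U ∩ Metric.ball p r, ENNReal.ofReal (φ x ^ 2) ∂μHE[d] ≤
        C * ∫⁻ x in U, ENNReal.ofReal ((1 / t + 1 / θ) * φ x ^ 2 + θ * ‖fderiv ℝ φ x‖ ^ 2) := by
  obtain ⟨hUo, hU⟩ := hU
  obtain ⟨e, γ, K, r, he, hγ, hr, hgr⟩ := hU p hp
  obtain ⟨c, hc⟩ := exists_lintegral_coord he
  refine ⟨r / 2, by positivity, (1 + K) ^ d * c, r / 4, by positivity, fun θ hθ φ hφ => ?_⟩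
  set t := r / 4 with ht
  have ht0 : 0 < t := by positivity
  set G : E (d + 1) → ℝ≥0∞ := fun x =>
    ENNReal.ofReal ((1 / t + 1 / θ) * φ x ^ 2 + θ * ‖fderiv ℝ φ x‖ ^ 2) with hG
  have hφc := hφ.continuous
  have hφ'c := hφ.continuous_fderiv one_ne_zero
  have hGm : Measurable G := by
    refine ENNReal.measurable_ofReal.comp (Continuous.measurable ?_)
    fun_prop
  set A := frontier U ∩ Metric.ball p (r / 2) with hA
  have hAm : MeasurableSet A := isClosed_frontier.measurableSet.inter measurableSet_ball
  have hAg : ∀ x ∈ A, γ ((hyp e).orthogonalProjectionOnto x) = inner ℝ e x := by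
    intro x hx
    have hxr : x ∈ Metric.ball p r := Metric.ball_subset_ball (by linarith) hx.2
    have hxU : x ∉ U := fun h => by
      have := hx.1.2
      rw [hUo.interior_eq] at this
      exact this h
    rw [hgr x hxr, not_lt] at hxU
    refine le_antisymm ?_ hxU
    by_contra! hlt
    -- otherwise a neighbourhood of `x` would lie outside of `U`
    have hop : IsOpen {z : E (d + 1) | inner ℝ e z < γ ((hyp e).orthogonalProjectionOnto z)} :=
      isOpen_lt (by fun_prop) (hγ.continuous.comp (ContinuousLinearMap.continuous _))
    obtain ⟨z, hz, hzU⟩ := mem_closure_iff.1 hx.1.1 _ (hop.inter Metric.isOpen_ball) ⟨hlt, hxr⟩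
    exact absurd ((hgr z hz.2).1 hzU) (not_lt.2 hz.1.le)
  have key : ∀ y : hyp e, (y : E (d + 1)) + γ y • e ∈ A →
      ENNReal.ofReal (φ ((y : E (d + 1)) + γ y • e) ^ 2) ≤
        ∫⁻ τ : ℝ, U.indicator G ((y : E (d + 1)) + (γ y + τ) • e) := by
    intro y hy
    set z := (y : E (d + 1)) + γ y • e with hz
    have h1 := sq_le_integral_segment hφ z he ht0 hθ
    have h2 : ENNReal.ofReal (φ z ^ 2) ≤ ∫⁻ τ in Ioc 0 t, G (z + τ • e) := by
      refine (ENNReal.ofReal_le_ofReal h1).trans ?_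
      rw [intervalIntegral.integral_of_le ht0.le, ofReal_integral_eq_lintegral_ofReal]
      · refine Continuous.integrableOn_Ioc ?_
        fun_prop
      · exact Filter.Eventually.of_forall fun τ => by positivity
    refine h2.trans ?_
    rw [← lintegral_indicator measurableSet_Ioc]
    refine lintegral_mono fun τ => ?_
    by_cases hτ : τ ∈ Ioc 0 t
    · have e1 : (y : E (d + 1)) + (γ y + τ) • e = z + τ • e := by rw [hz, add_smul, add_assoc]
      have hU' : z + τ • e ∈ U := by
        have hb : z + τ • e ∈ Metric.ball p r := by
          have := hy.2
          rw [Metric.mem_ball] at this ⊢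
          have h5 : dist (z + τ • e) z = τ := by
            rw [dist_self_add_left, norm_smul, he, mul_one, Real.norm_eq_abs, abs_of_pos hτ.1]
          linarith [dist_triangle (z + τ • e) z p, hτ.2]
        rw [hgr _ hb, ← e1, proj_graph, inner_add_right, inner_hyp, inner_smul_right,
          real_inner_self_eq_norm_sq, he]
        linarith [hτ.1]
      rw [indicator_of_mem hτ, e1, indicator_of_mem hU']
    · rw [indicator_of_notMem hτ]
      exact zero_le
  have hm1 : Measurable fun x => ENNReal.ofReal (φ x ^ 2) := by
    refine ENNReal.measurable_ofReal.comp (Continuous.measurable ?_)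
    fun_prop
  calc ∫⁻ x in A, ENNReal.ofReal (φ x ^ 2) ∂μHE[d]
      ≤ ((1 + K : ℝ≥0) : ℝ≥0∞) ^ d * ∫⁻ y in (fun y : hyp e => (y : E (d + 1)) + γ y • e) ⁻¹' A,
          ENNReal.ofReal (φ ((y : E (d + 1)) + γ y • e) ^ 2) :=
        lintegral_graph_le he hγ hAg _ hm1
    _ ≤ ((1 + K : ℝ≥0) : ℝ≥0∞) ^ d *
          ∫⁻ y : hyp e, ∫⁻ τ : ℝ, U.indicator G ((y : E (d + 1)) + τ • e) := by
        refine mul_le_mul_right ?_ _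
        have hΦc : Continuous fun y : hyp e => (y : E (d + 1)) + γ y • e :=
          continuous_subtype_val.add (hγ.continuous.smul continuous_const)
        rw [← lintegral_indicator (hAm.preimage hΦc.measurable)]
        refine lintegral_mono fun y => ?_
        rw [← lintegral_add_left_eq_self
          (fun τ : ℝ => U.indicator G ((y : E (d + 1)) + τ • e)) (γ y)]
        by_cases hy : (y : E (d + 1)) + γ y • e ∈ A
        · rw [indicator_of_mem (show y ∈ (fun y : hyp e => (y : E (d + 1)) + γ y • e) ⁻¹' A from hy)]
          exact key y hy
        · rw [indicator_of_notMem
            (show y ∉ (fun y : hyp e => (y : E (d + 1)) + γ y • e) ⁻¹' A from hy)]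
          exact zero_le
    _ = _ := by
        rw [hc _ (hGm.indicator hUo.measurableSet), lintegral_indicator hUo.measurableSet,
          ← mul_assoc]
        push_cast
        rfl

end Trace

end

section

open scoped Pointwise

/-! ### The trace inequality on bounded Lipschitz domains -/

section TraceGlobal

variable {d : ℕ}

/-- The trace inequality with a small constant in front of the gradient, by a finite covering of the
boundary. -/
lemma exists_trace_frontier {U : Set (E (d + 1))} (hU : IsLipschitzDomain U)
    (hb : Bornology.IsBounded U) : ∀ θ : ℝ, 0 < θ → ∃ C : ℝ≥0, ∀ φ : E (d + 1) → ℝ,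
      ContDiff ℝ 1 φ → ∫⁻ x in frontier U, ENNReal.ofReal (φ x ^ 2) ∂μHE[d] ≤
        C * (∫⁻ x in U, ENNReal.ofReal (φ x ^ 2)) +
          ENNReal.ofReal θ * ∫⁻ x in U, ENNReal.ofReal (‖fderiv ℝ φ x‖ ^ 2) := by
  have hc : IsCompact (frontier U) := hb.isCompact_closure.of_isClosed_subset isClosed_frontier
    frontier_subset_closure
  rw [← inter_self (frontier U)]
  refine hc.induction_on (p := fun s => ∀ θ : ℝ, 0 < θ → ∃ C : ℝ≥0, ∀ φ : E (d + 1) → ℝ,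
      ContDiff ℝ 1 φ → ∫⁻ x in frontier U ∩ s, ENNReal.ofReal (φ x ^ 2) ∂μHE[d] ≤
        C * (∫⁻ x in U, ENNReal.ofReal (φ x ^ 2)) +
          ENNReal.ofReal θ * ∫⁻ x in U, ENNReal.ofReal (‖fderiv ℝ φ x‖ ^ 2)) ?_ ?_ ?_ ?_
  · intro θ _
    exact ⟨0, fun φ _ => by simp⟩
  · intro s t hst ht θ hθ
    obtain ⟨C, hC⟩ := ht θ hθ
    exact ⟨C, fun φ hφ => (lintegral_mono_set (inter_subset_inter_right _ hst)).trans (hC φ hφ)⟩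
  · intro s t hs ht θ hθ
    obtain ⟨C, hC⟩ := hs (θ / 2) (by positivity)
    obtain ⟨C', hC'⟩ := ht (θ / 2) (by positivity)
    refine ⟨C + C', fun φ hφ => ?_⟩
    rw [inter_union_distrib_left]
    refine (lintegral_union_le _ _ _).trans ((add_le_add (hC φ hφ) (hC' φ hφ)).trans ?_)
    have : ENNReal.ofReal θ = ENNReal.ofReal (θ / 2) + ENNReal.ofReal (θ / 2) := by
      rw [← ENNReal.ofReal_add (by positivity) (by positivity), add_halves]
    rw [this]
    push_cast
    apply le_of_eq
    ring
  · intro p hp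
    obtain ⟨r, hr, C, t, ht, H⟩ := exists_trace_local hU hp
    refine ⟨Metric.ball p r, mem_nhdsWithin_of_mem_nhds (Metric.ball_mem_nhds p hr),
      fun θ hθ => ?_⟩
    set θ' := θ / (C + 1) with hθ'
    have hC1 : (0 : ℝ) < C + 1 := by positivity
    have hθ'0 : 0 < θ' := by positivity
    refine ⟨C * (1 / t + 1 / θ').toNNReal, fun φ hφ => (H θ' hθ'0 φ hφ).trans ?_⟩
    have hφ1 : Measurable fun x => ENNReal.ofReal (φ x ^ 2) := by
      have := hφ.continuous
      exact ENNReal.measurable_ofReal.comp (Continuous.measurable (by fun_prop))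
    have e1 : ∀ x, ENNReal.ofReal ((1 / t + 1 / θ') * φ x ^ 2 + θ' * ‖fderiv ℝ φ x‖ ^ 2) =
        ENNReal.ofReal (1 / t + 1 / θ') * ENNReal.ofReal (φ x ^ 2) +
          ENNReal.ofReal θ' * ENNReal.ofReal (‖fderiv ℝ φ x‖ ^ 2) := fun x => by
      rw [ENNReal.ofReal_add (by positivity) (by positivity), ENNReal.ofReal_mul (by positivity),
        ENNReal.ofReal_mul hθ'0.le]
    simp only [e1]
    rw [lintegral_add_left (hφ1.const_mul _), lintegral_const_mul' _ _ ENNReal.ofReal_ne_top,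
      lintegral_const_mul' _ _ ENNReal.ofReal_ne_top, mul_add, ← mul_assoc, ← mul_assoc]
    have hCθ : (C : ℝ≥0∞) * ENNReal.ofReal θ' ≤ ENNReal.ofReal θ := by
      rw [← ENNReal.ofReal_coe_nnreal, ← ENNReal.ofReal_mul C.coe_nonneg]
      refine ENNReal.ofReal_le_ofReal ?_
      rw [hθ', mul_div_assoc', div_le_iff₀ hC1]
      nlinarith
    push_cast
    gcongr
    exact le_rfl

/-! ### The trace inequality in the channels -/

/-- The map from the standard cell to the cell with index `k`. -/
def cellMap {ε : ℝ} (hε : 0 < ε) (k : Fin d → ℤ) : E (d + 1) ≃ₜ E (d + 1) :=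
  (Homeomorph.addRight (mkPt (intVec k) 0)).trans (Homeomorph.smulOfNeZero ε hε.ne')

/-- The scaling of the `n`-dimensional Hausdorff measure. -/
lemma map_cellMap {ε : ℝ} (hε : 0 < ε) (k : Fin d → ℤ) (n : ℕ) :
    Measure.map (cellMap hε k) (μHE[n] : Measure (E (d + 1))) =
      ENNReal.ofReal ε⁻¹ ^ n • μHE[n] := by
  ext B hB
  rw [Measure.map_apply (cellMap hε k).continuous.measurable hB, Measure.smul_apply, smul_eq_mul]
  have e1 : cellMap hε k ⁻¹' B = (fun x => x + mkPt (intVec k) 0) ⁻¹' (ε⁻¹ • B) := by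
    ext y
    rw [mem_preimage, mem_preimage, mem_smul_set_iff_inv_smul_mem₀ (inv_ne_zero hε.ne'), inv_inv]
    rfl
  rw [e1, measure_preimage_add_right, Measure.euclideanHausdorffMeasure_smul₀]
  · rw [ENNReal.smul_def, smul_eq_mul]
    congr 1
    push_cast
    congr 1
    change ‖ε⁻¹‖ₑ = _
    rw [← ofReal_norm, Real.norm_eq_abs, abs_of_pos (inv_pos.2 hε)]
  · exact inv_ne_zero hε.ne'

lemma setLIntegral_copy {ε : ℝ} (hε : 0 < ε) (k : Fin d → ℤ) (n : ℕ) (A : Set (E (d + 1)))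
    (g : E (d + 1) → ℝ≥0∞) :
    ∫⁻ x in copy ε k A, g x ∂μHE[n] =
      ENNReal.ofReal ε ^ n * ∫⁻ y in A, g (ε • (y + mkPt (intVec k) 0)) ∂μHE[n] := by
  have e1 : copy ε k A = cellMap hε k '' A := rfl
  have e2 : A = cellMap hε k ⁻¹' (copy ε k A) := by
    rw [e1, preimage_image_eq _ (cellMap hε k).injective]
  have h1 : ∫⁻ y in A, g (ε • (y + mkPt (intVec k) 0)) ∂μHE[n] =
      ENNReal.ofReal ε⁻¹ ^ n * ∫⁻ x in copy ε k A, g x ∂μHE[n] := by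
    conv_lhs => rw [e2]
    have h2 := (cellMap hε k).measurableEmbedding.lintegral_map g
      (μ := μHE[n].restrict (cellMap hε k ⁻¹' copy ε k A))
    rw [← (cellMap hε k).measurableEmbedding.restrict_map, map_cellMap, Measure.restrict_smul,
      lintegral_smul_measure, smul_eq_mul] at h2
    exact h2.symm
  rw [h1, ← mul_assoc, ← mul_pow, ← ENNReal.ofReal_mul hε.le, mul_inv_cancel₀ hε.ne']
  simp

variable {P : Problem d}

open Problem

lemma Problem.Admissible.zs_bounded (hP : P.Admissible) : Bornology.IsBounded P.Zs := by
  have h1 : Bornology.IsBounded (cellZ d) := by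
    rw [isBounded_iff_forall_norm_le]
    refine ⟨√(d + 1), fun x hx => ?_⟩
    rw [EuclideanSpace.norm_eq]
    refine Real.sqrt_le_sqrt ?_
    calc ∑ i, ‖x i‖ ^ 2 ≤ ∑ _i : Fin (d + 1), (1 : ℝ) := by
          refine Finset.sum_le_sum fun i _ => pow_le_one₀ (norm_nonneg _) ?_
          rw [Real.norm_eq_abs, abs_le]
          refine Fin.lastCases ?_ (fun j => ?_) i
          · exact ⟨hx.2.1.le, hx.2.2.le⟩
          · have := hx.1 j
            exact ⟨by linarith [this.1, bar_apply x j], this.2.le⟩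
      _ = d + 1 := by simp
  exact h1.subset hP.zs_subset

lemma Problem.Margin.copy_disjoint {ρ : ℝ} (hm : P.Margin ρ) (hρ : 0 < ρ) {ε : ℝ} (hε : 0 < ε)
    {k k' : Fin d → ℤ} (hkk : k ≠ k') :
    Disjoint (copy ε k (closure P.Zs)) (copy ε k' (closure P.Zs)) := by
  rw [Set.disjoint_left]
  intro x h1 h2
  refine hkk (eq_of_coord hε (hm.copy_coord' hρ hε h1) fun i => ?_)
  have := hm.copy_coord' hρ hε h2 i
  exact ⟨this.1.le, this.2.le⟩

lemma Problem.Margin.lintegral_chan {ρ : ℝ} (hm : P.Margin ρ) (hρ : 0 < ρ) (hP : P.Admissible)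
    {ε : ℝ} (hε : 0 < ε) (g : E (d + 1) → ℝ≥0∞) :
    ∫⁻ x in P.chan ε, g x = ∑' k : P.idx ε, ∫⁻ x in copy ε k P.Zs, g x := by
  rw [chan, biUnion_eq_iUnion, lintegral_iUnion]
  · exact fun k => (isOpen_copy hε _ hP.isOpen_zs).measurableSet
  · intro k k' hkk
    exact (hm.copy_disjoint hρ hε fun h => hkk (Subtype.ext h)).mono (copy_mono subset_closure)
      (copy_mono subset_closure)

/-- The trace inequality in the channels for smooth functions, by scaling from the standard cell. -/
lemma Problem.Admissible.exists_trace_chan (hP : P.Admissible) {ρ : ℝ} (hm : P.Margin ρ)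
    (hρ : 0 < ρ) : ∀ θ : ℝ, 0 < θ → ∃ C : ℝ≥0, ∀ ε : ℝ, 0 < ε → ∀ φ : E (d + 1) → ℝ,
      ContDiff ℝ 1 φ → ∫⁻ x in P.chanN ε, ENNReal.ofReal (φ x ^ 2) ∂μHE[d] ≤
        ENNReal.ofReal (C / ε) * (∫⁻ x in P.chan ε, ENNReal.ofReal (φ x ^ 2)) +
        ENNReal.ofReal (θ * ε) * ∫⁻ x in P.chan ε, ENNReal.ofReal (‖fderiv ℝ φ x‖ ^ 2) := by
  intro θ hθ
  obtain ⟨C, hC⟩ := exists_trace_frontier hP.zs_lipschitz hP.zs_bounded θ hθ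
  refine ⟨C, fun ε hε φ hφ => ?_⟩
  have hvol : (volume : Measure (E (d + 1))) = μHE[d + 1] :=
    (EuclideanSpace.euclideanHausdorffMeasure_eq_volume (d + 1)).symm
  rw [hm.lintegral_chan hρ hP hε, hm.lintegral_chan hρ hP hε, ← ENNReal.tsum_mul_left,
    ← ENNReal.tsum_mul_left, ← ENNReal.tsum_add, chanN, biUnion_eq_iUnion]
  refine (lintegral_iUnion_le _ _).trans (ENNReal.tsum_le_tsum fun k => ?_)
  rw [hvol, setLIntegral_copy hε, setLIntegral_copy hε, setLIntegral_copy hε, ← hvol]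
  set ψ : E (d + 1) → ℝ := fun y => φ (ε • (y + mkPt (intVec k) 0)) with hψ
  have hψs : ContDiff ℝ 1 ψ := hφ.comp (by fun_prop)
  have hψd : ∀ y, fderiv ℝ ψ y = ε • fderiv ℝ φ (ε • (y + mkPt (intVec k) 0)) := by
    intro y
    have h1 : HasFDerivAt (fun y : E (d + 1) => ε • (y + mkPt (intVec k) 0))
        (ε • ContinuousLinearMap.id ℝ (E (d + 1))) y :=
      ((hasFDerivAt_id y).add_const _).const_smul ε
    have h2 := ((hφ.differentiable one_ne_zero (ε • (y + mkPt (intVec k) 0))).hasFDerivAt).comp y h1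
    rw [show fderiv ℝ ψ y = _ from h2.fderiv]
    ext v
    simp
  have hmain := (lintegral_mono_set (μ := μHE[d]) (f := fun x => ENNReal.ofReal (ψ x ^ 2))
    (sdiff_subset : lateral P.Zs ⊆ frontier P.Zs)).trans (hC ψ hψs)
  have e1 : ∀ y, ENNReal.ofReal (‖fderiv ℝ ψ y‖ ^ 2) = ENNReal.ofReal (ε ^ 2) *
      ENNReal.ofReal (‖fderiv ℝ φ (ε • (y + mkPt (intVec k) 0))‖ ^ 2) := fun y => by
    rw [hψd, norm_smul, mul_pow, Real.norm_eq_abs, sq_abs, ENNReal.ofReal_mul (by positivity)]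
  simp only [e1] at hmain
  rw [lintegral_const_mul' _ _ ENNReal.ofReal_ne_top] at hmain
  refine (mul_le_mul_right hmain _).trans (le_of_eq ?_)
  rw [mul_add, ← mul_assoc, ← mul_assoc, ← mul_assoc, ← mul_assoc, ← mul_assoc]
  have a1 : ENNReal.ofReal (C / ε) * ENNReal.ofReal ε ^ (d + 1) = ENNReal.ofReal ε ^ d * C := by
    rw [← ENNReal.ofReal_coe_nnreal (p := C), ← ENNReal.ofReal_pow hε.le, ← ENNReal.ofReal_pow hε.le,
      ← ENNReal.ofReal_mul (by positivity), ← ENNReal.ofReal_mul (by positivity)]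
    congr 1
    field_simp
    ring
  have a2 : ENNReal.ofReal (θ * ε) * ENNReal.ofReal ε ^ (d + 1) =
      ENNReal.ofReal ε ^ d * ENNReal.ofReal θ * ENNReal.ofReal (ε ^ 2) := by
    rw [← ENNReal.ofReal_pow hε.le, ← ENNReal.ofReal_pow hε.le,
      ← ENNReal.ofReal_mul (by positivity), ← ENNReal.ofReal_mul (by positivity),
      ← ENNReal.ofReal_mul (by positivity)]
    congr 1
    ring
  rw [a1, a2]

lemma sq_eLpNorm_two {α F : Type*} [MeasurableSpace α] [NormedAddCommGroup F] (μ : Measure α)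
    (f : α → F) : eLpNorm f 2 μ ^ 2 = ∫⁻ x, ENNReal.ofReal (‖f x‖ ^ 2) ∂μ := by
  have h := eLpNorm_nnreal_pow_eq_lintegral (μ := μ) (f := f) (p := 2) (by norm_num)
  simp only [NNReal.coe_ofNat, ENNReal.coe_ofNat, ENNReal.rpow_ofNat] at h
  rw [h]
  refine lintegral_congr fun x => ?_
  rw [ENNReal.ofReal_pow (norm_nonneg _), ofReal_norm]

lemma norm_gradient {m : ℕ} (φ : E m → ℝ) (x : E m) : ‖gradient φ x‖ = ‖fderiv ℝ φ x‖ := by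
  rw [gradient, LinearIsometryEquiv.norm_map]

lemma continuous_gradient {m : ℕ} {φ : E m → ℝ} (hφ : ContDiff ℝ 1 φ) :
    Continuous (gradient φ) :=
  (InnerProductSpace.toDual ℝ (E m)).symm.continuous.comp (hφ.continuous_fderiv one_ne_zero)

/-- The trace inequality in the channels for functions in `H¹` with a trace, by approximation with
smooth functions. -/
lemma Problem.Admissible.exists_isTrace_le (hP : P.Admissible) {ρ : ℝ} (hm : P.Margin ρ)
    (hρ : 0 < ρ) : ∀ θ : ℝ, 0 < θ → ∃ C : ℝ, 0 ≤ C ∧ ∀ ε : ℝ, 0 < ε → ∀ v G b,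
      AEStronglyMeasurable v (volume.restrict (P.chan ε)) →
      AEStronglyMeasurable G (volume.restrict (P.chan ε)) →
      IsTrace (P.chan ε) (P.chanN ε) v G b →
      eLpNorm b 2 (μHE[d].restrict (P.chanN ε)) ≤
        ENNReal.ofReal (C / √ε) * eLpNorm v 2 (volume.restrict (P.chan ε)) +
        ENNReal.ofReal (θ * √ε) * eLpNorm G 2 (volume.restrict (P.chan ε)) := by
  intro θ hθ
  obtain ⟨C, hC⟩ := hP.exists_trace_chan hm hρ (θ ^ 2) (by positivity)
  refine ⟨√C, Real.sqrt_nonneg _, fun ε hε v G b hv hG hb => ?_⟩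
  set A := ENNReal.ofReal (√C / √ε) with hA
  set B := ENNReal.ofReal (θ * √ε) with hB
  have hA2 : ENNReal.ofReal (C / ε) = A ^ 2 := by
    rw [hA, ← ENNReal.ofReal_pow (by positivity), div_pow, Real.sq_sqrt C.coe_nonneg,
      Real.sq_sqrt hε.le]
  have hB2 : ENNReal.ofReal (θ ^ 2 * ε) = B ^ 2 := by
    rw [hB, ← ENNReal.ofReal_pow (by positivity), mul_pow, Real.sq_sqrt hε.le]
  have hsm : ∀ φ : E (d + 1) → ℝ, ContDiff ℝ 1 φ →
      eLpNorm φ 2 (μHE[d].restrict (P.chanN ε)) ≤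
        A * eLpNorm φ 2 (volume.restrict (P.chan ε)) +
        B * eLpNorm (gradient φ) 2 (volume.restrict (P.chan ε)) := by
    intro φ hφ
    have h := hC ε hε φ hφ
    have e1 := sq_eLpNorm_two (μHE[d].restrict (P.chanN ε)) φ
    have e2 := sq_eLpNorm_two (volume.restrict (P.chan ε)) φ
    have e3 := sq_eLpNorm_two (volume.restrict (P.chan ε)) (gradient φ)
    simp only [Real.norm_eq_abs, sq_abs] at e1 e2
    simp only [norm_gradient] at e3
    rw [← e1, ← e2, ← e3, hA2, hB2] at h
    rw [← ENNReal.pow_le_pow_left_iff (n := 2) two_ne_zero]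
    refine h.trans ?_
    rw [← mul_pow, ← mul_pow, add_sq]
    gcongr
    exact le_self_add
  obtain ⟨hbm, hb⟩ := hb
  refine ENNReal.le_of_forall_pos_le_add fun τ hτ _ => ?_
  have hAB : A + B + 1 ≠ ⊤ := by simp [hA, hB]
  have hAB0 : A + B + 1 ≠ 0 := by simp
  obtain ⟨φ, hφ, h1, h2, h3⟩ := hb (τ / (A + B + 1)) (ENNReal.div_pos (by simpa using hτ.ne') hAB)
  have hφ1 : ContDiff ℝ 1 φ := hφ.of_le (by simp)
  set δ : ℝ≥0∞ := τ / (A + B + 1) with hδ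
  have hφm : ∀ m : Measure (E (d + 1)), AEStronglyMeasurable φ m := fun m =>
    hφ.continuous.aestronglyMeasurable
  have s1 : eLpNorm b 2 (μHE[d].restrict (P.chanN ε)) ≤
      eLpNorm φ 2 (μHE[d].restrict (P.chanN ε)) + δ := by
    have : b = φ - fun x => φ x - b x := by ext x; simp
    rw [this]
    exact (eLpNorm_sub_le (hφm _) ((hφm _).sub hbm.1) (by norm_num)).trans
      (add_le_add le_rfl h3.le)
  have s2 : eLpNorm φ 2 (volume.restrict (P.chan ε)) ≤
      eLpNorm v 2 (volume.restrict (P.chan ε)) + δ := by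
    have : φ = v + fun x => φ x - v x := by ext x; simp
    conv_lhs => rw [this]
    exact (eLpNorm_add_le hv ((hφm _).sub hv) (by norm_num)).trans (add_le_add le_rfl h1.le)
  have s3 : eLpNorm (gradient φ) 2 (volume.restrict (P.chan ε)) ≤
      eLpNorm G 2 (volume.restrict (P.chan ε)) + δ := by
    have : gradient φ = G + fun x => gradient φ x - G x := by ext x; simp
    conv_lhs => rw [this]
    exact (eLpNorm_add_le hG ((continuous_gradient hφ1).aestronglyMeasurable.sub hG)
      (by norm_num)).trans (add_le_add le_rfl h2.le)
  have s4 : (A + B + 1) * δ = τ := ENNReal.mul_div_cancel hAB0 hAB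
  calc eLpNorm b 2 (μHE[d].restrict (P.chanN ε))
      ≤ (A * (eLpNorm v 2 (volume.restrict (P.chan ε)) + δ) +
        B * (eLpNorm G 2 (volume.restrict (P.chan ε)) + δ)) + δ := by
        refine s1.trans (add_le_add ((hsm φ hφ1).trans ?_) le_rfl)
        gcongr
    _ = _ := by
        rw [← s4]
        ring

end TraceGlobal

end

section

/-! ### Grönwall's inequality and weak derivatives in time -/

section Time

open Filter Topology

/-- Gronwall's inequality in integral form. -/
lemma le_mul_exp_of_le_add_integral {T A C : ℝ} {f : ℝ → ℝ} (hf : Continuous f) (hC : 0 ≤ C)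
    (h : ∀ t ∈ Ioo 0 T, f t ≤ A + C * ∫ s in 0..t, f s) {t : ℝ} (ht : t ∈ Ioo 0 T) :
    f t ≤ A * Real.exp (C * t) := by
  set F : ℝ → ℝ := fun t => A + C * ∫ s in 0..t, f s with hF
  have hF' : ∀ t, HasDerivAt F (C * f t) t := fun t =>
    ((intervalIntegral.integral_hasDerivAt_right (hf.intervalIntegrable _ _)
      (hf.stronglyMeasurableAtFilter _ _) hf.continuousAt).const_mul C).const_add A
  have hG : ∀ t, HasDerivAt (fun t => F t * Real.exp (-(C * t)))
      (C * f t * Real.exp (-(C * t)) + F t * (Real.exp (-(C * t)) * -(C * 1))) t := fun t =>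
    (hF' t).mul ((((hasDerivAt_id t).const_mul C).neg).exp)
  have hanti : AntitoneOn (fun t => F t * Real.exp (-(C * t))) (Icc 0 t) := by
    refine antitoneOn_of_deriv_nonpos (convex_Icc 0 t)
      (fun x _ => (hG x).continuousAt.continuousWithinAt)
      (fun x _ => (hG x).differentiableAt.differentiableWithinAt) fun x hx => ?_
    rw [interior_Icc] at hx
    rw [(hG x).deriv]
    have h1 := h x ⟨hx.1, hx.2.trans ht.2⟩
    have h2 := mul_nonneg (mul_nonneg hC (Real.exp_pos (-(C * x))).le) (sub_nonneg.2 h1)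
    simp only [hF]
    nlinarith
  have h1 := hanti (left_mem_Icc.2 ht.1.le) (right_mem_Icc.2 ht.1.le) ht.1.le
  simp only [mul_zero, neg_zero, Real.exp_zero, mul_one] at h1
  have h0 : F 0 = A := by simp [hF]
  rw [h0, Real.exp_neg, ← div_eq_mul_inv, div_le_iff₀ (Real.exp_pos _)] at h1
  exact (h t ht).trans h1

/-- Translations are continuous in `L²(ℝ)`. -/
lemma exists_eLpNorm_shift_sub_le {F : Type*} [NormedAddCommGroup F] {f : ℝ → F}
    (hf : MemLp f 2 volume) {δ : ℝ} (hδ : 0 < δ) :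
    ∃ r > 0, ∀ s, |s| < r → eLpNorm (fun t => f (t + s) - f t) 2 volume ≤ ENNReal.ofReal δ := by
  have : Fact ((2 : ℝ≥0∞) ≠ ⊤) := ⟨by simp⟩
  have hc : Continuous fun s : ℝ => DomAddAct.mk s +ᵥ (hf.toLp f : Lp F 2 (volume : Measure ℝ)) :=
    (DomAddAct.continuous_mk).vadd continuous_const
  have h0 : DomAddAct.mk (0 : ℝ) +ᵥ (hf.toLp f : Lp F 2 (volume : Measure ℝ)) = hf.toLp f := by
    rw [DomAddAct.mk_zero, zero_vadd]
  obtain ⟨r, hr, H⟩ := Metric.continuous_iff.1 hc 0 δ hδ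
  refine ⟨r, hr, fun s hs => ?_⟩
  have h1 := H s (by simpa [dist_eq_norm] using hs)
  rw [h0, DomAddAct.mk_vadd_toLp, dist_eq_norm, ← MemLp.toLp_sub, Lp.norm_toLp] at h1
  have h2 : MemLp (fun t => f (t + s) - f t) 2 volume := by
    refine MemLp.sub ?_ hf
    exact hf.comp_measurePreserving (measurePreserving_add_right volume s)
  rw [ENNReal.le_ofReal_iff_toReal_le h2.eLpNorm_ne_top hδ.le]
  refine le_trans (le_of_eq ?_) h1.le
  congr 2
  ext t
  simp [add_comm]

/-- A smooth function that increases from zero to one on the interval `(c, c + δ)`. -/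
def ramp (c δ t : ℝ) : ℝ := Real.smoothTransition ((t - c) * δ⁻¹)

lemma contDiff_ramp (c δ : ℝ) : ContDiff ℝ ∞ (ramp c δ) :=
  Real.smoothTransition.contDiff.comp ((contDiff_id.sub contDiff_const).mul contDiff_const)

lemma ramp_of_le {c δ t : ℝ} (hδ : 0 < δ) (h : t ≤ c) : ramp c δ t = 0 :=
  Real.smoothTransition.zero_of_nonpos
    (mul_nonpos_of_nonpos_of_nonneg (by linarith) (inv_pos.2 hδ).le)

lemma ramp_of_ge {c δ t : ℝ} (hδ : 0 < δ) (h : c + δ ≤ t) : ramp c δ t = 1 := by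
  refine Real.smoothTransition.one_of_one_le ?_
  rw [← div_eq_mul_inv, le_div_iff₀ hδ]
  linarith

lemma abs_ramp_le (c δ t : ℝ) : |ramp c δ t| ≤ 1 := by
  rw [ramp, abs_of_nonneg (Real.smoothTransition.nonneg _)]
  exact Real.smoothTransition.le_one _

lemma hasDerivAt_ramp (c δ t : ℝ) :
    HasDerivAt (ramp c δ) (deriv Real.smoothTransition ((t - c) * δ⁻¹) * δ⁻¹) t := by
  have h1 : HasDerivAt Real.smoothTransition (deriv Real.smoothTransition ((t - c) * δ⁻¹))
      ((t - c) * δ⁻¹) :=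
    ((Real.smoothTransition.contDiff (n := 1)).differentiable one_ne_zero _).hasDerivAt
  have h2 : HasDerivAt (fun t => (t - c) * δ⁻¹) δ⁻¹ t := by
    simpa using ((hasDerivAt_id t).sub_const c).mul_const δ⁻¹
  exact h1.comp t h2

lemma deriv_ramp_eq_zero {c δ t : ℝ} (hδ : 0 < δ) (h : t ∉ Icc c (c + δ)) :
    deriv (ramp c δ) t = 0 := by
  rw [mem_Icc, not_and_or, not_le, not_le] at h
  have : ∃ a : ℝ, ramp c δ =ᶠ[𝓝 t] fun _ => a := by
    rcases h with h | h
    · exact ⟨0, (eventually_lt_nhds h).mono fun s hs => ramp_of_le hδ (le_of_lt hs)⟩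
    · exact ⟨1, (eventually_gt_nhds h).mono fun s hs => ramp_of_ge hδ (le_of_lt hs)⟩
  obtain ⟨a, ha⟩ := this
  rw [ha.deriv_eq, deriv_const]

/-- The derivatives of the ramps at `c` tend to the Dirac measure at `c`. -/
lemma tendsto_integral_deriv_ramp {T c : ℝ} {p : ℝ → ℝ} (hp : Continuous p) (hc : 0 < c)
    {δ : ℕ → ℝ} (hδ0 : ∀ k, 0 < δ k) (hδ : Tendsto δ atTop (𝓝 0)) (hδT : ∀ k, c + δ k < T) :
    Tendsto (fun k => ∫ t in Ioo 0 T, deriv (ramp c (δ k)) t * p t) atTop (𝓝 (p c)) := by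
  set σ := deriv Real.smoothTransition with hσ
  have hσc : Continuous σ :=
    (Real.smoothTransition.contDiff (n := 1)).continuous_deriv le_rfl
  have h1 : ∀ k, ∫ t in Ioo 0 T, deriv (ramp c (δ k)) t * p t =
      ∫ s in (0 : ℝ)..1, σ s * p (c + δ k * s) := by
    intro k
    have e1 : ∫ t in Ioo 0 T, deriv (ramp c (δ k)) t * p t =
        ∫ t in Icc c (c + δ k), deriv (ramp c (δ k)) t * p t := by
      have hsub : Icc c (c + δ k) ⊆ Ioo 0 T := fun t ht =>
        ⟨hc.trans_le ht.1, ht.2.trans_lt (hδT k)⟩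
      refine setIntegral_eq_of_subset_of_forall_sdiff_eq_zero measurableSet_Ioo hsub
        fun t ht => ?_
      rw [deriv_ramp_eq_zero (hδ0 k) ht.2, zero_mul]
    rw [e1, integral_Icc_eq_integral_Ioc,
      ← intervalIntegral.integral_of_le (by linarith [hδ0 k])]
    have e2 := intervalIntegral.smul_integral_comp_add_mul (a := 0) (b := 1)
      (fun t => deriv (ramp c (δ k)) t * p t) (δ k) c
    rw [mul_zero, add_zero, mul_one] at e2
    rw [← e2, smul_eq_mul, ← intervalIntegral.integral_const_mul]
    refine intervalIntegral.integral_congr fun s _ => ?_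
    rw [(hasDerivAt_ramp _ _ _).deriv]
    have := (hδ0 k).ne'
    rw [show (c + δ k * s - c) * (δ k)⁻¹ = s by field_simp; ring]
    field_simp
    exact mul_comm _ _
  simp only [h1]
  have hcont : Continuous fun x : ℝ => ∫ s in (0 : ℝ)..1, σ s * p (c + x * s) :=
    intervalIntegral.continuous_parametric_intervalIntegral_of_continuous' (by fun_prop) 0 1
  have h2 := (hcont.tendsto 0).comp hδ
  refine h2.trans (le_of_eq ?_)
  simp only [zero_mul, add_zero]
  rw [intervalIntegral.integral_mul_const, intervalIntegral.integral_deriv_eq_sub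
    (fun x _ => (Real.smoothTransition.contDiff (n := 1)).differentiable one_ne_zero x)
    (hσc.intervalIntegrable _ _)]
  simp

/-- A continuous function is the primitive of its weak derivative, as one sees by testing with
approximations of the indicator function of `(a, b)`. -/
lemma sub_eq_integral_of_weakDeriv {T : ℝ} {p q : ℝ → ℝ} (hp : Continuous p)
    (hq : IntegrableOn q (Ioo 0 T))
    (h : ∀ ψ : ℝ → ℝ, ContDiff ℝ ∞ ψ → HasCompactSupport ψ → tsupport ψ ⊆ Ioo 0 T →
      ∫ t in Ioo 0 T, deriv ψ t * p t = - ∫ t in Ioo 0 T, ψ t * q t) {a b : ℝ}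
    (ha : 0 < a) (hab : a ≤ b) (hb : b < T) : p b - p a = ∫ t in a..b, q t := by
  set δ : ℕ → ℝ := fun k => (T - b) / 2 * (1 / ((k : ℝ) + 1)) with hδdef
  have hδ0 : ∀ k, 0 < δ k := fun k => mul_pos (by linarith) (by positivity)
  have hδ : Tendsto δ atTop (𝓝 0) := by
    have h1 := (tendsto_one_div_add_atTop_nhds_zero_nat (𝕜 := ℝ)).const_mul ((T - b) / 2)
    rwa [mul_zero] at h1
  have hδT : ∀ k, b + δ k < T := fun k => by
    have h1 : 1 / ((k : ℝ) + 1) ≤ 1 := by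
      rw [div_le_one (by positivity)]
      linarith [k.cast_nonneg (α := ℝ)]
    have : δ k ≤ (T - b) / 2 := mul_le_of_le_one_right (by linarith) h1
    linarith
  have hδTa : ∀ k, a + δ k < T := fun k => lt_of_le_of_lt (by linarith) (hδT k)
  set ψ : ℕ → ℝ → ℝ := fun k t => ramp a (δ k) t - ramp b (δ k) t with hψ
  have hψs : ∀ k, ContDiff ℝ ∞ (ψ k) := fun k => (contDiff_ramp _ _).sub (contDiff_ramp _ _)
  have hsub : ∀ k, tsupport (ψ k) ⊆ Icc a (b + δ k) := fun k => by
    refine closure_minimal (fun t ht => ?_) isClosed_Icc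
    by_contra hcon
    apply ht
    rw [mem_Icc, not_and_or, not_le, not_le] at hcon
    simp only [hψ]
    rcases hcon with hcon | hcon
    · rw [ramp_of_le (hδ0 k) hcon.le, ramp_of_le (hδ0 k) (hcon.le.trans hab), sub_zero]
    · rw [ramp_of_ge (hδ0 k) hcon.le, ramp_of_ge (hδ0 k) (by linarith), sub_self]
  have hcs : ∀ k, HasCompactSupport (ψ k) := fun k =>
    HasCompactSupport.of_support_subset_isCompact isCompact_Icc
      (subset_closure.trans (hsub k))
  have hk := fun k => h (ψ k) (hψs k) (hcs k)
    ((hsub k).trans fun t ht => ⟨ha.trans_le ht.1, ht.2.trans_lt (hδT k)⟩)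
  have hL : Tendsto (fun k => ∫ t in Ioo 0 T, deriv (ψ k) t * p t) atTop (𝓝 (p a - p b)) := by
    refine ((tendsto_integral_deriv_ramp hp ha hδ0 hδ hδTa).sub
      (tendsto_integral_deriv_ramp hp (ha.trans_le hab) hδ0 hδ hδT)).congr fun k => ?_
    have hi : ∀ c, IntegrableOn (fun t => deriv (ramp c (δ k)) t * p t) (Ioo 0 T) := fun c =>
      ((((contDiff_ramp c (δ k)).continuous_deriv (by simp)).mul hp).continuousOn.integrableOn_Icc
        (a := 0) (b := T)).mono_set Ioo_subset_Icc_self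
    rw [← integral_sub (hi a) (hi b)]
    refine integral_congr_ae (ae_of_all _ fun t => ?_)
    simp only [hψ]
    rw [((hasDerivAt_ramp a (δ k) t).fun_sub (hasDerivAt_ramp b (δ k) t)).deriv,
      (hasDerivAt_ramp a (δ k) t).deriv, (hasDerivAt_ramp b (δ k) t).deriv]
    exact (sub_mul _ _ _).symm
  have hlim : ∀ c t : ℝ, Tendsto (fun k => ramp c (δ k) t) atTop
      (𝓝 ((Ioi c).indicator (fun _ => (1 : ℝ)) t)) := fun c t => by
    by_cases ht : c < t
    · rw [indicator_of_mem (mem_Ioi.2 ht)]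
      refine tendsto_const_nhds.congr' ?_
      filter_upwards [hδ.eventually (eventually_lt_nhds (sub_pos.2 ht))] with k hk
      exact (ramp_of_ge (hδ0 k) (by linarith)).symm
    · rw [indicator_of_notMem (by simpa using ht)]
      exact tendsto_const_nhds.congr fun k => (ramp_of_le (hδ0 k) (not_lt.1 ht)).symm
  have hR : Tendsto (fun k => ∫ t in Ioo 0 T, ψ k t * q t) atTop
      (𝓝 (∫ t in Ioo 0 T, ((Ioi a).indicator (fun _ => (1 : ℝ)) t -
        (Ioi b).indicator (fun _ => (1 : ℝ)) t) * q t)) := by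
    refine tendsto_integral_of_dominated_convergence (fun t => 2 * ‖q t‖)
      (fun k => (hψs k).continuous.aestronglyMeasurable.mul hq.1) (hq.norm.const_mul 2)
      (fun k => ae_of_all _ fun t => ?_) (ae_of_all _ fun t =>
        ((hlim a t).sub (hlim b t)).mul_const _)
    rw [norm_mul]
    refine mul_le_mul_of_nonneg_right ?_ (norm_nonneg _)
    have := abs_sub (ramp a (δ k) t) (ramp b (δ k) t)
    rw [Real.norm_eq_abs]
    have h1 := abs_ramp_le a (δ k) t
    have h2 := abs_ramp_le b (δ k) t
    simp only [hψ]
    linarith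
  have hfin := tendsto_nhds_unique (hL.congr hk) hR.neg
  have e3 : ∫ t in Ioo 0 T, ((Ioi a).indicator (fun _ => (1 : ℝ)) t -
        (Ioi b).indicator (fun _ => (1 : ℝ)) t) * q t = ∫ t in a..b, q t := by
    rw [intervalIntegral.integral_of_le hab, ← integral_indicator measurableSet_Ioo,
      ← integral_indicator measurableSet_Ioc]
    refine integral_congr_ae (ae_of_all _ fun t => ?_)
    simp only [indicator_apply, mem_Ioo, mem_Ioc, mem_Ioi]
    by_cases h1 : a < t <;> by_cases h2 : b < t
    · simp [h1, h2]
    · have : t < T := by linarith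
      have h3 : 0 < t := by linarith
      simp [h1, h2, this, h3, not_lt.1 h2]
    · exact absurd (hab.trans_lt h2) h1
    · simp [h1, h2]
  rw [e3] at hfin
  linarith

end Time

end

section

/-! ### The energy identity for a function with a time derivative in the dual space -/

section Energy

open Filter Topology

/-- The Cauchy-Schwarz inequality for the pairing of `L²(V')` and `L²(V)`. -/
lemma abs_integral_apply_le {α V : Type*} [MeasurableSpace α] {m : Measure α}
    [NormedAddCommGroup V] [NormedSpace ℝ V] {A : α → StrongDual ℝ V} {z : α → V}
    (hA : MemLp A 2 m) (hz : MemLp z 2 m) :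
    Integrable (fun t => A t (z t)) m ∧
      |∫ t, A t (z t) ∂m| ≤ (eLpNorm A 2 m).toReal * (eLpNorm z 2 m).toReal := by
  have hm : AEStronglyMeasurable (fun t => A t (z t)) m :=
    isBoundedBilinearMap_apply.continuous.comp_aestronglyMeasurable (hA.1.prodMk hz.1)
  have h1 : eLpNorm (fun t => A t (z t)) 1 m ≤ eLpNorm A 2 m * eLpNorm z 2 m := by
    have := eLpNorm_le_eLpNorm_mul_eLpNorm_of_nnnorm (p := 2) (q := 2) (r := 1) hA.1 hz.1
      (fun (A : StrongDual ℝ V) z => A z) 1 (ae_of_all _ fun x => by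
        rw [one_mul]
        exact ContinuousLinearMap.le_opNNNorm _ _)
    simpa using this
  have hfin : eLpNorm A 2 m * eLpNorm z 2 m ≠ ⊤ :=
    ENNReal.mul_ne_top hA.eLpNorm_ne_top hz.eLpNorm_ne_top
  refine ⟨memLp_one_iff_integrable.1 ⟨hm, h1.trans_lt hfin.lt_top⟩, ?_⟩
  rw [← ENNReal.toReal_mul, ← Real.norm_eq_abs, ← toReal_enorm]
  refine ENNReal.toReal_mono hfin ((enorm_integral_le_lintegral_enorm _).trans ?_)
  rwa [← eLpNorm_one_eq_lintegral_enorm]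

variable {L H : Type*} [NormedAddCommGroup L] [InnerProductSpace ℝ L]
  [NormedAddCommGroup H] [NormedSpace ℝ H]

lemma inner_sub_inner_of_symm {K : L →L[ℝ] L} (hK : ∀ x y, inner ℝ (K x) y = inner ℝ x (K y))
    (x y : L) : inner ℝ x (K x) - inner ℝ y (K y) = inner ℝ (x - y) (K (x + y)) := by
  have h1 : inner ℝ x (K y) = inner ℝ y (K x) := by
    rw [← hK, real_inner_comm]
  rw [map_add, inner_add_right, inner_sub_left, inner_sub_left]
  linarith

/-- The pairing of a translate of `w` with `u` plus a translate of `u` is, for short translations,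
close to twice the pairing of `w` with `u`, because translations are continuous in `L²`. -/
lemma exists_abs_shift_pairing_sub_le {u : ℝ → H} {w : ℝ → StrongDual ℝ H}
    (hu : MemLp u 2 volume) (hw : MemLp w 2 volume) (KH : H →L[ℝ] H) (S : Set ℝ) {δ : ℝ}
    (hδ : 0 < δ) : ∃ r > 0, ∀ h s, |h| < r → |s| < r →
      |(∫ t in S, w (t + s) (KH (u (t + h) + u t))) - 2 * ∫ t in S, w t (KH (u t))| ≤ δ := by
  set A := (eLpNorm w 2 volume).toReal
  set B := (eLpNorm u 2 volume).toReal
  set k := ‖KH‖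
  have hA0 : 0 ≤ A := ENNReal.toReal_nonneg
  have hB0 : 0 ≤ B := ENNReal.toReal_nonneg
  have hk0 : 0 ≤ k := norm_nonneg _
  set η := δ / (k * (2 * B + A) + 1) with hη
  have hη0 : 0 < η := by positivity
  obtain ⟨r1, hr1, H1⟩ := exists_eLpNorm_shift_sub_le hw hη0
  obtain ⟨r2, hr2, H2⟩ := exists_eLpNorm_shift_sub_le hu hη0
  refine ⟨min r1 r2, lt_min hr1 hr2, fun h s hh hs => ?_⟩
  have hus : MemLp (fun t => u (t + h)) 2 volume :=
    hu.comp_measurePreserving (measurePreserving_add_right volume h)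
  have hws : MemLp (fun t => w (t + s)) 2 volume :=
    hw.comp_measurePreserving (measurePreserving_add_right volume s)
  have hz : MemLp (fun t => KH (u (t + h) + u t)) 2 volume := KH.comp_memLp' (hus.add hu)
  have hz' : MemLp (fun t => KH (u (t + h) - u t)) 2 volume := KH.comp_memLp' (hus.sub hu)
  have hz0 : MemLp (fun t => KH (u t)) 2 volume := KH.comp_memLp' hu
  have hwd : MemLp (fun t => w (t + s) - w t) 2 volume := hws.sub hw
  have hB' : (eLpNorm (fun t => u (t + h)) 2 volume).toReal = B := by
    congr 1
    exact eLpNorm_comp_measurePreserving hu.1 (measurePreserving_add_right volume h)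
  have e0 : (eLpNorm (fun t => w (t + s) - w t) 2 volume).toReal ≤ η :=
    ENNReal.toReal_le_of_le_ofReal hη0.le (H1 s (hs.trans_le (min_le_left _ _)))
  have e1 : (eLpNorm (fun t => u (t + h) - u t) 2 volume).toReal ≤ η :=
    ENNReal.toReal_le_of_le_ofReal hη0.le (H2 h (hh.trans_le (min_le_right _ _)))
  have hKle : ∀ z : ℝ → H, MemLp z 2 volume → (eLpNorm (fun t => KH (z t)) 2 volume).toReal ≤
      k * (eLpNorm z 2 volume).toReal := fun z hzL => by
    have h1 : eLpNorm (fun t => KH (z t)) 2 volume ≤ ENNReal.ofReal k * eLpNorm z 2 volume :=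
      eLpNorm_le_mul_eLpNorm_of_ae_le_mul (ae_of_all _ fun t => KH.le_opNorm _) 2
    refine (ENNReal.toReal_mono (ENNReal.mul_ne_top ENNReal.ofReal_ne_top hzL.eLpNorm_ne_top)
      h1).trans ?_
    rw [ENNReal.toReal_mul, ENNReal.toReal_ofReal hk0]
  have e2 : (eLpNorm (fun t => KH (u (t + h) + u t)) 2 volume).toReal ≤ k * (2 * B) := by
    refine (hKle _ (hus.add hu)).trans ?_
    gcongr
    refine (ENNReal.toReal_mono (ENNReal.add_ne_top.2 ⟨hus.eLpNorm_ne_top, hu.eLpNorm_ne_top⟩)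
      (eLpNorm_add_le hus.1 hu.1 (by norm_num))).trans ?_
    rw [ENNReal.toReal_add hus.eLpNorm_ne_top hu.eLpNorm_ne_top, hB']
    linarith
  have e3 : (eLpNorm (fun t => KH (u (t + h) - u t)) 2 volume).toReal ≤ k * η :=
    (hKle _ (hus.sub hu)).trans (mul_le_mul_of_nonneg_left e1 hk0)
  have hres : ∀ {F : Type _} [NormedAddCommGroup F] (f : ℝ → F), MemLp f 2 volume →
      (eLpNorm f 2 (volume.restrict S)).toReal ≤ (eLpNorm f 2 volume).toReal := fun f hf =>
    ENNReal.toReal_mono hf.eLpNorm_ne_top (eLpNorm_mono_measure _ Measure.restrict_le_self)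
  obtain ⟨i1, b1⟩ := abs_integral_apply_le (hwd.restrict S) (hz.restrict S)
  obtain ⟨i2, b2⟩ := abs_integral_apply_le (hw.restrict S) (hz'.restrict S)
  obtain ⟨i3, -⟩ := abs_integral_apply_le (hw.restrict S) (hz0.restrict S)
  obtain ⟨i4, -⟩ := abs_integral_apply_le (hws.restrict S) (hz.restrict S)
  have hsplit : (∫ t in S, w (t + s) (KH (u (t + h) + u t))) - 2 * ∫ t in S, w t (KH (u t)) =
      (∫ t in S, (w (t + s) - w t) (KH (u (t + h) + u t))) +
        ∫ t in S, w t (KH (u (t + h) - u t)) := by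
    rw [← integral_const_mul, ← integral_sub i4 (i3.const_mul 2), ← integral_add i1 i2]
    refine integral_congr_ae (ae_of_all _ fun t => ?_)
    simp only [map_add, map_sub, _root_.sub_apply]
    ring
  rw [hsplit]
  refine (abs_add_le _ _).trans ((add_le_add (b1.trans (mul_le_mul ((hres _ hwd).trans e0)
    ((hres _ hz).trans e2) ENNReal.toReal_nonneg hη0.le)) (b2.trans (mul_le_mul (hres _ hw)
    ((hres _ hz').trans e3) ENNReal.toReal_nonneg hA0))).trans ?_)
  have : η * (k * (2 * B) ) + A * (k * η) = δ * ((k * (2 * B + A)) / (k * (2 * B + A) + 1)) := by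
    rw [hη]
    field_simp
  rw [this]
  refine mul_le_of_le_one_right hδ.le ?_
  rw [div_le_one (by positivity)]
  linarith

/-- The integral of the difference quotients of a continuous function tends to its increment. -/
lemma tendsto_integral_shift_sub {f : ℝ → ℝ} (hf : Continuous f) (a b : ℝ) :
    Tendsto (fun h => h⁻¹ * ∫ t in a..b, (f (t + h) - f t)) (𝓝[>] 0) (𝓝 (f b - f a)) := by
  have hF : ∀ c, HasDerivAt (fun h => ∫ t in c..c + h, f t) (f c) 0 := fun c => by
    have h1 : HasDerivAt (fun x => ∫ t in c..x, f t) (f c) (c + 0) := by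
      rw [add_zero]
      exact intervalIntegral.integral_hasDerivAt_right (hf.intervalIntegrable _ _)
        (hf.stronglyMeasurableAtFilter _ _) hf.continuousAt
    exact h1.comp_const_add c 0
  have h2 : HasDerivAt (fun h => (∫ t in b..b + h, f t) - ∫ t in a..a + h, f t) (f b - f a) 0 :=
    (hF b).fun_sub (hF a)
  have h3 := h2.tendsto_slope_zero_right
  refine h3.congr fun h => ?_
  simp only [zero_add, add_zero, intervalIntegral.integral_same, sub_zero, smul_eq_mul]
  congr 1
  have hfh : Continuous fun t => f (t + h) := by fun_prop
  rw [intervalIntegral.integral_sub (hfh.intervalIntegrable _ _) (hf.intervalIntegrable _ _),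
    intervalIntegral.integral_comp_add_right,
    intervalIntegral.integral_interval_sub_interval_comm' (hf.intervalIntegrable _ _)
      (hf.intervalIntegrable _ _) (hf.intervalIntegrable _ _)]

/-- The energy identity: if `w` is the time derivative of `u` in the dual of `H`, then
`2 w(t)(K u(t))` is the time derivative of the quadratic form `⟪v, K v⟫` along `v = j u`.  By the
symmetry of `K`, the increment of the form over `(t, t + h)` is `∫ w(τ)(K (u(t + h) + u(t))) dτ`; one
divides by `h`, integrates over `t` and lets `h` tend to zero. -/
lemma inner_sub_inner_eq_two_mul_integral {T : ℝ} (j : H →L[ℝ] L) {v : ℝ → L} (hv : Continuous v)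
    {u : ℝ → H} {w : ℝ → StrongDual ℝ H} (hu : MemLp u 2 volume) (hw : MemLp w 2 volume)
    {K : L →L[ℝ] L} (hK : ∀ x y, inner ℝ (K x) y = inner ℝ x (K y)) {KH : H →L[ℝ] H}
    (hKj : ∀ φ, j (KH φ) = K (j φ)) (huv : ∀ᵐ t ∂volume.restrict (Ioo 0 T), v t = j (u t))
    (hinc : ∀ φ s t, 0 < s → s ≤ t → t < T → inner ℝ (v t - v s) (j φ) = ∫ τ in s..t, w τ φ)
    {a b : ℝ} (ha : 0 < a) (hab : a ≤ b) (hb : b < T) :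
    inner ℝ (v b) (K (v b)) - inner ℝ (v a) (K (v a)) = 2 * ∫ t in a..b, w t (KH (u t)) := by
  set Q : ℝ → ℝ := fun t => inner ℝ (v t) (K (v t)) with hQ
  have hQc : Continuous Q := hv.inner (K.continuous.comp hv)
  have hlim := tendsto_integral_shift_sub hQc a b
  refine tendsto_nhds_unique hlim ?_
  rw [Metric.tendsto_nhds]
  intro δ hδ
  obtain ⟨r, hr, H1⟩ := exists_abs_shift_pairing_sub_le hu hw KH (Ioc a b) (half_pos hδ)
  filter_upwards [Ioo_mem_nhdsGT (lt_min hr (sub_pos.2 hb))] with h hh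
  have h0 : 0 < h := hh.1
  have hhr : h < r := hh.2.trans_le (min_le_left _ _)
  have hhT : h < T - b := hh.2.trans_le (min_le_right _ _)
  have huv' : ∀ᵐ t, t ∈ Ioo 0 T → v t = j (u t) := (ae_restrict_iff' measurableSet_Ioo).1 huv
  have huvh : ∀ᵐ t, t + h ∈ Ioo 0 T → v (t + h) = j (u (t + h)) :=
    (measurePreserving_add_right volume h).quasiMeasurePreserving.ae huv'
  have e1 : ∫ t in a..b, (Q (t + h) - Q t) =
      ∫ t in Ioc a b, ∫ s in Ioc 0 h, w (t + s) (KH (u (t + h) + u t)) := by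
    rw [intervalIntegral.integral_of_le hab]
    refine setIntegral_congr_ae measurableSet_Ioc ?_
    filter_upwards [huv', huvh] with t h1 h2 ht
    have h1' := h1 ⟨ha.trans ht.1, ht.2.trans_lt hb⟩
    have h2' := h2 ⟨by linarith [ht.1], by linarith [ht.2]⟩
    simp only [hQ]
    rw [inner_sub_inner_of_symm hK, h2', h1', ← map_add, ← hKj, ← h2', ← h1',
      hinc _ _ _ (ha.trans ht.1) (by linarith) (by linarith [ht.2]),
      ← intervalIntegral.integral_of_le h0.le,
      intervalIntegral.integral_comp_add_left (fun τ => w τ (KH (u (t + h) + u t))), add_zero]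
  have hint : Integrable (Function.uncurry fun t s => w (t + s) (KH (u (t + h) + u t)))
      ((volume.restrict (Ioc a b)).prod (volume.restrict (Ioc 0 h))) := by
    have hz : MemLp (fun t => KH (u (t + h) + u t)) 2 volume := KH.comp_memLp'
      ((hu.comp_measurePreserving (measurePreserving_add_right volume h)).add hu)
    have h1 : MemLp (fun p : ℝ × ℝ => w (p.1 + p.2)) 2 (volume.prod (volume.restrict (Ioc 0 h))) :=
      (hw.comp_fst (volume.restrict (Ioc 0 h))).comp_measurePreserving
        (measurePreserving_add_prod volume (volume.restrict (Ioc 0 h)))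
    have h2 := (abs_integral_apply_le h1 (hz.comp_fst (volume.restrict (Ioc 0 h)))).1
    refine h2.mono_measure ?_
    exact Measure.prod_mono Measure.restrict_le_self le_rfl
  rw [e1, integral_integral_swap hint, dist_eq_norm, Real.norm_eq_abs]
  set c := 2 * ∫ t in a..b, w t (KH (u t)) with hc
  have e2 : h⁻¹ * (∫ s in Ioc 0 h, ∫ t in Ioc a b, w (t + s) (KH (u (t + h) + u t))) - c =
      h⁻¹ * ∫ s in (0 : ℝ)..h, ((∫ t in Ioc a b, w (t + s) (KH (u (t + h) + u t))) - c) := by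
    have hi : IntegrableOn (fun s => ∫ t in Ioc a b, w (t + s) (KH (u (t + h) + u t))) (Ioc 0 h) :=
      hint.integral_prod_right
    rw [intervalIntegral.integral_of_le h0.le, integral_sub hi (integrable_const _),
      setIntegral_const, mul_sub]
    simp [h0.le, h0.ne']
  rw [e2, abs_mul, abs_of_pos (inv_pos.2 h0)]
  have e3 := intervalIntegral.norm_integral_le_of_norm_le_const (a := 0) (b := h) (C := δ / 2)
    (f := fun s => (∫ t in Ioc a b, w (t + s) (KH (u (t + h) + u t))) - c) fun s hs => by
      rw [uIoc_of_le h0.le] at hs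
      rw [hc, intervalIntegral.integral_of_le hab]
      exact H1 h s (by rwa [abs_of_pos h0]) (by rw [abs_of_pos hs.1]; exact hs.2.trans_lt hhr)
  rw [sub_zero, abs_of_pos h0] at e3
  calc _ ≤ h⁻¹ * (δ / 2 * h) := by gcongr; exact e3
    _ = δ / 2 := by field_simp
    _ < δ := half_lt_self hδ

end Energy

end

section

/-! ### Weak gradients of second differences -/

section WeakGradient

lemma ShiftInv.integral_mul_backDiff {X : Type*} [NormedAddCommGroup X] [MeasurableSpace X]
    [BorelSpace X] {m : Measure X} {S : Set X} {s : X} (h : ShiftInv m S s)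
    (hS : MeasurableSet S) {f q : X → ℝ} (h0 : ∀ x ∉ S, q x = 0) (hf : MemLp f 2 m)
    (hq : MemLp q 2 m) :
    ∫ x, f x * backDiff s q x ∂m = ∫ x, (f (x + s) - f x) * q x ∂m := by
  have := (h.integral_inner_backDiff hS h0 hf hq).1
  simpa [mul_comm] using this

variable {m : ℕ} {μ : Measure (E m)} {S : Set (E m)} {s : E m}

lemma ShiftInv.memLp_mulDiff (h : ShiftInv μ S s) (hS : MeasurableSet S) {M : ℝ} {ζ : E m → ℝ}
    (hζ : Measurable ζ) (h0 : ∀ x ∉ S, ζ x = 0) (hM : ∀ x, |ζ x| ≤ M) {F : Type*}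
    [NormedAddCommGroup F] [NormedSpace ℝ F] {f : E m → F} (hf : MemLp f 2 μ) :
    MemLp (fun x => ζ x • (f (x + s) - f x)) 2 μ := by
  refine (h.memLp_locDiff hS (M := M) (a := fun x => ζ x • ContinuousLinearMap.id ℝ F)
    (hζ.stronglyMeasurable.smul_const _) (fun x hx => by simp [h0 x hx]) (fun x => ?_) hf).ae_eq
    (Filter.Eventually.of_forall fun x => by simp [locDiff])
  rw [norm_smul]
  exact (mul_le_of_le_one_right (norm_nonneg _) ContinuousLinearMap.norm_id_le).trans (hM x)

lemma ShiftInv.memLp_diffSMul (h : ShiftInv μ S s) (hS : MeasurableSet S) {M : ℝ} {F : Type*}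
    [NormedAddCommGroup F] [NormedSpace ℝ F] {Z : E m → F}
    (hZ : StronglyMeasurable Z) (h0 : ∀ x ∉ S, Z x = 0) (hM : ∀ x, ‖Z x‖ ≤ M)
    {f : E m → ℝ} (hf : MemLp f 2 μ) :
    MemLp (fun x => (f (x + s) - f x) • Z x) 2 μ := by
  refine (h.memLp_locDiff hS (M := M) (a := fun x => ContinuousLinearMap.toSpanSingleton ℝ (Z x))
    ((ContinuousLinearMap.toSpanSingletonCLE (𝕜 := ℝ)
      (E := F)).continuous.comp_stronglyMeasurable hZ)
    (fun x hx => by ext; simp [h0 x hx]) (fun x => ?_) hf).ae_eq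
    (Filter.Eventually.of_forall fun x => by simp [locDiff])
  rw [ContinuousLinearMap.norm_toSpanSingleton]
  exact hM x

/-- The gradient of the product of a cut-off function `ζ` with a difference. -/
def diffGrad (ζ : E m → ℝ) (s : E m) (v : E m → ℝ) (G : E m → E m) (x : E m) : E m :=
  ζ x • (G (x + s) - G x) + (v (x + s) - v x) • gradient ζ x

lemma inner_gradient (ζ : E m → ℝ) (x e : E m) : inner ℝ (gradient ζ x) e = fderiv ℝ ζ x e := by
  rw [gradient, InnerProductSpace.toDual_symm_apply]

/-- If `U` is, inside the support of the cut-off function `ζ`, invariant under the translation by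
`s`, then the symmetric second difference with weight `ζ` preserves weak differentiability.  The test
function `φ` is replaced with its second difference, which has compact support in `U`, too. -/
lemma IsWeakGradient.backDiff {U : Set (E m)} (hS : IsOpen S)
    (hU : ∀ x ∈ S, (x + s ∈ U ↔ x ∈ U)) (hUS : ShiftInv (volume.restrict U) S s) {M : ℝ}
    {ζ : E m → ℝ} (hζ : ContDiff ℝ ∞ ζ) (hζS : tsupport ζ ⊆ S) (hM : ∀ x, |ζ x| ≤ M)
    (hM' : ∀ x, ‖fderiv ℝ ζ x‖ ≤ M) {v : E m → ℝ} {G : E m → E m}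
    (hv : MemLp v 2 (volume.restrict U)) (hG : MemLp G 2 (volume.restrict U))
    (h : IsWeakGradient U v G) :
    IsWeakGradient U (Channels.backDiff s fun x => ζ x * (v (x + s) - v x))
      (Channels.backDiff s (diffGrad ζ s v G)) := by
  intro φ hφ hφc hφU e
  have hSm := hS.measurableSet
  have hζ1 : ContDiff ℝ 1 ζ := hζ.of_le (by simp)
  have hζ0 : ∀ x ∉ S, ζ x = 0 := fun x hx => image_eq_zero_of_notMem_tsupport fun h => hx (hζS h)
  have hdζ0 : ∀ x ∉ S, gradient ζ x = 0 := fun x hx => by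
    rw [gradient, fderiv_of_notMem_tsupport (𝕜 := ℝ) fun h => hx (hζS h), map_zero]
  set q : E m → ℝ := fun x => ζ x * (v (x + s) - v x) with hq
  have hq0 : ∀ x ∉ S, q x = 0 := fun x hx => by simp [hq, hζ0 x hx]
  have hQ0 : ∀ x ∉ S, diffGrad ζ s v G x = 0 := fun x hx => by
    simp [diffGrad, hζ0 x hx, hdζ0 x hx]
  have hqm : MemLp q 2 (volume.restrict U) := by
    have := hUS.memLp_mulDiff hSm hζ.continuous.measurable hζ0 hM hv
    simpa using this
  have hQm : MemLp (diffGrad ζ s v G) 2 (volume.restrict U) :=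
    (hUS.memLp_mulDiff hSm hζ.continuous.measurable hζ0 hM hG).add
      (hUS.memLp_diffSMul hSm (continuous_gradient hζ1).stronglyMeasurable hdζ0
        (fun x => by rw [norm_gradient]; exact hM' x) hv)
  set Φ : E m → ℝ := fun x => φ (x + s) - φ x with hΦ
  have hΦs : ContDiff ℝ ∞ Φ := (hφ.comp (contDiff_id.add contDiff_const)).sub hφ
  have hΦc : HasCompactSupport Φ :=
    (hφc.comp_homeomorph (Homeomorph.addRight s)).sub hφc
  set Ψ : E m → ℝ := fun x => ζ x * Φ x with hΨ
  have hΨs : ContDiff ℝ ∞ Ψ := hζ.mul hΦs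
  have hΨc : HasCompactSupport Ψ := hΦc.mul_left
  have hΨU : tsupport Ψ ⊆ S ∩ U := by
    intro x hx
    have hxS : x ∈ S := hζS (tsupport_mul_subset_left hx)
    refine ⟨hxS, ?_⟩
    have hx2 : x ∈ tsupport Φ := tsupport_mul_subset_right hx
    rcases (tsupport_sub (f := fun x => φ (x + s)) (g := φ)) hx2 with hx3 | hx3
    · have : x + s ∈ tsupport φ :=
        tsupport_comp_subset_preimage φ (continuous_add_const s) hx3
      exact (hU x hxS).1 (hφU this)
    · exact hφU hx3
  have hΨ0 : ∀ x ∉ S, Ψ x = 0 := fun x hx => by simp [hΨ, hζ0 x hx]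
  have hmem : ∀ f : E m → ℝ, Continuous f → HasCompactSupport f →
      MemLp f 2 (volume.restrict U) := fun f hf hfc => hf.memLp_of_hasCompactSupport hfc
  have hdc : ∀ f : E m → ℝ, ContDiff ℝ ∞ f → Continuous fun x => fderiv ℝ f x e := fun f hf =>
    (hf.continuous_fderiv (by simp)).clm_apply continuous_const
  have hdΦ : ∀ x, fderiv ℝ Φ x e = fderiv ℝ φ (x + s) e - fderiv ℝ φ x e := fun x => by
    have h1 : HasFDerivAt (fun x => φ (x + s)) (fderiv ℝ φ (x + s)) x :=
      (hasFDerivAt_comp_add_right s).2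
      (hφ.differentiable (by simp) (x + s)).hasFDerivAt
    rw [(h1.fun_sub (hφ.differentiable (by simp) x).hasFDerivAt).fderiv]
    rfl
  have hdΨ : ∀ x, fderiv ℝ Ψ x e = ζ x * fderiv ℝ Φ x e + Φ x * fderiv ℝ ζ x e := fun x => by
    rw [((hζ.differentiable (by simp) x).hasFDerivAt.fun_mul
      (hΦs.differentiable (by simp) x).hasFDerivAt).fderiv]
    simp
  have hdΨ0 : ∀ x ∉ S, fderiv ℝ Ψ x e = 0 := fun x hx => by
    rw [fderiv_of_notMem_tsupport (𝕜 := ℝ) fun h => hx (hΨU h).1]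
    rfl
  have hBs : ContDiff ℝ ∞ (Channels.backDiff s Ψ) :=
    (hΨs.comp (contDiff_id.sub contDiff_const)).sub hΨs
  have hBc : HasCompactSupport (Channels.backDiff s Ψ) :=
    (hΨc.comp_homeomorph (Homeomorph.subRight s)).sub hΨc
  have hBU : tsupport (Channels.backDiff s Ψ) ⊆ U := by
    intro x hx
    rcases (tsupport_sub (f := fun x => Ψ (x - s)) (g := Ψ)) hx with hx | hx
    · have h1 : x - s ∈ tsupport Ψ := 
        tsupport_comp_subset_preimage Ψ (continuous_id.sub continuous_const) hx
      have h2 := (hU _ (hΨU h1).1).2 (hΨU h1).2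
      rwa [sub_add_cancel] at h2
    · exact (hΨU hx).2
  have hdB : ∀ x, fderiv ℝ (Channels.backDiff s Ψ) x e =
      Channels.backDiff s (fun x => fderiv ℝ Ψ x e) x := fun x => by
    have h1 : HasFDerivAt (fun x => Ψ (x - s)) (fderiv ℝ Ψ (x - s)) x :=
      (hasFDerivAt_comp_sub s).2
      (hΨs.differentiable (by simp) (x - s)).hasFDerivAt
    have h2 : fderiv ℝ (Channels.backDiff s Ψ) x = fderiv ℝ Ψ (x - s) - fderiv ℝ Ψ x :=
      (h1.fun_sub (hΨs.differentiable (by simp) x).hasFDerivAt).fderiv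
    rw [h2]
    rfl
  have hwk := h _ hBs hBc hBU e
  simp only [hdB] at hwk
  have hdΨc : HasCompactSupport fun x => fderiv ℝ Ψ x e := hΨc.fderiv_apply ℝ e
  rw [hUS.integral_mul_backDiff hSm hdΨ0 hv (hmem _ (hdc _ hΨs) hdΨc)] at hwk
  have hGe : MemLp (fun x => (inner ℝ (G x) e : ℝ)) 2 (volume.restrict U) := hG.inner_const e
  have hwk2 : ∫ x in U, Channels.backDiff s Ψ x * inner ℝ (G x) e =
      ∫ x in U, (inner ℝ (G (x + s)) e - inner ℝ (G x) e) * Ψ x := by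
    rw [← hUS.integral_mul_backDiff hSm hΨ0 hGe (hmem _ hΨs.continuous hΨc)]
    simp only [mul_comm]
  rw [hwk2] at hwk
  have e1 : ∫ x in U, Channels.backDiff s q x * fderiv ℝ φ x e =
      ∫ x in U, (v (x + s) - v x) * (ζ x * fderiv ℝ Φ x e) := by
    have := hUS.integral_mul_backDiff hSm hq0
      (hmem _ (hdc _ hφ) (hφc.fderiv_apply ℝ e)) hqm
    simp only [mul_comm (fderiv ℝ φ _ e)] at this
    rw [this]
    refine integral_congr_ae (ae_of_all _ fun x => ?_)
    simp only [hdΦ, hq]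
    ring
  have hQe : MemLp (fun x => (inner ℝ (diffGrad ζ s v G x) e : ℝ)) 2 (volume.restrict U) :=
    hQm.inner_const e
  have e2 : ∫ x in U, φ x * inner ℝ (Channels.backDiff s (diffGrad ζ s v G) x) e =
      ∫ x in U, Φ x * inner ℝ (diffGrad ζ s v G x) e := by
    rw [← hUS.integral_mul_backDiff hSm (fun x hx => by rw [hQ0 x hx, inner_zero_left])
      (hmem _ hφ.continuous hφc) hQe]
    refine integral_congr_ae (ae_of_all _ fun x => ?_)
    simp only [Channels.backDiff, inner_sub_left]
  rw [e1, e2]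
  have hδv : ∀ g : E m → ℝ, Continuous g → HasCompactSupport g → (∀ x ∉ S, g x = 0) →
      Integrable (fun x => (v (x + s) - v x) * g x) (volume.restrict U) := fun g hg hgc hg0 => by
    have := (hUS.integral_inner_backDiff hSm hg0 hv (hmem _ hg hgc)).2
    simpa [mul_comm] using this
  have hδG : Integrable (fun x => (inner ℝ (G (x + s)) e - inner ℝ (G x) e) * Ψ x)
      (volume.restrict U) := by
    have := (hUS.integral_inner_backDiff hSm hΨ0 hGe (hmem _ hΨs.continuous hΨc)).2
    simpa [mul_comm] using this
  set g : E m → ℝ := fun x => Φ x * fderiv ℝ ζ x e with hg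
  have hgc : Continuous g := hΦs.continuous.mul (hdc _ hζ)
  have hgS : ∀ x ∉ S, g x = 0 := fun x hx => by
    simp [hg, fderiv_of_notMem_tsupport (𝕜 := ℝ) fun h => hx (hζS h)]
  have hgi := hδv g hgc hΦc.mul_right hgS
  have hi := hδv _ (hdc _ hΨs) hdΨc hdΨ0
  have e3 : ∫ x in U, (v (x + s) - v x) * (ζ x * fderiv ℝ Φ x e) =
      (∫ x in U, (v (x + s) - v x) * fderiv ℝ Ψ x e) - ∫ x in U, (v (x + s) - v x) * g x := by
    rw [← integral_sub hi hgi]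
    refine integral_congr_ae (ae_of_all _ fun x => ?_)
    simp only [hdΨ, hg]
    ring
  have e4 : ∫ x in U, Φ x * inner ℝ (diffGrad ζ s v G x) e =
      (∫ x in U, (inner ℝ (G (x + s)) e - inner ℝ (G x) e) * Ψ x) +
        ∫ x in U, (v (x + s) - v x) * g x := by
    rw [← integral_add hδG hgi]
    refine integral_congr_ae (ae_of_all _ fun x => ?_)
    simp only [diffGrad, inner_add_left, real_inner_smul_left, inner_sub_left, inner_gradient, hg,
      hΨ]
    ring
  rw [e3, e4, hwk]
  ring

end WeakGradient

end

section

/-! ### The test operators on the function spaces -/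
namespace Problem
variable {d : ℕ} {P : Problem d}

/-- The embedding `𝓗_ε ↪ 𝓛_ε`. -/
def valL (P : Problem d) (ε : ℝ) (hε : 0 < ε) : P.Heps ε hε →L[ℝ] P.Leps ε :=
  (WithLp.fstL 2 ℝ (P.Leps ε) (P.Geps ε)).comp (P.Heps ε hε).subtypeL

/-- The weak gradient as an operator on `𝓗_ε`. -/
def gradL (P : Problem d) (ε : ℝ) (hε : 0 < ε) : P.Heps ε hε →L[ℝ] P.Geps ε :=
  (WithLp.sndL 2 ℝ (P.Leps ε) (P.Geps ε)).comp (P.Heps ε hε).subtypeL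

@[simp] lemma valL_apply {ε : ℝ} {hε : 0 < ε} (φ : P.Heps ε hε) : P.valL ε hε φ = val φ := rfl

@[simp] lemma gradL_apply {ε : ℝ} {hε : 0 < ε} (φ : P.Heps ε hε) : P.gradL ε hε φ = grad φ := rfl

lemma isWeakGradient_val {ε : ℝ} {hε : 0 < ε} (φ : P.Heps ε hε) :
    IsWeakGradient (P.Oe ε) (val φ) (grad φ) := φ.2

/-- The measure of the space of gradients is controlled by that of `𝓛_ε`; this makes products of
functions in `𝓛_ε` with bounded vector fields gradients. -/
lemma wvol_le_smul (P : Problem d) {ε : ℝ} (hε : 0 < ε) :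
    P.wvol ε ε ≤ ENNReal.ofReal (1 + ε ^ 2) • P.wvol ε ε⁻¹ := by
  have h1 : (1 : ℝ≥0∞) ≤ ENNReal.ofReal (1 + ε ^ 2) := by
    rw [← ENNReal.ofReal_one]
    exact ENNReal.ofReal_le_ofReal (by nlinarith [sq_nonneg ε])
  have h2 : ENNReal.ofReal ε ≤ ENNReal.ofReal (1 + ε ^ 2) * ENNReal.ofReal ε⁻¹ := by
    rw [← ENNReal.ofReal_mul (by positivity)]
    refine ENNReal.ofReal_le_ofReal ?_
    have := inv_pos.2 hε
    have : (1 + ε ^ 2) * ε⁻¹ = ε⁻¹ + ε := by field_simp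
    linarith
  rw [wvol, wvol, smul_add, smul_add, smul_smul]
  refine add_le_add (add_le_add ?_ ?_) ?_
  · intro A
    simp only [Measure.smul_apply, smul_eq_mul]
    exact le_mul_of_one_le_left zero_le h1
  · intro A
    simp only [Measure.smul_apply, smul_eq_mul]
    exact le_mul_of_one_le_left zero_le h1
  · intro A
    simp only [Measure.smul_apply, smul_eq_mul]
    exact mul_le_mul_left h2 _

lemma bulk_le_wvol (P : Problem d) (ε c : ℝ) (s : Bool) :
    volume.restrict (P.bulk ε s) ≤ (1 : ℝ≥0∞) • P.wvol ε c := by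
  rw [one_smul, wvol]
  cases s
  · exact (Measure.le_add_left le_rfl).trans (Measure.le_add_right le_rfl)
  · exact (Measure.le_add_right le_rfl).trans (Measure.le_add_right le_rfl)

lemma chan_le_wvol (P : Problem d) (ε : ℝ) {c : ℝ} (hc : 0 < c) :
    volume.restrict (P.chan ε) ≤ ENNReal.ofReal c⁻¹ • P.wvol ε c := by
  rw [wvol, smul_add, smul_smul, ← ENNReal.ofReal_mul (inv_pos.2 hc).le, inv_mul_cancel₀ hc.ne',
    ENNReal.ofReal_one, one_smul]
  exact Measure.le_add_left le_rfl

lemma integral_wvol (P : Problem d) (ε : ℝ) {c : ℝ} (hc : 0 < c) {f : E (d + 1) → ℝ}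
    (hf : Integrable f (P.wvol ε c)) :
    ∫ x, f x ∂P.wvol ε c = (∑ s, ∫ x in P.bulk ε s, f x) + c * ∫ x in P.chan ε, f x := by
  have h1 := hf
  rw [wvol] at h1
  have h2 := (integrable_add_measure.1 h1).1
  rw [wvol, integral_add_measure h2 (integrable_add_measure.1 h1).2,
    integral_add_measure (integrable_add_measure.1 h2).1 (integrable_add_measure.1 h2).2,
    integral_smul_measure, ENNReal.toReal_ofReal hc.le, Fintype.sum_bool, smul_eq_mul]

lemma _root_.MeasureTheory.MemLp.ofWvol {F : Type*} [NormedAddCommGroup F] {P : Problem d}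
    {ε c : ℝ} {f : E (d + 1) → F}
    (hf : MemLp f 2 (P.wvol ε c)) (s : Bool) : MemLp f 2 (volume.restrict (P.bulk ε s)) :=
  hf.of_measure_le_smul ENNReal.one_ne_top (P.bulk_le_wvol ε c s)

lemma _root_.MeasureTheory.MemLp.ofWvol_chan {F : Type*} [NormedAddCommGroup F] {P : Problem d}
    {ε c : ℝ} {f : E (d + 1) → F} (hc : 0 < c)
    (hf : MemLp f 2 (P.wvol ε c)) : MemLp f 2 (volume.restrict (P.chan ε)) :=
  hf.of_measure_le_smul ENNReal.ofReal_ne_top (P.chan_le_wvol ε hc)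

lemma ae_bulk {ε c : ℝ} {p : E (d + 1) → Prop} (h : ∀ᵐ x ∂P.wvol ε c, p x) (s : Bool) :
    ∀ᵐ x ∂volume.restrict (P.bulk ε s), p x :=
  ((Measure.absolutelyContinuous_of_le (P.bulk_le_wvol ε c s)).trans
    Measure.smul_absolutelyContinuous).ae_le h

lemma ae_chan {ε c : ℝ} (hc : 0 < c) {p : E (d + 1) → Prop} (h : ∀ᵐ x ∂P.wvol ε c, p x) :
    ∀ᵐ x ∂volume.restrict (P.chan ε), p x :=
  ((Measure.absolutelyContinuous_of_le (P.chan_le_wvol ε hc)).trans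
    Measure.smul_absolutelyContinuous).ae_le h

namespace Cutoff

variable {h ε ρ M : ℝ} (c : Cutoff P h ε ρ M)

/-- The weight `ζ = η²` of the localized energy. -/
def ζ (x : E (d + 1)) : ℝ := c.η x ^ 2

lemma contDiff_ζ : ContDiff ℝ ∞ c.ζ := c.smooth.pow 2

lemma tsupport_ζ : tsupport c.ζ ⊆ c.cS := by
  refine (closure_mono fun x hx => ?_).trans c.tsupport_subset
  intro h0
  apply hx
  simp only [ζ, h0, ne_eq, OfNat.ofNat_ne_zero, not_false_eq_true, zero_pow]

lemma abs_η_le (x : E (d + 1)) : |c.η x| ≤ 1 := by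
  rw [abs_of_nonneg (c.nonneg x)]
  exact c.le_one x

lemma ζ_nonneg (x : E (d + 1)) : 0 ≤ c.ζ x := sq_nonneg _

lemma ζ_le_one (x : E (d + 1)) : c.ζ x ≤ 1 := pow_le_one₀ (c.nonneg x) (c.le_one x)

lemma abs_ζ_le (x : E (d + 1)) : |c.ζ x| ≤ 1 := by
  rw [abs_of_nonneg (c.ζ_nonneg x)]
  exact c.ζ_le_one x

lemma ζ_zero {x : E (d + 1)} (hx : x ∉ c.cS) : c.ζ x = 0 := by
  rw [ζ, c.η_zero hx, zero_pow two_ne_zero]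

lemma fderiv_ζ (x : E (d + 1)) : fderiv ℝ c.ζ x = (2 * c.η x) • fderiv ℝ c.η x := by
  have h := (c.smooth.differentiable (by simp) x).hasFDerivAt
  have e : c.ζ = fun x => c.η x * c.η x := funext fun x => sq (c.η x)
  rw [e, (h.fun_mul h).fderiv, two_mul, add_smul]

lemma gradient_ζ (x : E (d + 1)) : gradient c.ζ x = (2 * c.η x) • gradient c.η x := by
  rw [gradient, gradient, fderiv_ζ, map_smul]

lemma norm_gradient_η_le (x : E (d + 1)) : ‖gradient c.η x‖ ≤ M := by
  rw [norm_gradient]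
  exact c.fderiv_le x

lemma norm_gradient_ζ_le (x : E (d + 1)) : ‖gradient c.ζ x‖ ≤ 2 * M := by
  rw [gradient_ζ, norm_smul, Real.norm_eq_abs, abs_mul, abs_two]
  have := c.abs_η_le x
  have h1 := c.norm_gradient_η_le x
  have h2 := norm_nonneg (gradient c.η x)
  have h3 := abs_nonneg (c.η x)
  nlinarith

lemma gradient_η_eq_zero {x : E (d + 1)} (hx : x ∉ c.cS) : gradient c.η x = 0 := by
  rw [gradient, fderiv_of_notMem_tsupport (𝕜 := ℝ) fun h => hx (c.tsupport_subset h), map_zero]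

lemma gradient_ζ_eq_zero {x : E (d + 1)} (hx : x ∉ c.cS) : gradient c.ζ x = 0 := by
  rw [gradient_ζ, c.gradient_η_eq_zero hx, smul_zero]

lemma diffGrad_eq_zero {s : E (d + 1)} {v : E (d + 1) → ℝ} {G : E (d + 1) → E (d + 1)}
    {x : E (d + 1)} (hx : x ∉ c.cS) : diffGrad c.ζ s v G x = 0 := by
  simp [diffGrad, c.ζ_zero hx, c.gradient_ζ_eq_zero hx]

lemma exists_valOperator (hP : P.Admissible) (hm : P.Margin ρ) (hρ : 0 < ρ) (hε : 0 < ε)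
    {l : Fin d → ℤ} (hl : ‖shiftVec ε l‖ ≤ h) :
    ∃ K : P.Leps ε →L[ℝ] P.Leps ε, ∀ v : P.Leps ε, K v =ᵐ[P.wvol ε ε⁻¹] backDiff (shiftVec ε l)
        fun x => c.ζ x * (v (x + shiftVec ε l) - v x) := by
  have hS := c.isOpen_cS.measurableSet
  have hL := c.shiftInv_wvol hP hm hρ hε hl ε⁻¹
  have hζm : StronglyMeasurable c.ζ := c.contDiff_ζ.continuous.stronglyMeasurable
  obtain ⟨T1, hT1⟩ := hL.exists_clm_locDiff hS ENNReal.one_ne_top (one_smul _ _).ge (M := 1)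
    (a := fun x => c.ζ x • ContinuousLinearMap.id ℝ ℝ) (hζm.smul_const _)
    (fun x hx => by simp [c.ζ_zero hx]) (fun x => by
      rw [norm_smul]
      exact (mul_le_of_le_one_right (norm_nonneg _) ContinuousLinearMap.norm_id_le).trans
        (c.abs_ζ_le x))
  obtain ⟨T4, hT4⟩ := hL.exists_clm_backDiff (F := ℝ) hS
  refine ⟨T4.comp T1, fun v => ?_⟩
  refine hT4 (T1 v) _ (fun x hx => by rw [c.ζ_zero hx, zero_mul]) ?_
  filter_upwards [hT1 v] with x hx
  simpa [locDiff] using hx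

lemma exists_gradOperator (hP : P.Admissible) (hm : P.Margin ρ) (hρ : 0 < ρ) (hε : 0 < ε)
    {l : Fin d → ℤ} (hl : ‖shiftVec ε l‖ ≤ h) :
    ∃ (A : P.Geps ε →L[ℝ] P.Geps ε) (B : P.Leps ε →L[ℝ] P.Geps ε),
      ∀ (v : P.Leps ε) (G : P.Geps ε), (A G + B v : P.Geps ε) =ᵐ[P.wvol ε ε]
        backDiff (shiftVec ε l) (diffGrad c.ζ (shiftVec ε l) v G) := by
  have hS := c.isOpen_cS.measurableSet
  have hG := c.shiftInv_wvol hP hm hρ hε hl ε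
  have hζ1 : ContDiff ℝ 1 c.ζ := c.contDiff_ζ.of_le (by simp)
  have hζm : StronglyMeasurable c.ζ := c.contDiff_ζ.continuous.stronglyMeasurable
  obtain ⟨T2, hT2⟩ := hG.exists_clm_locDiff hS ENNReal.one_ne_top (one_smul _ _).ge (M := 1)
    (a := fun x => c.ζ x • ContinuousLinearMap.id ℝ (E (d + 1))) (hζm.smul_const _)
    (fun x hx => by simp [c.ζ_zero hx]) (fun x => by
      rw [norm_smul]
      exact (mul_le_of_le_one_right (norm_nonneg _) ContinuousLinearMap.norm_id_le).trans
        (c.abs_ζ_le x))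
  obtain ⟨T3, hT3⟩ := hG.exists_clm_locDiff hS ENNReal.ofReal_ne_top (P.wvol_le_smul hε)
    (M := 2 * M) (a := fun x => ContinuousLinearMap.toSpanSingleton ℝ (gradient c.ζ x))
    ((ContinuousLinearMap.toSpanSingletonCLE (𝕜 := ℝ)
      (E := E (d + 1))).continuous.comp_stronglyMeasurable
        (continuous_gradient hζ1).stronglyMeasurable)
    (fun x hx => by ext; simp [c.gradient_ζ_eq_zero hx]) (fun x => by
      rw [ContinuousLinearMap.norm_toSpanSingleton]
      exact c.norm_gradient_ζ_le x)
  obtain ⟨T5, hT5⟩ := hG.exists_clm_backDiff (F := E (d + 1)) hS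
  refine ⟨T5.comp T2, T5.comp T3, fun v G => ?_⟩
  have e : T5.comp T2 G + T5.comp T3 v = T5 (T2 G + T3 v) := (map_add T5 _ _).symm
  rw [e]
  refine hT5 _ _ (fun x hx => c.diffGrad_eq_zero hx) ?_
  filter_upwards [hT2 G, hT3 v, Lp.coeFn_add (T2 G) (T3 v)] with x h1 h2 h3
  rw [h3, Pi.add_apply, h1, h2]
  simp [locDiff, diffGrad]

/-- Operators on functions and on gradients that are compatible with weak differentiation combine to an
operator on `𝓗_ε`. -/
lemma _root_.Channels.Problem.exists_heps_operator (K : P.Leps ε →L[ℝ] P.Leps ε)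
    (A : P.Geps ε →L[ℝ] P.Geps ε) (B : P.Leps ε →L[ℝ] P.Geps ε) (hε : 0 < ε)
    (hKAB : ∀ φ : P.Heps ε hε, IsWeakGradient (P.Oe ε) (K (val φ))
      (A (grad φ) + B (val φ) : P.Geps ε)) :
    ∃ KH : P.Heps ε hε →L[ℝ] P.Heps ε hε, (∀ φ, val (KH φ) = K (val φ)) ∧
      ∀ φ, grad (KH φ) = A (grad φ) + B (val φ) := by
  let T : P.Heps ε hε →L[ℝ] WithLp 2 (P.Leps ε × P.Geps ε) :=
    (WithLp.prodContinuousLinearEquiv 2 ℝ (P.Leps ε) (P.Geps ε)).symm.toContinuousLinearMap.comp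
      ((K.comp (P.valL ε hε)).prod (A.comp (P.gradL ε hε) + B.comp (P.valL ε hε)))
  exact ⟨T.codRestrict (P.Heps ε hε) hKAB, fun φ => rfl, fun φ => rfl⟩

/-- The operators `v ↦ δ*(ζ δv)` on `𝓛_ε` and on `𝓗_ε` that serve to test the equation. -/
lemma exists_testOperators (hP : P.Admissible) (hm : P.Margin ρ) (hρ : 0 < ρ) (hε : 0 < ε)
    {l : Fin d → ℤ} (hl : ‖shiftVec ε l‖ ≤ h) :
    ∃ (K : P.Leps ε →L[ℝ] P.Leps ε) (KH : P.Heps ε hε →L[ℝ] P.Heps ε hε),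
      (∀ v : P.Leps ε, K v =ᵐ[P.wvol ε ε⁻¹] backDiff (shiftVec ε l)
        fun x => c.ζ x * (v (x + shiftVec ε l) - v x)) ∧
      (∀ φ, val (KH φ) = K (val φ)) ∧
      (∀ φ, grad (KH φ) =ᵐ[P.wvol ε ε] backDiff (shiftVec ε l)
        (diffGrad c.ζ (shiftVec ε l) (val φ) (grad φ))) := by
  obtain ⟨K, hK⟩ := c.exists_valOperator hP hm hρ hε hl
  obtain ⟨A, B, hAB⟩ := c.exists_gradOperator hP hm hρ hε hl
  obtain ⟨KH, h1, h2⟩ := exists_heps_operator K A B hε fun φ => by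
    have h3 : IsWeakGradient (P.Oe ε)
        (backDiff (shiftVec ε l) fun x => c.ζ x * (val φ (x + shiftVec ε l) - val φ x))
        (backDiff (shiftVec ε l) (diffGrad c.ζ (shiftVec ε l) (val φ) (grad φ))) :=
      IsWeakGradient.backDiff (M := max 1 (2 * M)) c.isOpen_cS (c.Oe_shift hm hρ hε hl)
        (c.shiftInv_Oe hm hρ hε hl) c.contDiff_ζ c.tsupport_ζ
        (fun x => (c.abs_ζ_le x).trans (le_max_left _ _))
        (fun x => by rw [← norm_gradient]; exact (c.norm_gradient_ζ_le x).trans (le_max_right _ _))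
        (P.memLp_Oe (inv_pos.2 hε) (Lp.memLp _)) (P.memLp_Oe hε (Lp.memLp _))
        (isWeakGradient_val φ)
    exact h3.congr (P.ae_Oe (inv_pos.2 hε) (hK (val φ))) (P.ae_Oe hε (hAB (val φ) (grad φ)))
  refine ⟨K, KH, hK, h1, fun φ => ?_⟩
  rw [h2]
  exact hAB (val φ) (grad φ)

lemma memLp_ζ_diff (hP : P.Admissible) (hm : P.Margin ρ) (hρ : 0 < ρ) (hε : 0 < ε)
    {l : Fin d → ℤ} (hl : ‖shiftVec ε l‖ ≤ h) (v : P.Leps ε) :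
    MemLp (fun x => c.ζ x * (v (x + shiftVec ε l) - v x)) 2 (P.wvol ε ε⁻¹) := by
  have := (c.shiftInv_wvol hP hm hρ hε hl ε⁻¹).memLp_mulDiff c.isOpen_cS.measurableSet
    c.contDiff_ζ.continuous.measurable (fun x hx => c.ζ_zero hx) c.abs_ζ_le (Lp.memLp v)
  simpa using this

/-- The bilinear form of the test operator, by summation by parts. -/
lemma inner_testOperator (hP : P.Admissible) (hm : P.Margin ρ) (hρ : 0 < ρ) (hε : 0 < ε)
    {l : Fin d → ℤ} (hl : ‖shiftVec ε l‖ ≤ h) {K : P.Leps ε →L[ℝ] P.Leps ε}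
    (hK : ∀ v : P.Leps ε, K v =ᵐ[P.wvol ε ε⁻¹] backDiff (shiftVec ε l)
        fun x => c.ζ x * (v (x + shiftVec ε l) - v x)) (v w : P.Leps ε) :
    inner ℝ v (K w) = ∫ x, c.ζ x * ((v (x + shiftVec ε l) - v x) *
      (w (x + shiftVec ε l) - w x)) ∂P.wvol ε ε⁻¹ := by
  rw [L2.inner_def]
  have h1 := (c.shiftInv_wvol hP hm hρ hε hl ε⁻¹).integral_mul_backDiff c.isOpen_cS.measurableSet
    (fun x hx => by rw [c.ζ_zero hx, zero_mul]) (Lp.memLp v) (c.memLp_ζ_diff hP hm hρ hε hl w)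
  have h2 : ∫ x, (inner ℝ (v x) (K w x) : ℝ) ∂P.wvol ε ε⁻¹ = ∫ x, v x * backDiff (shiftVec ε l)
      (fun x => c.ζ x * (w (x + shiftVec ε l) - w x)) x ∂P.wvol ε ε⁻¹ := by
    refine integral_congr_ae ((hK w).mono fun x hx => ?_)
    simp only [hx]
    simp [mul_comm]
  rw [h2, h1]
  refine integral_congr_ae (ae_of_all _ fun x => ?_)
  simp only
  ring

lemma testOperator_symm (hP : P.Admissible) (hm : P.Margin ρ) (hρ : 0 < ρ) (hε : 0 < ε)
    {l : Fin d → ℤ} (hl : ‖shiftVec ε l‖ ≤ h) {K : P.Leps ε →L[ℝ] P.Leps ε}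
    (hK : ∀ v : P.Leps ε, K v =ᵐ[P.wvol ε ε⁻¹] backDiff (shiftVec ε l)
        fun x => c.ζ x * (v (x + shiftVec ε l) - v x)) (v w : P.Leps ε) :
    inner ℝ (K v) w = inner ℝ v (K w) := by
  rw [real_inner_comm, c.inner_testOperator hP hm hρ hε hl hK,
    c.inner_testOperator hP hm hρ hε hl hK]
  refine integral_congr_ae (ae_of_all _ fun x => ?_)
  simp only
  ring

end Cutoff
end Problem

end

section

/-! ### Traces of differences -/

section

variable {m : ℕ} {μ : Measure (E m)} {S : Set (E m)} {s : E m}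

lemma ShiftInv.eLpNorm_mulDiff_le (h : ShiftInv μ S s) (hS : MeasurableSet S) {ζ : E m → ℝ}
    (hζ : Measurable ζ) (h0 : ∀ x ∉ S, ζ x = 0) (hM : ∀ x, |ζ x| ≤ 1) {F : Type*}
    [NormedAddCommGroup F] [NormedSpace ℝ F] {f : E m → F} (hf : MemLp f 2 μ) :
    eLpNorm (fun x => ζ x • (f (x + s) - f x)) 2 μ ≤ 2 * eLpNorm f 2 μ := by
  have hm : ∀ x, ‖ζ x • ContinuousLinearMap.id ℝ F‖ ≤ 1 := fun x => by
    rw [norm_smul]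
    exact (mul_le_of_le_one_right (norm_nonneg _) ContinuousLinearMap.norm_id_le).trans (hM x)
  have key : ∀ s', ShiftInv μ S s' → AEStronglyMeasurable (fun x => ζ x • f (x + s')) μ ∧
      eLpNorm (fun x => ζ x • f (x + s')) 2 μ ≤ eLpNorm f 2 μ := fun s' hs' => by
    have h1 := hs'.memLp_shiftMul hS (a := fun x => ζ x • ContinuousLinearMap.id ℝ F)
      (hζ.stronglyMeasurable.smul_const _) (fun x hx => by simp [h0 x hx]) hm hf
    refine ⟨by simpa using h1.1, ?_⟩
    have := hs'.eLpNorm_le hS (M := 1) (f := f) (q := fun x => ζ x • f (x + s'))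
      (fun x hx => by simp [h0 x hx]) (fun x => by
        rw [norm_smul]
        exact mul_le_mul_of_nonneg_right (hM x) (norm_nonneg _))
    simpa using this
  obtain ⟨a1, a2⟩ := key s h
  obtain ⟨b1, b2⟩ := key 0 (shiftInv_zero μ S)
  have e : (fun x => ζ x • (f (x + s) - f x)) =
      (fun x => ζ x • f (x + s)) - fun x => ζ x • f (x + 0) := by
    ext1 x
    simp [smul_sub]
  rw [e, two_mul]
  exact (eLpNorm_sub_le a1 b1 (by norm_num)).trans (add_le_add a2 b2)

lemma ShiftInv.eLpNorm_backDiff_le (h : ShiftInv μ S s) (hS : MeasurableSet S) {F : Type*}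
    [NormedAddCommGroup F] [NormedSpace ℝ F] {q : E m → F} (h0 : ∀ x ∉ S, q x = 0)
    (hq : MemLp q 2 μ) : eLpNorm (Channels.backDiff s q) 2 μ ≤ 2 * eLpNorm q 2 μ := by
  have h1 := h.symm.eLpNorm_le (measurableSet_sub_mem hS s) (M := 1) (f := q)
    (q := fun x => q (x - s)) (fun x hx => h0 _ hx) (fun x => by simp [sub_eq_add_neg])
  rw [ENNReal.ofReal_one, one_mul] at h1
  have e : Channels.backDiff s q = (fun x => q (x - s)) - q := rfl
  rw [e, two_mul]
  exact (eLpNorm_sub_le (h.memLp_sub_shift hS h0 hq).1 hq.1 (by norm_num)).trans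
    (add_le_add h1 le_rfl)

/-- The restriction operator between the `L²` spaces of two comparable measures. -/
lemma exists_clm_restrict {α F : Type*} [MeasurableSpace α]
    [NormedAddCommGroup F] [NormedSpace ℝ F] {μ ν : Measure α} {C : ℝ≥0∞} (hC : C ≠ ⊤)
    (hμν : ν ≤ C • μ) : ∃ R : Lp F 2 μ →L[ℝ] Lp F 2 ν, ∀ f, R f =ᵐ[ν] f := by
  have hmem : ∀ f : Lp F 2 μ, MemLp f 2 ν := fun f => (Lp.memLp f).of_measure_le_smul hC hμν
  have hac : ν ≪ μ := (Measure.absolutelyContinuous_of_le hμν).trans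
    Measure.smul_absolutelyContinuous
  let T0 : Lp F 2 μ →ₗ[ℝ] Lp F 2 ν :=
    { toFun := fun f => (hmem f).toLp
      map_add' := fun f g => by
        rw [← MemLp.toLp_add, MemLp.toLp_eq_toLp_iff]
        exact hac.ae_le (Lp.coeFn_add f g)
      map_smul' := fun c f => by
        rw [RingHom.id_apply, ← MemLp.toLp_const_smul, MemLp.toLp_eq_toLp_iff]
        exact hac.ae_le (Lp.coeFn_smul c f) }
  refine ⟨T0.mkContinuous (C ^ (1 / (2 : ℝ≥0∞)).toReal).toReal fun f => ?_,
    fun f => MemLp.coeFn_toLp (hmem f)⟩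
  change ‖(hmem f).toLp‖ ≤ _
  rw [Lp.norm_toLp, Lp.norm_def, ← ENNReal.toReal_mul]
  refine ENNReal.toReal_mono (ENNReal.mul_ne_top
    (ENNReal.rpow_ne_top_of_nonneg ENNReal.toReal_nonneg hC) (Lp.eLpNorm_ne_top f)) ?_
  refine (eLpNorm_mono_measure _ hμν).trans ?_
  rw [eLpNorm_smul_measure_of_ne_top (by norm_num), smul_eq_mul]

lemma differentiableAt_of_smooth {φ : E m → ℝ} (hφ : ContDiff ℝ ∞ φ) (x : E m) :
    DifferentiableAt ℝ φ x := hφ.differentiable (by simp) x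

lemma gradient_mulDiff {ψ φ : E m → ℝ} (hψ : ContDiff ℝ ∞ ψ) (hφ : ContDiff ℝ ∞ φ) (s x : E m) :
    gradient (fun x => ψ x * (φ (x + s) - φ x)) x = diffGrad ψ s φ (gradient φ) x := by
  have h1 : HasFDerivAt (fun x => φ (x + s)) (fderiv ℝ φ (x + s)) x :=
    (hasFDerivAt_comp_add_right s).2 (differentiableAt_of_smooth hφ _).hasFDerivAt
  have h2 := (differentiableAt_of_smooth hψ x).hasFDerivAt.fun_mul
    (h1.fun_sub (differentiableAt_of_smooth hφ x).hasFDerivAt)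
  simp only [gradient, h2.fderiv, diffGrad, map_add, map_smul, map_sub]

lemma gradient_backDiff {Ψ : E m → ℝ} (hΨ : ContDiff ℝ ∞ Ψ) (s x : E m) :
    gradient (backDiff s Ψ) x = backDiff s (gradient Ψ) x := by
  have h1 : HasFDerivAt (fun x => Ψ (x - s)) (fderiv ℝ Ψ (x - s)) x :=
    (hasFDerivAt_comp_sub s).2 (differentiableAt_of_smooth hΨ _).hasFDerivAt
  have h2 : fderiv ℝ (backDiff s Ψ) x = fderiv ℝ Ψ (x - s) - fderiv ℝ Ψ x :=
    (h1.fun_sub (differentiableAt_of_smooth hΨ x).hasFDerivAt).fderiv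
  simp only [gradient, h2, backDiff, map_sub]

variable {U N : Set (E m)} {v v' : E m → ℝ} {G G' : E m → E m} {b b' : E m → ℝ}

lemma IsTrace.congr (h : IsTrace U N v G b) (hv : v' =ᵐ[volume.restrict U] v)
    (hG : G' =ᵐ[volume.restrict U] G) (hb : b' =ᵐ[μHE[m - 1].restrict N] b) :
    IsTrace U N v' G' b' := by
  refine ⟨(memLp_congr_ae hb).2 h.1, fun δ hδ => ?_⟩
  obtain ⟨φ, h0, h1, h2, h3⟩ := h.2 δ hδ
  refine ⟨φ, h0, ?_, ?_, ?_⟩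
  · rwa [eLpNorm_congr_ae (g := fun x => φ x - v x) (hv.mono fun x hx => by simp only [hx])]
  · rwa [eLpNorm_congr_ae (g := fun x => gradient φ x - G x) (hG.mono fun x hx => by simp only [hx])]
  · rwa [eLpNorm_congr_ae (g := fun x => φ x - b x) (hb.mono fun x hx => by simp only [hx])]

lemma IsTrace.add (h : IsTrace U N v G b) (h' : IsTrace U N v' G' b')
    (hv : AEStronglyMeasurable v (volume.restrict U))
    (hv' : AEStronglyMeasurable v' (volume.restrict U))
    (hG : AEStronglyMeasurable G (volume.restrict U))
    (hG' : AEStronglyMeasurable G' (volume.restrict U)) :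
    IsTrace U N (fun x => v x + v' x) (fun x => G x + G' x) (fun x => b x + b' x) := by
  refine ⟨h.1.add h'.1, fun δ hδ => ?_⟩
  obtain ⟨φ, h0, h1, h2, h3⟩ := h.2 (δ / 2) (ENNReal.half_pos hδ.ne')
  obtain ⟨φ', h0', h1', h2', h3'⟩ := h'.2 (δ / 2) (ENNReal.half_pos hδ.ne')
  have hc : ∀ {ν : Measure (E m)} {ψ : E m → ℝ}, ContDiff ℝ ∞ ψ → AEStronglyMeasurable ψ ν :=
    fun hψ => hψ.continuous.aestronglyMeasurable
  have hg : ∀ {ν : Measure (E m)} {ψ : E m → ℝ}, ContDiff ℝ ∞ ψ →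
      AEStronglyMeasurable (gradient ψ) ν :=
    fun hψ => (continuous_gradient (hψ.of_le (by simp))).aestronglyMeasurable
  have key : ∀ {F : Type} [NormedAddCommGroup F] {ν : Measure (E m)} {f g : E m → F},
      AEStronglyMeasurable f ν → AEStronglyMeasurable g ν → eLpNorm f 2 ν < δ / 2 →
      eLpNorm g 2 ν < δ / 2 → eLpNorm (f + g) 2 ν < δ := fun hf hg h1 h2 => by
    refine (eLpNorm_add_le hf hg (by norm_num)).trans_lt ?_
    calc _ < δ / 2 + δ / 2 := ENNReal.add_lt_add h1 h2
      _ = δ := ENNReal.add_halves δ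
  refine ⟨fun x => φ x + φ' x, h0.add h0', ?_, ?_, ?_⟩
  · refine lt_of_le_of_lt (le_of_eq ?_) (key ((hc h0).sub hv) ((hc h0').sub hv') h1 h1')
    congr 1
    ext x
    simp only [Pi.add_apply, Pi.sub_apply]
    ring
  · refine lt_of_le_of_lt (le_of_eq ?_) (key ((hg h0).sub hG) ((hg h0').sub hG') h2 h2')
    congr 1
    ext1 x
    have : gradient (fun x => φ x + φ' x) x = gradient φ x + gradient φ' x := by
      simp only [gradient]
      rw [((differentiableAt_of_smooth h0 x).hasFDerivAt.fun_add
        (differentiableAt_of_smooth h0' x).hasFDerivAt).fderiv, map_add]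
    simp only [this, Pi.add_apply, Pi.sub_apply]
    abel
  · refine lt_of_le_of_lt (le_of_eq ?_) (key ((hc h0).sub h.1.1) ((hc h0').sub h'.1.1) h3 h3')
    congr 1
    ext x
    simp only [Pi.add_apply, Pi.sub_apply]
    ring

lemma IsTrace.smul (h : IsTrace U N v G b) (a : ℝ) :
    IsTrace U N (fun x => a * v x) (fun x => a • G x) (fun x => a * b x) := by
  refine ⟨h.1.const_mul a, fun δ hδ => ?_⟩
  have hpos : (0 : ℝ≥0∞) < δ / (‖a‖ₑ + 1) := ENNReal.div_pos hδ.ne' (by simp)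
  obtain ⟨φ, h0, h1, h2, h3⟩ := h.2 _ hpos
  have key : ∀ {F : Type} [NormedAddCommGroup F] [NormedSpace ℝ F] {ν : Measure (E m)}
      {f : E m → F}, eLpNorm f 2 ν < δ / (‖a‖ₑ + 1) → eLpNorm (a • f) 2 ν < δ := fun {F} _ _ {ν} {f} hf => by
    rw [eLpNorm_const_smul]
    rcases eq_or_ne (eLpNorm f 2 ν) 0 with h | h
    · rw [h, mul_zero]
      exact hδ
    · refine lt_of_lt_of_le (b := (‖a‖ₑ + 1) * eLpNorm f 2 ν) ?_ ?_
      · exact ENNReal.mul_lt_mul_left h (hf.ne_top) (ENNReal.lt_add_right (by simp) one_ne_zero)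
      · refine (mul_le_mul_right hf.le _).trans ENNReal.mul_div_le
  refine ⟨fun x => a * φ x, contDiff_const.mul h0, ?_, ?_, ?_⟩
  · refine lt_of_le_of_lt (le_of_eq ?_) (key h1)
    congr 1
    ext x
    simp only [Pi.smul_apply, smul_eq_mul]
    ring
  · refine lt_of_le_of_lt (le_of_eq ?_) (key h2)
    congr 1
    ext1 x
    have : gradient (fun x => a * φ x) x = a • gradient φ x := by
      simp only [gradient]
      rw [((differentiableAt_of_smooth h0 x).hasFDerivAt.const_mul a).fderiv, map_smul]
    simp only [this, Pi.smul_apply, smul_sub]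
  · refine lt_of_le_of_lt (le_of_eq ?_) (key h3)
    congr 1
    ext x
    simp only [Pi.smul_apply, smul_eq_mul]
    ring

/-- Weighted differences of a function with a trace have a trace, if the weight is locally constant
in the domain. -/
lemma IsTrace.mulDiff (h : IsTrace U N v G b) (hS : MeasurableSet S) (hUm : MeasurableSet U)
    (hU : ShiftInv (volume.restrict U) S s) (hN : ShiftInv (μHE[m - 1].restrict N) S s)
    {ψ : E m → ℝ} (hψ : ContDiff ℝ ∞ ψ) (h0 : ∀ x ∉ S, ψ x = 0) (hM : ∀ x, |ψ x| ≤ 1)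
    (hd : ∀ x ∈ U, gradient ψ x = 0) (hv : AEStronglyMeasurable v (volume.restrict U))
    (hG : AEStronglyMeasurable G (volume.restrict U)) :
    IsTrace U N (fun x => ψ x * (v (x + s) - v x)) (fun x => ψ x • (G (x + s) - G x))
      (fun x => ψ x * (b (x + s) - b x)) := by
  have hψm := hψ.continuous.measurable
  refine ⟨by simpa using hN.memLp_mulDiff hS hψm h0 hM h.1, fun δ hδ => ?_⟩
  obtain ⟨φ, hφ, h1, h2, h3⟩ := h.2 (δ / 2) (ENNReal.half_pos hδ.ne')
  have hlt : ∀ {a : ℝ≥0∞}, a < δ / 2 → 2 * a < δ := fun {a} ha => by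
    calc 2 * a = a + a := two_mul a
      _ < δ / 2 + δ / 2 := ENNReal.add_lt_add ha ha
      _ = δ := ENNReal.add_halves δ
  have m1 : MemLp (fun x => φ x - v x) 2 (volume.restrict U) :=
    ⟨hφ.continuous.aestronglyMeasurable.sub hv, h1.trans_le le_top⟩
  have m2 : MemLp (fun x => gradient φ x - G x) 2 (volume.restrict U) :=
    ⟨(continuous_gradient (hφ.of_le (by simp))).aestronglyMeasurable.sub hG, h2.trans_le le_top⟩
  have m3 : MemLp (fun x => φ x - b x) 2 (μHE[m - 1].restrict N) :=
    ⟨hφ.continuous.aestronglyMeasurable.sub h.1.1, h3.trans_le le_top⟩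
  refine ⟨fun x => ψ x * (φ (x + s) - φ x),
    hψ.mul ((hφ.comp (contDiff_id.add contDiff_const)).sub hφ), ?_, ?_, ?_⟩
  · refine lt_of_le_of_lt (le_of_eq ?_) ((hU.eLpNorm_mulDiff_le hS hψm h0 hM m1).trans_lt (hlt h1))
    congr 1
    ext x
    simp only [smul_eq_mul]
    ring
  · refine lt_of_le_of_lt (le_of_eq ?_) ((hU.eLpNorm_mulDiff_le hS hψm h0 hM m2).trans_lt (hlt h2))
    refine eLpNorm_congr_ae ((ae_restrict_iff' hUm).2 (ae_of_all _ fun x hx => ?_))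
    simp only [gradient_mulDiff hψ hφ, diffGrad, hd x hx, smul_zero, add_zero]
    rw [← smul_sub]
    congr 1
    abel
  · refine lt_of_le_of_lt (le_of_eq ?_) ((hN.eLpNorm_mulDiff_le hS hψm h0 hM m3).trans_lt (hlt h3))
    congr 1
    ext x
    simp only [smul_eq_mul]
    ring

/-- Weighted second differences of a function with a trace have a trace, if the weight is locally
constant in the domain. -/
lemma IsTrace.backDiff_mulDiff (h : IsTrace U N v G b) (hS : MeasurableSet S)
    (hUm : MeasurableSet U) (hUS : ∀ x ∈ S, (x + s ∈ U ↔ x ∈ U))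
    (hU : ShiftInv (volume.restrict U) S s) (hN : ShiftInv (μHE[m - 1].restrict N) S s)
    {ψ : E m → ℝ} (hψ : ContDiff ℝ ∞ ψ) (h0 : ∀ x ∉ S, ψ x = 0)
    (h0' : ∀ x ∉ S, gradient ψ x = 0) (hM : ∀ x, |ψ x| ≤ 1)
    (hd : ∀ x ∈ U, gradient ψ x = 0) (hv : AEStronglyMeasurable v (volume.restrict U))
    (hG : AEStronglyMeasurable G (volume.restrict U)) :
    IsTrace U N (backDiff s fun x => ψ x * (v (x + s) - v x))
      (backDiff s fun x => ψ x • (G (x + s) - G x))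
      (backDiff s fun x => ψ x * (b (x + s) - b x)) := by
  have hψm := hψ.continuous.measurable
  have hz : ∀ f : E m → ℝ, ∀ x ∉ S, ψ x • (f (x + s) - f x) = 0 := fun f x hx => by simp [h0 x hx]
  have hz' : ∀ f : E m → E m, ∀ x ∉ S, ψ x • (f (x + s) - f x) = 0 := fun f x hx => by
    simp [h0 x hx]
  refine ⟨by
    have := hN.memLp_backDiff hS (hz b) (hN.memLp_mulDiff hS hψm h0 hM h.1)
    simpa using this, fun δ hδ => ?_⟩
  obtain ⟨φ, hφ, h1, h2, h3⟩ := h.2 (δ / 4) (ENNReal.div_pos hδ.ne' (by simp))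
  have hlt : ∀ {a : ℝ≥0∞}, a < δ / 4 → 2 * (2 * a) < δ := fun {a} ha => by
    have h4 : (2 : ℝ≥0∞) * 2 = 4 := by norm_num
    rw [← mul_assoc, h4]
    rw [ENNReal.lt_div_iff_mul_lt (by simp) (by simp)] at ha
    rwa [mul_comm]
  have m1 : MemLp (fun x => φ x - v x) 2 (volume.restrict U) :=
    ⟨hφ.continuous.aestronglyMeasurable.sub hv, h1.trans_le le_top⟩
  have m2 : MemLp (fun x => gradient φ x - G x) 2 (volume.restrict U) :=
    ⟨(continuous_gradient (hφ.of_le (by simp))).aestronglyMeasurable.sub hG, h2.trans_le le_top⟩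
  have m3 : MemLp (fun x => φ x - b x) 2 (μHE[m - 1].restrict N) :=
    ⟨hφ.continuous.aestronglyMeasurable.sub h.1.1, h3.trans_le le_top⟩
  have key : ∀ {ν : Measure (E m)} {F : Type} [NormedAddCommGroup F] [NormedSpace ℝ F]
      {f : E m → F}, ShiftInv ν S s → MemLp f 2 ν → eLpNorm f 2 ν < δ / 4 →
      eLpNorm (backDiff s fun x => ψ x • (f (x + s) - f x)) 2 ν < δ := fun {ν F} _ _ {f} hν hf hl =>
    ((hν.eLpNorm_backDiff_le hS (fun x hx => by simp [h0 x hx])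
      (hν.memLp_mulDiff hS hψm h0 hM hf)).trans
      (mul_le_mul_right (hν.eLpNorm_mulDiff_le hS hψm h0 hM hf) _)).trans_lt (hlt hl)
  have hΨ : ContDiff ℝ ∞ fun x => ψ x * (φ (x + s) - φ x) :=
    hψ.mul ((hφ.comp (contDiff_id.add contDiff_const)).sub hφ)
  refine ⟨backDiff s fun x => ψ x * (φ (x + s) - φ x),
    (hΨ.comp (contDiff_id.sub contDiff_const)).sub hΨ, ?_, ?_, ?_⟩
  · refine lt_of_le_of_lt (le_of_eq ?_) (key hU m1 h1)
    congr 1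
    ext x
    simp only [backDiff, smul_eq_mul]
    ring
  · refine lt_of_le_of_lt (le_of_eq ?_) (key hU m2 h2)
    refine eLpNorm_congr_ae ((ae_restrict_iff' hUm).2 (ae_of_all _ fun x hx => ?_))
    have hd' : gradient ψ (x - s) = 0 := by
      by_cases hxS : x - s ∈ S
      · exact hd _ ((hUS _ hxS).1 (by rwa [sub_add_cancel]))
      · exact h0' _ hxS
    simp only [gradient_backDiff hΨ, backDiff, gradient_mulDiff hψ hφ, diffGrad, hd x hx, hd',
      smul_zero, add_zero]
    simp only [smul_sub]
    abel
  · refine lt_of_le_of_lt (le_of_eq ?_) (key hN m3 h3)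
    congr 1
    ext x
    simp only [backDiff, smul_eq_mul]
    ring

end

namespace Problem
variable {d : ℕ} {P : Problem d}

/-- An element of `𝓗_ε` that has a trace on the lateral boundary of the channels. -/
def HasTrace {ε : ℝ} {hε : 0 < ε} (φ : P.Heps ε hε) : Prop :=
  ∃ b, IsTrace (P.chan ε) (P.chanN ε) (val φ) (grad φ) b

variable {ε : ℝ} {hε : 0 < ε}

lemma HasTrace.isTrace {φ : P.Heps ε hε} (h : HasTrace φ) :
    IsTrace (P.chan ε) (P.chanN ε) (val φ) (grad φ) (trN φ) := by
  have h' : ∃ b, IsTrace (P.chan ε) (P.chanN ε) (val φ) (grad φ) b := h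
  rw [trN, dif_pos h']
  exact h'.choose_spec

lemma trN_of_not_hasTrace {φ : P.Heps ε hε} (h : ¬ HasTrace φ) : trN φ = 0 := dif_neg h

lemma aestronglyMeasurable_val (φ : P.Heps ε hε) :
    AEStronglyMeasurable (val φ) (volume.restrict (P.chan ε)) :=
  ((Lp.memLp (val φ)).ofWvol_chan (inv_pos.2 hε)).1

lemma aestronglyMeasurable_grad (φ : P.Heps ε hε) :
    AEStronglyMeasurable (grad φ) (volume.restrict (P.chan ε)) :=
  ((Lp.memLp (grad φ)).ofWvol_chan hε).1

lemma isTrace_add {φ ψ : P.Heps ε hε} {b b' : E (d + 1) → ℝ}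
    (h : IsTrace (P.chan ε) (P.chanN ε) (val φ) (grad φ) b)
    (h' : IsTrace (P.chan ε) (P.chanN ε) (val ψ) (grad ψ) b') :
    IsTrace (P.chan ε) (P.chanN ε) (val (φ + ψ)) (grad (φ + ψ)) (fun x => b x + b' x) :=
  (h.add h' (aestronglyMeasurable_val φ) (aestronglyMeasurable_val ψ)
    (aestronglyMeasurable_grad φ) (aestronglyMeasurable_grad ψ)).congr
    (ae_chan (inv_pos.2 hε) (Lp.coeFn_add (val φ) (val ψ)))
    (ae_chan hε (Lp.coeFn_add (grad φ) (grad ψ))) Filter.EventuallyEq.rfl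

lemma isTrace_smul {φ : P.Heps ε hε} {b : E (d + 1) → ℝ}
    (h : IsTrace (P.chan ε) (P.chanN ε) (val φ) (grad φ) b) (a : ℝ) :
    IsTrace (P.chan ε) (P.chanN ε) (val (a • φ)) (grad (a • φ)) (fun x => a * b x) :=
  (h.smul a).congr
    (ae_chan (inv_pos.2 hε) (Lp.coeFn_smul a (val φ)))
    (ae_chan hε (Lp.coeFn_smul a (grad φ))) Filter.EventuallyEq.rfl

lemma HasTrace.of_add {φ ψ : P.Heps ε hε} (h : HasTrace (φ + ψ)) (h' : HasTrace φ) :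
    HasTrace ψ := by
  have := isTrace_add h.isTrace (isTrace_smul h'.isTrace (-1))
  have e : φ + ψ + (-1 : ℝ) • φ = ψ := by
    rw [neg_one_smul]
    abel
  rw [e] at this
  exact ⟨_, this⟩

/-- Traces are unique, by the trace inequality. -/
lemma Admissible.isTrace_unique (hP : P.Admissible) {ρ : ℝ} (hm : P.Margin ρ) (hρ : 0 < ρ)
    (hε : 0 < ε) {v : E (d + 1) → ℝ} {G : E (d + 1) → E (d + 1)} {b b' : E (d + 1) → ℝ}
    (hv : AEStronglyMeasurable v (volume.restrict (P.chan ε)))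
    (hG : AEStronglyMeasurable G (volume.restrict (P.chan ε)))
    (h : IsTrace (P.chan ε) (P.chanN ε) v G b) (h' : IsTrace (P.chan ε) (P.chanN ε) v G b') :
    b =ᵐ[μHE[d].restrict (P.chanN ε)] b' := by
  obtain ⟨C, -, hC⟩ := hP.exists_isTrace_le hm hρ 1 one_pos
  have h0 := h.add (h'.smul (-1)) hv (hv.const_mul _) hG
    (hG.fun_const_smul _)
  have h1 : IsTrace (P.chan ε) (P.chanN ε) (fun _ => 0) (fun _ => 0)
      (fun x => b x + -1 * b' x) := h0.congr (ae_of_all _ fun x => by simp)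
        (ae_of_all _ fun x => by simp) Filter.EventuallyEq.rfl
  have h2 := hC ε hε _ _ _ aestronglyMeasurable_const aestronglyMeasurable_const h1
  rw [eLpNorm_zero', eLpNorm_zero', mul_zero, mul_zero, add_zero, nonpos_iff_eq_zero] at h2
  filter_upwards [(eLpNorm_eq_zero_iff h1.1.1 (by norm_num)).1 h2] with x hx
  simp only [Pi.zero_apply] at hx
  linarith

lemma Admissible.trN_add (hP : P.Admissible) {ρ : ℝ} (hm : P.Margin ρ) (hρ : 0 < ρ)
    {φ ψ : P.Heps ε hε} (h1 : HasTrace φ) (h2 : HasTrace ψ) (h3 : HasTrace (φ + ψ)) :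
    trN (φ + ψ) =ᵐ[μHE[d].restrict (P.chanN ε)] trN φ + trN ψ :=
  hP.isTrace_unique hm hρ hε (aestronglyMeasurable_val _) (aestronglyMeasurable_grad _)
    h3.isTrace (isTrace_add h1.isTrace h2.isTrace)

lemma Admissible.trN_smul (hP : P.Admissible) {ρ : ℝ} (hm : P.Margin ρ) (hρ : 0 < ρ) (a : ℝ)
    {φ : P.Heps ε hε} (h1 : HasTrace φ) (h3 : HasTrace (a • φ)) :
    trN (a • φ) =ᵐ[μHE[d].restrict (P.chanN ε)] a • trN φ :=
  hP.isTrace_unique hm hρ hε (aestronglyMeasurable_val _) (aestronglyMeasurable_grad _)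
    h3.isTrace (isTrace_smul h1.isTrace a)

lemma eLpNorm_chan_eq {F : Type*} [NormedAddCommGroup F] [NormedSpace ℝ F] {μ : Measure (E (d + 1))}
    {R : Lp F 2 μ →L[ℝ] Lp F 2 (volume.restrict (P.chan ε))} {f : Lp F 2 μ}
    (h : R f =ᵐ[volume.restrict (P.chan ε)] f) :
    eLpNorm f 2 (volume.restrict (P.chan ε)) = ENNReal.ofReal ‖R f‖ := by
  rw [Lp.norm_def, ENNReal.ofReal_toReal (Lp.eLpNorm_ne_top _)]
  exact (eLpNorm_congr_ae h).symm

lemma Admissible.exists_norm_trN_le (hP : P.Admissible) {ρ : ℝ} (hm : P.Margin ρ) (hρ : 0 < ρ)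
    (hε : 0 < ε) : ∃ B : ℝ, ∀ φ : P.Heps ε hε, HasTrace φ →
      (eLpNorm (trN φ) 2 (μHE[d].restrict (P.chanN ε))).toReal ≤ B * ‖φ‖ := by
  obtain ⟨C, hC0, hC⟩ := hP.exists_isTrace_le hm hρ 1 one_pos
  obtain ⟨R1, h1⟩ := exists_clm_restrict (F := ℝ) ENNReal.ofReal_ne_top
    (P.chan_le_wvol ε (inv_pos.2 hε))
  obtain ⟨R2, h2⟩ := exists_clm_restrict (F := E (d + 1)) ENNReal.ofReal_ne_top
    (P.chan_le_wvol ε hε)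
  refine ⟨C / √ε * ‖R1.comp (P.valL ε hε)‖ + 1 * √ε * ‖R2.comp (P.gradL ε hε)‖, fun φ hφ => ?_⟩
  have h3 := hC ε hε _ _ _ (aestronglyMeasurable_val φ) (aestronglyMeasurable_grad φ) hφ.isTrace
  rw [eLpNorm_chan_eq (h1 (val φ)), eLpNorm_chan_eq (h2 (grad φ)),
    ← ENNReal.ofReal_mul (by positivity), ← ENNReal.ofReal_mul (by positivity),
    ← ENNReal.ofReal_add (by positivity) (by positivity)] at h3
  refine (ENNReal.toReal_le_of_le_ofReal (by positivity) h3).trans ?_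
  have e1 := (R1.comp (P.valL ε hε)).le_opNorm φ
  have e2 := (R2.comp (P.gradL ε hε)).le_opNorm φ
  rw [add_mul, mul_assoc (C / √ε), mul_assoc (1 * √ε)]
  exact add_le_add (mul_le_mul_of_nonneg_left e1 (by positivity))
    (mul_le_mul_of_nonneg_left e2 (by positivity))

/-- If every element of `𝓗_ε` has a trace, then the trace is a bounded operator. -/
lemma Admissible.exists_traceOperator (hP : P.Admissible) {ρ : ℝ} (hm : P.Margin ρ) (hρ : 0 < ρ)
    (hall : ∀ φ : P.Heps ε hε, HasTrace φ) :
    ∃ R : P.Heps ε hε →L[ℝ] Lp ℝ 2 (μHE[d].restrict (P.chanN ε)),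
      ∀ φ, R φ =ᵐ[μHE[d].restrict (P.chanN ε)] trN φ := by
  obtain ⟨B, hB⟩ := hP.exists_norm_trN_le hm hρ hε
  have hmem : ∀ φ : P.Heps ε hε, MemLp (trN φ) 2 (μHE[d].restrict (P.chanN ε)) := fun φ =>
    (hall φ).isTrace.1
  have hadd : ∀ φ ψ : P.Heps ε hε, (hmem (φ + ψ)).toLp = (hmem φ).toLp + (hmem ψ).toLp :=
    fun φ ψ => by
      rw [← MemLp.toLp_add, MemLp.toLp_eq_toLp_iff]
      exact hP.trN_add hm hρ (hall φ) (hall ψ) (hall (φ + ψ))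
  have hsmul : ∀ (a : ℝ) (φ : P.Heps ε hε), (hmem (a • φ)).toLp = a • (hmem φ).toLp :=
    fun a φ => by
      rw [← MemLp.toLp_const_smul, MemLp.toLp_eq_toLp_iff]
      exact hP.trN_smul hm hρ a (hall φ) (hall (a • φ))
  let R0 : P.Heps ε hε →ₗ[ℝ] Lp ℝ 2 (μHE[d].restrict (P.chanN ε)) :=
    { toFun := fun φ => (hmem φ).toLp
      map_add' := hadd
      map_smul' := hsmul }
  refine ⟨R0.mkContinuous B fun φ => ?_, fun φ => MemLp.coeFn_toLp (hmem φ)⟩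
  have e : ‖R0 φ‖ = (eLpNorm (trN φ) 2 (μHE[d].restrict (P.chanN ε))).toReal :=
    Lp.norm_toLp _ (hmem φ)
  rw [e]
  exact hB φ (hall φ)

end Problem

end

section

/-! ### Superposition operators and the coefficients on the channels -/

section Superposition

variable {X Y : Type*} [MeasurableSpace X] [TopologicalSpace Y] [SecondCountableTopology Y]
  [MeasurableSpace Y] [BorelSpace Y] {m : Measure X} {A : Set Y} {F : Y → ℝ → ℝ} {π : X → Y}

/-- Superposition with a continuous function preserves measurability.  The function is continuous on
`A × ℝ` only, and its values elsewhere are irrelevant. -/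
lemma aestronglyMeasurable_superposition (hA : MeasurableSet A)
    (hF : ContinuousOn (fun p : Y × ℝ => F p.1 p.2) (A ×ˢ univ)) (hπ : Measurable π)
    (hπA : ∀ᵐ x ∂m, π x ∈ A) {v : X → ℝ} (hv : AEStronglyMeasurable v m) :
    AEStronglyMeasurable (fun x => F (π x) (v x)) m := by
  classical
  obtain ⟨v', hv', hvv⟩ := hv
  have hg : Measurable fun x => (π x, v' x) := hπ.prodMk hv'.measurable
  have hF' : Measurable ((A ×ˢ univ).piecewise (fun p : Y × ℝ => F p.1 p.2) fun _ => 0) :=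
    hF.measurable_piecewise continuousOn_const (hA.prod MeasurableSet.univ)
  refine ⟨_, (hF'.comp hg).stronglyMeasurable, ?_⟩
  filter_upwards [hvv, hπA] with x h1 h2
  have : (π x, v' x) ∈ A ×ˢ (univ : Set ℝ) := ⟨h2, mem_univ _⟩
  simp only [Function.comp_apply, piecewise_eq_of_mem _ _ _ this, h1]

lemma exists_abs_le_of_lipschitz {L : ℝ≥0} (hA : IsCompact A)
    (hF : ContinuousOn (fun p : Y × ℝ => F p.1 p.2) (A ×ˢ univ))
    (hL : ∀ y ∈ A, LipschitzWith L (F y)) : ∃ B : ℝ, ∀ y ∈ A, ∀ z, |F y z| ≤ B + L * |z| := by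
  have hc : ContinuousOn (fun y => F y 0) A :=
    hF.comp (continuousOn_id.prodMk continuousOn_const) fun y hy => ⟨hy, mem_univ _⟩
  obtain ⟨B, hB⟩ := hA.exists_bound_of_continuousOn hc
  refine ⟨B, fun y hy z => ?_⟩
  have h1 := (hL y hy).dist_le_mul z 0
  rw [Real.dist_eq, Real.dist_eq, sub_zero] at h1
  have h2 := hB y hy
  rw [Real.norm_eq_abs] at h2
  calc |F y z| = |F y 0 + (F y z - F y 0)| := by congr 1; ring
    _ ≤ |F y 0| + |F y z - F y 0| := abs_add_le _ _
    _ ≤ B + L * |z| := add_le_add h2 h1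

/-- Superposition with a Lipschitz continuous function preserves square integrability. -/
lemma memLp_superposition [IsFiniteMeasure m] {L : ℝ≥0} (hA : IsCompact A) (hAm : MeasurableSet A)
    (hF : ContinuousOn (fun p : Y × ℝ => F p.1 p.2) (A ×ˢ univ))
    (hL : ∀ y ∈ A, LipschitzWith L (F y)) (hπ : Measurable π)
    (hπA : ∀ᵐ x ∂m, π x ∈ A) {v : X → ℝ} (hv : MemLp v 2 m) :
    MemLp (fun x => F (π x) (v x)) 2 m := by
  obtain ⟨B, hB⟩ := exists_abs_le_of_lipschitz hA hF hL
  have hg : MemLp (fun x => B + L * |v x|) 2 m := (memLp_const B).add (hv.norm.const_mul L)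
  refine hg.mono (aestronglyMeasurable_superposition hAm hF hπ hπA hv.1) ?_
  filter_upwards [hπA] with x hx
  rw [Real.norm_eq_abs, Real.norm_eq_abs]
  exact (hB _ hx _).trans (le_abs_self _)

end Superposition

lemma isBounded_cyl {d : ℕ} {B : Set (E d)} {I : Set ℝ} (hB : Bornology.IsBounded B)
    (hI : Bornology.IsBounded I) : Bornology.IsBounded (cyl B I) := by
  obtain ⟨b, hb⟩ := isBounded_iff_forall_norm_le.1 hB
  obtain ⟨c, hc⟩ := isBounded_iff_forall_norm_le.1 hI
  rw [isBounded_iff_forall_norm_le]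
  refine ⟨√(b ^ 2 + c ^ 2), fun x hx => ?_⟩
  rw [EuclideanSpace.norm_eq, Fin.sum_univ_castSucc]
  refine Real.sqrt_le_sqrt (add_le_add ?_ ?_)
  · have h1 := hb _ hx.1
    have h2 : ∑ i : Fin d, ‖x i.castSucc‖ ^ 2 = ‖bar x‖ ^ 2 := by
      rw [EuclideanSpace.norm_sq_eq]
      rfl
    rw [h2]
    gcongr
  · have h1 : ‖x (Fin.last d)‖ ≤ c := hc _ hx.2
    gcongr

lemma measurable_perRep {d : ℕ} : Measurable (perRep : E (d + 1) → E (d + 1)) := by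
  have h : Measurable fun (y : E (d + 1)) (i : Fin (d + 1)) => perRep y i := by
    refine measurable_pi_lambda _ fun i => ?_
    refine Fin.lastCases ?_ (fun j => ?_) i
    · simp only [perRep, mkPt_last]
      exact continuous_vert.measurable
    · simp only [perRep, mkPt_castSucc]
      exact measurable_fract.comp (by simp only [bar_apply]; fun_prop)
  exact (PiLp.continuous_toLp 2 _).measurable.comp h

namespace Problem
variable {d : ℕ} {P : Problem d}

/-- The position in the standard cell of a point `x` of the layer: the point `x / ε`, reduced modulo
`ℤ^d` in the horizontal variables. -/
def cellPt (ε : ℝ) (x : E (d + 1)) : E (d + 1) := perRep (ε⁻¹ • x)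

lemma measurable_cellPt (ε : ℝ) : Measurable (cellPt ε : E (d + 1) → E (d + 1)) :=
  measurable_perRep.comp (measurable_const_smul ε⁻¹)

lemma cellPt_add_shiftVec {ε : ℝ} (hε : 0 < ε) (l : Fin d → ℤ) (x : E (d + 1)) :
    cellPt ε (x + shiftVec ε l) = cellPt ε x := by
  have e : ε⁻¹ • (x + shiftVec ε l) = ε⁻¹ • x + mkPt (intVec l) 0 := by
    rw [smul_add, shiftVec, smul_smul, inv_mul_cancel₀ hε.ne', one_smul]
  rw [cellPt, cellPt, e]
  refine ext_bar_vert ?_ ?_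
  · simp only [perRep, bar_mkPt]
    ext i
    simp only [bar_add, bar_mkPt, PiLp.add_apply, intVec_apply, Int.fract_add_intCast]
  · simp [perRep]

lemma Margin.cellPt_eq {ρ : ℝ} (hm : P.Margin ρ) (hρ : 0 < ρ) {ε : ℝ} (hε : 0 < ε)
    (k : Fin d → ℤ) {y : E (d + 1)} (hy : y ∈ closure P.Zs) :
    cellPt ε (ε • (y + mkPt (intVec k) 0)) = y := by
  rw [cellPt, smul_smul, inv_mul_cancel₀ hε.ne', one_smul]
  refine ext_bar_vert ?_ ?_
  · simp only [perRep, bar_mkPt]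
    ext i
    have := hm y hy i
    simp only [bar_add, bar_mkPt, PiLp.add_apply, intVec_apply, Int.fract_add_intCast]
    exact Int.fract_eq_self.2 ⟨by linarith [this.1], by linarith [this.2]⟩
  · simp [perRep]

lemma Margin.cellPt_mem {ρ : ℝ} (hm : P.Margin ρ) (hρ : 0 < ρ) {ε : ℝ} (hε : 0 < ε)
    {A : Set (E (d + 1))} (hA : A ⊆ closure P.Zs) {x : E (d + 1)} (hx : x ∈ P.copies ε A) :
    cellPt ε x ∈ A := by
  obtain ⟨k, -, y, hy, rfl⟩ := mem_copies.1 hx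
  rw [hm.cellPt_eq hρ hε k (hA hy)]
  exact hy

/-- A property that holds almost everywhere in the standard channel holds almost everywhere in the
channels. -/
lemma Margin.ae_cellPt {ρ : ℝ} (hm : P.Margin ρ) (hρ : 0 < ρ) (hP : P.Admissible) {ε : ℝ}
    (hε : 0 < ε) {p : E (d + 1) → Prop} (hp : ∀ᵐ y ∂volume.restrict P.Zs, p y) :
    ∀ᵐ x ∂volume.restrict (P.chan ε), p (cellPt ε x) := by
  have hvol : (volume : Measure (E (d + 1))) = μHE[d + 1] :=
    (EuclideanSpace.euclideanHausdorffMeasure_eq_volume (d + 1)).symm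
  obtain ⟨B, hB, hBm, hB0⟩ := exists_measurable_superset_of_null hp
  have hBm' : MeasurableSet (cellPt ε ⁻¹' B : Set (E (d + 1))) := measurable_cellPt ε hBm
  have h0 : ∫⁻ x in P.chan ε, (cellPt ε ⁻¹' B).indicator 1 x = 0 := by
    rw [hm.lintegral_chan hρ hP hε, ENNReal.tsum_eq_zero]
    intro k
    rw [hvol, setLIntegral_copy hε, ← hvol]
    refine mul_eq_zero_of_right _ ?_
    have : ∫⁻ y in P.Zs, (cellPt ε ⁻¹' B).indicator 1 (ε • (y + mkPt (intVec k) 0)) =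
        ∫⁻ y in P.Zs, B.indicator 1 y := by
      refine setLIntegral_congr_fun hP.isOpen_zs.measurableSet fun y hy => ?_
      classical
      simp only [indicator_apply, mem_preimage, hm.cellPt_eq hρ hε k (subset_closure hy),
        Pi.one_apply]
    rw [this, lintegral_indicator_one hBm]
    exact hB0
  rw [lintegral_indicator_one hBm'] at h0
  refine measure_mono_null (fun x hx => ?_) h0
  exact hB hx

lemma Admissible.isBounded_Om (hP : P.Admissible) : Bornology.IsBounded P.Om :=
  isBounded_cyl hP.sig_bounded (Metric.isBounded_Ioo _ _)

lemma bulk_subset_Om {ε : ℝ} (hε : 0 < ε) (s : Bool) : P.bulk ε s ⊆ P.Om := fun x hx =>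
  ⟨hx.1, by
    have := hx.2
    cases s <;> simp only [bulkIoo, if_true, Bool.false_eq_true, if_false, mem_Ioo] at this ⊢ <;>
      constructor <;> linarith [this.1, this.2]⟩

lemma Admissible.isFiniteMeasure_bulk (hP : P.Admissible) {ε : ℝ} (hε : 0 < ε) (s : Bool) :
    IsFiniteMeasure (volume.restrict (P.bulk ε s)) :=
  isFiniteMeasure_restrict.2
    (hP.isBounded_Om.subset (bulk_subset_Om hε s)).measure_lt_top.ne

lemma Admissible.isFiniteMeasure_chan (hP : P.Admissible) (ε : ℝ) :
    IsFiniteMeasure (volume.restrict (P.chan ε)) := by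
  refine isFiniteMeasure_restrict.2 (Bornology.IsBounded.measure_lt_top ?_).ne
  refine (isBounded_cyl hP.sig_bounded (Metric.isBounded_Ioo (-ε) ε)).subset fun x hx => ?_
  obtain ⟨k, hk, hx⟩ := mem_copies.1 hx
  exact hk (copy_mono hP.zs_subset hx)

lemma Admissible.isFiniteMeasure_chanN (hP : P.Admissible) {ρ : ℝ} (hm : P.Margin ρ) (hρ : 0 < ρ)
    {ε : ℝ} (hε : 0 < ε) : IsFiniteMeasure (μHE[d].restrict (P.chanN ε)) := by
  obtain ⟨C, hC⟩ := hP.exists_trace_chan hm hρ 1 one_pos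
  have h := hC ε hε (fun _ => 1) contDiff_const
  have hfin := hP.isFiniteMeasure_chan ε
  refine ⟨?_⟩
  have e : ∫⁻ x in P.chanN ε, ENNReal.ofReal ((fun _ : E (d + 1) => (1 : ℝ)) x ^ 2) ∂μHE[d] =
      (μHE[d].restrict (P.chanN ε)) univ := by simp
  rw [e] at h
  refine h.trans_lt ?_
  simp only [one_pow, ENNReal.ofReal_one, lintegral_const, fderiv_fun_const, Pi.zero_apply,
    norm_zero, ne_eq, OfNat.ofNat_ne_zero, not_false_eq_true, zero_pow, ENNReal.ofReal_zero,
    zero_mul, mul_zero, add_zero, one_mul]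
  exact ENNReal.mul_lt_top ENNReal.ofReal_lt_top (measure_lt_top _ _)

section Rates

variable {ε t : ℝ} {v : E (d + 1) → ℝ}

lemma Admissible.isCompact_Om (hP : P.Admissible) : IsCompact (closure P.Om) :=
  hP.isBounded_Om.isCompact_closure

lemma Admissible.f_contOn (hP : P.Admissible) (s : Bool) (ht : t ∈ Icc 0 P.T) :
    ContinuousOn (fun p : E (d + 1) × ℝ => P.f s t p.1 p.2) (closure P.Om ×ˢ univ) :=
  (hP.f_cont s).comp (f := fun p : E (d + 1) × ℝ => (t, p.1, p.2)) (by fun_prop)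
    fun _ hp => ⟨ht, hp.1, mem_univ _⟩

lemma Admissible.memLp_f (hP : P.Admissible) (hε : 0 < ε) (s : Bool) (ht : t ∈ Icc 0 P.T)
    (hv : MemLp v 2 (volume.restrict (P.bulk ε s))) :
    MemLp (fun x => P.f s t x (v x)) 2 (volume.restrict (P.bulk ε s)) := by
  have := hP.isFiniteMeasure_bulk hε s
  obtain ⟨L, hL⟩ := hP.f_lipschitz s
  refine memLp_superposition (π := fun x => x) hP.isCompact_Om isClosed_closure.measurableSet
    (hP.f_contOn s ht) (hL t ht) measurable_id ?_ hv
  filter_upwards [ae_restrict_mem (hP.isOpen_bulk ε s).measurableSet] with x hx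
  exact subset_closure (bulk_subset_Om hε s hx)

lemma Admissible.memLp_g (hP : P.Admissible) {ρ : ℝ} (hm : P.Margin ρ) (hρ : 0 < ρ) (hε : 0 < ε)
    (ht : t ∈ Icc 0 P.T) (hv : MemLp v 2 (volume.restrict (P.chan ε))) :
    MemLp (fun x => P.g t (cellPt ε x) (v x)) 2 (volume.restrict (P.chan ε)) := by
  have := hP.isFiniteMeasure_chan ε
  obtain ⟨L, hL⟩ := hP.g_lipschitz
  refine memLp_superposition (F := P.g t) hP.zs_bounded.isCompact_closure
    isClosed_closure.measurableSet ?_ (hL t ht) (measurable_cellPt ε) ?_ hv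
  · exact hP.g_cont.comp (f := fun p : E (d + 1) × ℝ => (t, p.1, p.2)) (by fun_prop)
      fun _ hp => ⟨ht, hp.1, mem_univ _⟩
  · filter_upwards [ae_restrict_mem (hP.isOpen_chan hε).measurableSet] with x hx
    exact subset_closure (hm.cellPt_mem hρ hε subset_closure hx)

lemma Admissible.memLp_hN (hP : P.Admissible) {ρ : ℝ} (hm : P.Margin ρ) (hρ : 0 < ρ) (hε : 0 < ε)
    (ht : t ∈ Icc 0 P.T) (hv : MemLp v 2 (μHE[d].restrict (P.chanN ε))) :
    MemLp (fun x => P.hN t (cellPt ε x) (v x)) 2 (μHE[d].restrict (P.chanN ε)) := by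
  have := hP.isFiniteMeasure_chanN hm hρ hε
  obtain ⟨L, hL⟩ := hP.hN_lipschitz
  refine memLp_superposition (F := P.hN t)
    (hP.zs_bounded.isCompact_closure.of_isClosed_subset isClosed_closure
      (closure_minimal lateral_subset_closure isClosed_closure))
    isClosed_closure.measurableSet ?_ (hL t ht) (measurable_cellPt ε) ?_ hv
  · exact hP.hN_cont.comp (f := fun p : E (d + 1) × ℝ => (t, p.1, p.2)) (by fun_prop)
      fun _ hp => ⟨ht, hp.1, mem_univ _⟩
  · filter_upwards [ae_restrict_mem (measurableSet_chanN hε)] with x hx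
    exact subset_closure (hm.cellPt_mem hρ hε lateral_subset_closure hx)

lemma toEuclideanLin_eq_sum {n : ℕ} (A : Matrix (Fin n) (Fin n) ℝ) (ξ : E n) :
    A.toEuclideanLin ξ = ∑ i, ∑ j, (A i j * ξ j) • EuclideanSpace.single i (1 : ℝ) := by
  ext k
  simp [Matrix.toLpLin_apply, Matrix.mulVec, dotProduct, Pi.single_apply]

/-- The diffusive flux in the channels is square integrable. -/
lemma Admissible.memLp_flux (hP : P.Admissible) {ρ : ℝ} (hm : P.Margin ρ) (hρ : 0 < ρ) (hε : 0 < ε)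
    {G : E (d + 1) → E (d + 1)} (hG : MemLp G 2 (volume.restrict (P.chan ε))) :
    MemLp (fun x => (P.DM (cellPt ε x)).toEuclideanLin (G x)) 2 (volume.restrict (P.chan ε)) := by
  simp only [toEuclideanLin_eq_sum]
  refine memLp_finsetSum _ fun i _ => memLp_finsetSum _ fun j _ => ?_
  have hD := hP.DM_bounded i j
  have hq : Measure.QuasiMeasurePreserving (cellPt ε : E (d + 1) → E (d + 1))
      (volume.restrict (P.chan ε)) (volume.restrict P.Zs) := by
    refine ⟨measurable_cellPt ε, fun B hB => ?_⟩
    obtain ⟨B', h1, h2, h3⟩ := exists_measurable_superset_of_null hB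
    refine measure_mono_null h1 ?_
    rw [Measure.map_apply (measurable_cellPt ε) h2]
    have := hm.ae_cellPt hρ hP hε (measure_eq_zero_iff_ae_notMem.1 h3)
    exact measure_eq_zero_iff_ae_notMem.2 this
  have hDm : AEStronglyMeasurable (fun x => P.DM (cellPt ε x) i j) (volume.restrict (P.chan ε)) :=
    hD.1.comp_quasiMeasurePreserving hq
  have hGj : MemLp (fun x => G x j) 2 (volume.restrict (P.chan ε)) :=
    (EuclideanSpace.proj j : E (d + 1) →L[ℝ] ℝ).comp_memLp' hG
  have hDb : ∃ b : ℝ, ∀ᵐ y ∂volume.restrict P.Zs, ‖P.DM y i j‖ ≤ b := by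
    refine ⟨(eLpNorm (fun y => P.DM y i j) ⊤ (volume.restrict P.Zs)).toReal, ?_⟩
    filter_upwards [ae_le_eLpNormEssSup (f := fun y => P.DM y i j)
      (μ := volume.restrict P.Zs)] with y hy
    rw [← toReal_enorm]
    exact ENNReal.toReal_mono hD.eLpNorm_ne_top (by rwa [eLpNorm_exponent_top])
  obtain ⟨b, hb⟩ := hDb
  have h1 : MemLp (fun x => P.DM (cellPt ε x) i j * G x j) 2 (volume.restrict (P.chan ε)) := by
    refine (hGj.const_mul b).mono (hDm.mul hGj.1) ?_
    filter_upwards [hm.ae_cellPt hρ hP hε hb] with x hx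
    rw [norm_mul, norm_mul]
    exact mul_le_mul_of_nonneg_right (hx.trans (le_abs_self b)) (norm_nonneg _)
  exact ((ContinuousLinearMap.toSpanSingleton ℝ
    (EuclideanSpace.single i (1 : ℝ))).comp_memLp' h1)

end Rates

end Problem

end

section

/-! ### Testing the weak formulation with a time dependent function -/

/-- A family of continuous functionals, each vector of which is annihilated at almost every time,
annihilates a time dependent vector at almost every time.  The space need not be separable, since
the time dependent vector has an essentially separable range. -/
lemma ae_apply_eq_zero {α H : Type*} [MeasurableSpace α] {m : Measure α} [NormedAddCommGroup H]
    {Φ : α → H → ℝ} (hc : ∀ᵐ t ∂m, Continuous (Φ t)) (h : ∀ φ, ∀ᵐ t ∂m, Φ t φ = 0)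
    {u : α → H} (hu : AEStronglyMeasurable u m) : ∀ᵐ t ∂m, Φ t (u t) = 0 := by
  obtain ⟨S, ⟨D, hD, hSD⟩, hS⟩ := hu.isSeparable_ae_range
  have h1 : ∀ᵐ t ∂m, ∀ φ ∈ D, Φ t φ = 0 := (ae_ball_iff hD).2 fun φ _ => h φ
  filter_upwards [hc, hS, h1] with t h2 h3 h4
  exact (isClosed_eq h2 continuous_const).closure_subset_iff.2 h4 (hSD h3)

/-- Integration against a square integrable function is a continuous functional. -/
lemma exists_clm_integral_inner {α F : Type*} [MeasurableSpace α] [NormedAddCommGroup F]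
    [InnerProductSpace ℝ F] {μ ν : Measure α} {C : ℝ≥0∞} (hC : C ≠ ⊤)
    (hμν : ν ≤ C • μ) {A : α → F} (hA : MemLp A 2 ν) :
    ∃ ℓ : StrongDual ℝ (Lp F 2 μ), ∀ g : Lp F 2 μ, ℓ g = ∫ x, inner ℝ (A x) (g x) ∂ν := by
  obtain ⟨R, hR⟩ := exists_clm_restrict (F := F) hC hμν
  refine ⟨(innerSL ℝ (hA.toLp A)).comp R, fun g => ?_⟩
  rw [ContinuousLinearMap.comp_apply, innerSL_apply_apply, L2.inner_def]
  refine integral_congr_ae ?_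
  filter_upwards [hA.coeFn_toLp, hR g] with x h1 h2
  rw [h1, h2]

namespace Problem
variable {d : ℕ} {P : Problem d}

/-- The part of the weak formulation that involves integrals over the bulk domains and the channels
(and not over the lateral surfaces), all terms being put on the left-hand side. -/
def volForm (P : Problem d) {ε : ℝ} {hε : 0 < ε} (t : ℝ) (u φ : P.Heps ε hε) : ℝ :=
  (∑ s, P.D s * (∫ x in P.bulk ε s, inner ℝ (grad u x) (grad φ x)))
    + ε * (∫ x in P.chan ε, inner ℝ ((P.DM (cellPt ε x)).toEuclideanLin (grad u x)) (grad φ x))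
    - (∑ s, (∫ x in P.bulk ε s, P.f s t x (val u x) * val φ x))
    - ε⁻¹ * (∫ x in P.chan ε, P.g t (cellPt ε x) (val u x) * val φ x)

variable {ε : ℝ} {hε : 0 < ε}

lemma memLp_val (u : P.Heps ε hε) : MemLp (val u) 2 (P.wvol ε ε⁻¹) := Lp.memLp _

lemma memLp_grad (u : P.Heps ε hε) : MemLp (grad u) 2 (P.wvol ε ε) := Lp.memLp _

/-- `volForm` is a continuous functional of the test function. -/
lemma Admissible.exists_volForm (hP : P.Admissible) {ρ : ℝ} (hm : P.Margin ρ) (hρ : 0 < ρ)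
    {t : ℝ} (ht : t ∈ Icc 0 P.T) (u : P.Heps ε hε) :
    ∃ ℓ : StrongDual ℝ (P.Heps ε hε), ∀ φ, ℓ φ = P.volForm t u φ := by
  have hε' : 0 < ε⁻¹ := inv_pos.2 hε
  have h1 : ∀ s, ∃ ℓ : StrongDual ℝ (P.Geps ε), ∀ G : P.Geps ε,
      ℓ G = ∫ x in P.bulk ε s, inner ℝ (grad u x) (G x) := fun s =>
    exists_clm_integral_inner (by simp) (P.bulk_le_wvol ε ε s) ((memLp_grad u).ofWvol s)
  obtain ⟨ℓ2, h2⟩ := exists_clm_integral_inner ENNReal.ofReal_ne_top (P.chan_le_wvol ε hε)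
    (hP.memLp_flux hm hρ hε ((memLp_grad u).ofWvol_chan hε))
  have h3 : ∀ s, ∃ ℓ : StrongDual ℝ (P.Leps ε), ∀ v : P.Leps ε,
      ℓ v = ∫ x in P.bulk ε s, inner ℝ (P.f s t x (val u x)) (v x) := fun s =>
    exists_clm_integral_inner (by simp) (P.bulk_le_wvol ε ε⁻¹ s)
      (hP.memLp_f hε s ht ((memLp_val u).ofWvol s))
  obtain ⟨ℓ4, h4⟩ := exists_clm_integral_inner ENNReal.ofReal_ne_top (P.chan_le_wvol ε hε')
    (hP.memLp_g hm hρ hε ht ((memLp_val u).ofWvol_chan hε'))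
  choose ℓ1 h1 using h1
  choose ℓ3 h3 using h3
  refine ⟨((∑ s, P.D s • ℓ1 s) + ε • ℓ2).comp (gradL P ε hε) -
    ((∑ s, ℓ3 s) + ε⁻¹ • ℓ4).comp (valL P ε hε), fun φ => ?_⟩
  have hi : ∀ a b : ℝ, inner ℝ a b = a * b := fun a b => by simp [mul_comm]
  simp only [_root_.sub_apply, ContinuousLinearMap.comp_apply, _root_.add_apply,
    _root_.sum_apply, _root_.smul_apply, gradL_apply, valL_apply, h1, h2, h3, h4,
    smul_eq_mul, hi, volForm]
  ring

/-- The boundary contribution to the weak formulation tested with `φ`: the integral over `N_ε` of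
proper traces, or zero. -/
def IsBoundaryTerm {ε : ℝ} {hε : 0 < ε} (t : ℝ) (u φ : P.Heps ε hε) (β : ℝ) : Prop :=
  β = 0 ∨ HasTrace u ∧ HasTrace φ ∧
    β = ∫ x in P.chanN ε, P.hN t (cellPt ε x) (trN u x) * trN φ x ∂μHE[d]

/-- The weak formulation may be tested with a time dependent function.  If every element of `H¹(Ω_ε)`
has a trace, the boundary integral is a continuous functional of the test function.  Otherwise, as
`trN` is zero by definition for functions without trace, the sum of the other terms vanishes for these
test functions, and by linearity for all. -/
lemma Admissible.tested_equation (hP : P.Admissible) {ρ : ℝ} (hm : P.Margin ρ) (hρ : 0 < ρ)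
    {u : ℝ → P.Heps ε hε} {w : ℝ → StrongDual ℝ (P.Heps ε hε)}
    (hu : AEStronglyMeasurable u (volume.restrict (Ioo 0 P.T)))
    (heq : ∀ φ : P.Heps ε hε, ∀ᵐ t ∂volume.restrict (Ioo 0 P.T),
      w t φ + P.volForm t (u t) φ +
        (∫ x in P.chanN ε, P.hN t (cellPt ε x) (trN (u t) x) * trN φ x ∂μHE[d]) = 0)
    (KH : P.Heps ε hε →L[ℝ] P.Heps ε hε) :
    ∀ᵐ t ∂volume.restrict (Ioo 0 P.T), ∃ β, IsBoundaryTerm t (u t) (KH (u t)) β ∧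
      w t (KH (u t)) + P.volForm t (u t) (KH (u t)) + β = 0 := by
  have hKu : AEStronglyMeasurable (fun t => KH (u t)) (volume.restrict (Ioo 0 P.T)) :=
    KH.continuous.comp_aestronglyMeasurable hu
  have hIcc : ∀ᵐ t ∂volume.restrict (Ioo 0 P.T), t ∈ Icc 0 P.T :=
    (ae_restrict_mem measurableSet_Ioo).mono fun t ht => Ioo_subset_Icc_self ht
  have hlin : ∀ t ∈ Icc 0 P.T, ∃ ℓ : StrongDual ℝ (P.Heps ε hε),
      ∀ φ, ℓ φ = w t φ + P.volForm t (u t) φ := fun t ht => by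
    obtain ⟨ℓ, hℓ⟩ := hP.exists_volForm hm hρ ht (u t)
    exact ⟨w t + ℓ, fun φ => by rw [_root_.add_apply, hℓ]⟩
  by_cases hall : ∀ φ : P.Heps ε hε, HasTrace φ
  · obtain ⟨R, hR⟩ := hP.exists_traceOperator hm hρ hall
    have hmain := ae_apply_eq_zero (Φ := fun t φ => w t φ + P.volForm t (u t) φ +
        (∫ x in P.chanN ε, P.hN t (cellPt ε x) (trN (u t) x) * trN φ x ∂μHE[d])) ?_ heq hKu
    · filter_upwards [hmain] with t ht
      exact ⟨_, Or.inr ⟨hall _, hall _, rfl⟩, ht⟩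
    · filter_upwards [hIcc] with t ht
      obtain ⟨ℓ, hℓ⟩ := hlin t ht
      obtain ⟨ℓ', hℓ'⟩ := exists_clm_integral_inner (C := 1) (by simp) (by rw [one_smul])
        (hP.memLp_hN hm hρ hε ht (hall (u t)).isTrace.1)
      refine (ℓ + ℓ'.comp R).continuous.congr fun φ => ?_
      rw [_root_.add_apply, hℓ, ContinuousLinearMap.comp_apply, hℓ']
      congr 1
      refine integral_congr_ae ((hR φ).mono fun x hx => ?_)
      simp [hx, mul_comm]
  · push Not at hall
    obtain ⟨φ₀, hφ₀⟩ := hall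
    have h0 : ∀ φ : P.Heps ε hε, ∀ᵐ t ∂volume.restrict (Ioo 0 P.T),
        w t φ + P.volForm t (u t) φ = 0 := by
      have hno : ∀ φ : P.Heps ε hε, ¬ HasTrace φ → ∀ᵐ t ∂volume.restrict (Ioo 0 P.T),
          w t φ + P.volForm t (u t) φ = 0 := fun φ hφ => by
        filter_upwards [heq φ] with t ht
        simpa [trN_of_not_hasTrace hφ] using ht
      intro φ
      by_cases hφ : HasTrace φ
      · filter_upwards [hno φ₀ hφ₀, hno (φ + φ₀) fun h => hφ₀ (h.of_add hφ), hIcc]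
          with t h1 h2 ht
        obtain ⟨ℓ, hℓ⟩ := hlin t ht
        rw [← hℓ] at h1 h2 ⊢
        rw [map_add] at h2
        linarith
      · exact hno φ hφ
    have hmain := ae_apply_eq_zero (Φ := fun t φ => w t φ + P.volForm t (u t) φ) ?_ h0 hKu
    · filter_upwards [hmain] with t ht
      exact ⟨0, Or.inl rfl, by rw [add_zero]; exact ht⟩
    · filter_upwards [hIcc] with t ht
      obtain ⟨ℓ, hℓ⟩ := hlin t ht
      exact ℓ.continuous.congr fun φ => hℓ φ

end Problem

end

section

/-! ### Estimates for terms tested with second differences -/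

section Abstract

variable {m : ℕ} {μ : Measure (E m)} {S : Set (E m)} {s : E m}

lemma ShiftInv.memLp_shift_sub (h : ShiftInv μ S s) (hS : MeasurableSet S) {F : Type*}
    [NormedAddCommGroup F] [NormedSpace ℝ F] {f : E m → F} (hf : MemLp f 2 μ) :
    MemLp (fun x => f (x + s) - f x) 2 (μ.restrict S) := by
  classical
  have h1 := h.memLp_mulDiff hS (M := 1) (ζ := S.indicator 1) (measurable_one.indicator hS)
    (fun x hx => indicator_of_notMem hx _)
    (fun x => by by_cases hx : x ∈ S <;> simp [hx]) hf
  rw [← memLp_indicator_iff_restrict hS]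
  refine h1.ae_eq (Filter.Eventually.of_forall fun x => ?_)
  by_cases hx : x ∈ S <;> simp [hx]

lemma ShiftInv.integrable_sq_mulDiff (h : ShiftInv μ S s) (hS : MeasurableSet S) {η : E m → ℝ}
    (hη : Measurable η) (h0 : ∀ x ∉ S, η x = 0) (h1 : ∀ x, |η x| ≤ 1) {F : Type*}
    [NormedAddCommGroup F] [NormedSpace ℝ F] {f : E m → F} (hf : MemLp f 2 μ) :
    Integrable (fun x => η x ^ 2 * ‖f (x + s) - f x‖ ^ 2) μ := by
  have := (h.memLp_mulDiff hS hη h0 h1 hf).integrable_norm_pow (by norm_num)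
  refine this.congr (Filter.Eventually.of_forall fun x => ?_)
  simp only [norm_smul, mul_pow, Real.norm_eq_abs, sq_abs]

/-- A term of the form `∫ F(x, v) φ`, tested with the cut off second difference `φ` of `v`, is
controlled by the cut off first difference of `v` if `F` is Lipschitz continuous in the second
variable, up to the oscillation `r` of `F` in the first one. -/
lemma ShiftInv.abs_integral_mul_backDiff_le (h : ShiftInv μ S s) (hS : MeasurableSet S)
    {η : E m → ℝ} (hη : Measurable η) (h0 : ∀ x ∉ S, η x = 0) (h1 : ∀ x, |η x| ≤ 1)
    {f v r : E m → ℝ} (hf : MemLp f 2 μ) (hv : MemLp v 2 μ) (hr : MemLp r 2 (μ.restrict S))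
    {L : ℝ} (hL : ∀ᵐ x ∂μ.restrict S, |f (x + s) - f x| ≤ L * |v (x + s) - v x| + |r x|) :
    |∫ x, f x * backDiff s (fun x => η x ^ 2 * (v (x + s) - v x)) x ∂μ| ≤
      (L + 1 / 2) * (∫ x, η x ^ 2 * ‖v (x + s) - v x‖ ^ 2 ∂μ) + 1 / 2 * ∫ x in S, r x ^ 2 ∂μ := by
  have hq0 : ∀ x ∉ S, η x ^ 2 * (v (x + s) - v x) = 0 := fun x hx => by simp [h0 x hx]
  have hq : MemLp (fun x => η x ^ 2 * (v (x + s) - v x)) 2 μ :=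
    h.memLp_mulDiff hS (M := 1) (hη.pow_const 2) (fun x hx => by simp [h0 x hx])
      (fun x => by rw [abs_pow]; exact pow_le_one₀ (abs_nonneg _) (h1 x)) hv
  rw [h.integral_mul_backDiff hS hq0 hf hq, ← integral_indicator hS, ← integral_const_mul,
    ← integral_const_mul]
  have i1 := (h.integrable_sq_mulDiff hS hη h0 h1 hv).const_mul (L + 1 / 2)
  have i2 : Integrable (S.indicator fun x => r x ^ 2) μ :=
    (integrable_indicator_iff hS).2 hr.integrable_sq
  rw [← integral_add i1 (i2.const_mul _), ← Real.norm_eq_abs]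
  refine norm_integral_le_of_norm_le (i1.add (i2.const_mul _)) ?_
  filter_upwards [(ae_restrict_iff' hS).1 hL] with x hx
  by_cases hxS : x ∈ S
  · have hx := hx hxS
    simp only [indicator_of_mem hxS, norm_mul, Real.norm_eq_abs, abs_pow, sq_abs]
    set a := |v (x + s) - v x|
    have ha : 0 ≤ a := abs_nonneg _
    have hb : 0 ≤ |r x| := abs_nonneg _
    have hη1 : η x ^ 2 ≤ 1 := by
      rw [← sq_abs]; exact pow_le_one₀ (abs_nonneg _) (h1 x)
    have hη0 := sq_nonneg (η x)
    have e2 : η x ^ 2 * (|r x| * a) ≤ η x ^ 2 * (1 / 2 * a ^ 2) + 1 / 2 * r x ^ 2 := by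
      rw [← sq_abs (r x)]
      nlinarith [sq_nonneg (a - |r x|), mul_nonneg hη0 (sq_nonneg (a - |r x|)),
        mul_nonneg (sub_nonneg.2 hη1) (sq_nonneg |r x|)]
    have e1 : |f (x + s) - f x| * (η x ^ 2 * a) ≤ (L * a + |r x|) * (η x ^ 2 * a) := by gcongr
    have e3 : (v (x + s) - v x) ^ 2 = a ^ 2 := (sq_abs _).symm
    rw [e3]
    linarith
  · simp [h0 x hxS, hxS]

end Abstract

namespace Problem
variable {d : ℕ} {P : Problem d}

namespace Cutoff

variable {h ε ρ M : ℝ} (c : Cutoff P h ε ρ M)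

lemma measurable_η : Measurable c.η := c.smooth.continuous.measurable

lemma memLp_diffGrad {μ : Measure (E (d + 1))} {s : E (d + 1)} (hμ : ShiftInv μ c.cS s)
    {v : E (d + 1) → ℝ} {G : E (d + 1) → E (d + 1)} (hv : MemLp v 2 μ) (hG : MemLp G 2 μ) :
    MemLp (diffGrad c.ζ s v G) 2 μ :=
  (hμ.memLp_mulDiff c.isOpen_cS.measurableSet c.contDiff_ζ.continuous.measurable
    (fun _ hx => c.ζ_zero hx) c.abs_ζ_le hG).add
    (hμ.memLp_diffSMul c.isOpen_cS.measurableSet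
      (continuous_gradient (c.contDiff_ζ.of_le (by exact_mod_cast le_top))).stronglyMeasurable
      (fun _ hx => c.gradient_ζ_eq_zero hx) c.norm_gradient_ζ_le hv)

/-- The diffusion in the bulk has a sign, up to a term produced by the cut-off. -/
lemma neg_le_integral_diffusion {μ : Measure (E (d + 1))} {s : E (d + 1)}
    (hμ : ShiftInv μ c.cS s)
    {v : E (d + 1) → ℝ} {G : E (d + 1) → E (d + 1)} (hv : MemLp v 2 μ) (hG : MemLp G 2 μ) :
    -(M ^ 2 * ∫ x in c.cS, (v (x + s) - v x) ^ 2 ∂μ) ≤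
      ∫ x, inner ℝ (G x) (backDiff s (diffGrad c.ζ s v G) x) ∂μ := by
  have hS := c.isOpen_cS.measurableSet
  obtain ⟨e, hi⟩ := hμ.integral_inner_backDiff hS (fun _ hx => c.diffGrad_eq_zero hx) hG
    (c.memLp_diffGrad hμ hv hG)
  rw [e, ← integral_const_mul, ← integral_neg, ← integral_indicator hS]
  refine integral_mono_ae ?_ hi (Filter.Eventually.of_forall fun x => ?_)
  · exact (integrable_indicator_iff hS).2
      ((hμ.memLp_shift_sub hS hv).integrable_sq.const_mul _).neg
  · by_cases hx : x ∈ c.cS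
    · simp only [indicator_of_mem hx, diffGrad, inner_add_right, inner_smul_right,
        real_inner_self_eq_norm_sq, c.gradient_ζ]
      have h1 := abs_real_inner_le_norm (G (x + s) - G x) (gradient c.η x)
      have h2 := c.norm_gradient_η_le x
      set a := ‖G (x + s) - G x‖
      set b := v (x + s) - v x
      set i : ℝ := inner ℝ (G (x + s) - G x) (gradient c.η x)
      have h4 : |c.η x * b * i| ≤ |c.η x| * |b| * (a * M) := by
        rw [abs_mul, abs_mul]
        have : 0 ≤ a := norm_nonneg _
        gcongr
        exact h1.trans (by gcongr)
      have h5 : c.ζ x = |c.η x| ^ 2 := by rw [sq_abs]; rfl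
      rw [h5, ← sq_abs b]
      -- Young's inequality, with the cross term `2 η b ⟪a, ∇η⟫` absorbed by `η² |a|²`
      nlinarith [neg_abs_le (c.η x * b * i), sq_nonneg (|c.η x| * a - M * |b|)]
    · simp [hx, c.diffGrad_eq_zero hx]

end Cutoff

end Problem

end

section

/-! ### The terms of the weak formulation, tested with second differences -/

lemma integral_sq_norm_eq {α F : Type*} [MeasurableSpace α] [NormedAddCommGroup F] {μ : Measure α}
    {f : α → F} (hf : MemLp f 2 μ) : ∫ x, ‖f x‖ ^ 2 ∂μ = (eLpNorm f 2 μ).toReal ^ 2 := by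
  rw [← ENNReal.toReal_pow, sq_eLpNorm_two]
  exact integral_eq_lintegral_of_nonneg_ae (Filter.Eventually.of_forall fun x => by positivity)
    (hf.1.norm.pow 2)

namespace Problem
variable {d : ℕ} {P : Problem d}

namespace Cutoff

variable {h ε ρ M : ℝ} (c : Cutoff P h ε ρ M)

/-- The squared norm in the channels of a cut off difference. -/
def chanSq (s : E (d + 1)) {F : Type*} [NormedAddCommGroup F] (v : E (d + 1) → F) : ℝ :=
  ∫ x in P.chan ε, c.η x ^ 2 * ‖v (x + s) - v x‖ ^ 2

/-- The squared norm in a bulk domain of a cut off difference. -/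
def bulkCutSq (s : E (d + 1)) (v : E (d + 1) → ℝ) (b : Bool) : ℝ :=
  ∫ x in P.bulk ε b, c.η x ^ 2 * ‖v (x + s) - v x‖ ^ 2

/-- The squared norm in `𝓛_ε` of a cut off difference. -/
def energy (s : E (d + 1)) (v : E (d + 1) → ℝ) : ℝ :=
  (∑ b, c.bulkCutSq s v b) + ε⁻¹ * c.chanSq s v

/-- The squared norm of a difference on the part of a bulk domain where the cut-off lives. -/
def bulkSq (s : E (d + 1)) (v : E (d + 1) → ℝ) (b : Bool) : ℝ :=
  ∫ x in c.cS, (v (x + s) - v x) ^ 2 ∂volume.restrict (P.bulk ε b)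

/-- The squared norm of the horizontal oscillation of a bulk reaction rate on the part of a bulk
domain where the cut-off lives. -/
def rateSq (s : E (d + 1)) (t : ℝ) (v : E (d + 1) → ℝ) (b : Bool) : ℝ :=
  ∫ x in c.cS, (P.f b t (x + s) (v x) - P.f b t x (v x)) ^ 2 ∂volume.restrict (P.bulk ε b)

/-- `φ` is the cut off second difference of `u`. -/
structure IsTest {hε : 0 < ε} (s : E (d + 1)) (u φ : P.Heps ε hε) : Prop where
  val_eq : val φ =ᵐ[P.wvol ε ε⁻¹] backDiff s fun x => c.η x ^ 2 * (val u (x + s) - val u x)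
  grad_eq : grad φ =ᵐ[P.wvol ε ε] backDiff s (diffGrad c.ζ s (val u) (grad u))

lemma gradient_η_chan (hP : P.Admissible) (hm : P.Margin ρ) (hε : 0 < ε) {x : E (d + 1)}
    (hx : x ∈ P.chan ε) : gradient c.η x = 0 := by
  rw [gradient, c.fderiv_eq_zero hP hm hε hx, map_zero]

variable {hε : 0 < ε} {l : Fin d → ℤ} {u φ : P.Heps ε hε} {t : ℝ}

lemma bulk_diffusion (hP : P.Admissible) (hl : ‖shiftVec ε l‖ ≤ h)
    (hφ : c.IsTest (shiftVec ε l) u φ) (b : Bool) :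
    -(M ^ 2 * c.bulkSq (shiftVec ε l) (val u) b) ≤
      ∫ x in P.bulk ε b, inner ℝ (grad u x) (grad φ x) := by
  refine (c.neg_le_integral_diffusion (c.shiftInv_bulk hP hε hl b) ((memLp_val u).ofWvol b)
    ((memLp_grad u).ofWvol b)).trans_eq (integral_congr_ae ?_)
  filter_upwards [ae_bulk hφ.grad_eq b] with x hx
  rw [hx]

/-- The diffusion in the channels is coercive, without error terms, because the diffusivity is periodic
and the cut-off is constant on each channel. -/
lemma chan_diffusion (hP : P.Admissible) (hm : P.Margin ρ) (hρ : 0 < ρ)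
    (hl : ‖shiftVec ε l‖ ≤ h) (hφ : c.IsTest (shiftVec ε l) u φ) {c₀ : ℝ}
    (hc₀ : ∀ᵐ y ∂volume.restrict P.Zs, ∀ ξ : E (d + 1),
      c₀ * ‖ξ‖ ^ 2 ≤ inner ℝ ((P.DM y).toEuclideanLin ξ) ξ) :
    c₀ * c.chanSq (shiftVec ε l) (grad u) ≤
      ∫ x in P.chan ε, inner ℝ ((P.DM (cellPt ε x)).toEuclideanLin (grad u x)) (grad φ x) := by
  have hG := (memLp_grad u).ofWvol_chan hε
  have hv := (memLp_val u).ofWvol_chan (inv_pos.2 hε)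
  have hS := c.isOpen_cS.measurableSet
  have hμ := c.shiftInv_chan hP hm hρ hε hl
  obtain ⟨e, hi⟩ := hμ.integral_inner_backDiff hS
    (fun _ hx => c.diffGrad_eq_zero hx) (hP.memLp_flux hm hρ hε hG) (c.memLp_diffGrad hμ hv hG)
  have e2 : ∫ x in P.chan ε, inner ℝ ((P.DM (cellPt ε x)).toEuclideanLin (grad u x)) (grad φ x) =
      ∫ x in P.chan ε, inner ℝ ((P.DM (cellPt ε x)).toEuclideanLin (grad u x))
        (backDiff (shiftVec ε l) (diffGrad c.ζ (shiftVec ε l) (val u) (grad u)) x) := by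
    refine integral_congr_ae ?_
    filter_upwards [ae_chan hε hφ.grad_eq] with x hx
    rw [hx]
  rw [e2, e, chanSq, ← integral_const_mul]
  refine integral_mono_ae ((hμ.integrable_sq_mulDiff hS c.measurable_η (fun _ hx => c.η_zero hx)
    c.abs_η_le hG).const_mul c₀) hi ?_
  filter_upwards [hm.ae_cellPt hρ hP hε hc₀, ae_restrict_mem (hP.isOpen_chan hε).measurableSet]
    with x hx hxc
  have hd : gradient c.ζ x = 0 := by
    rw [c.gradient_ζ, c.gradient_η_chan hP hm hε hxc, smul_zero]
  rw [cellPt_add_shiftVec hε, ← map_sub, diffGrad, hd, smul_zero, add_zero, inner_smul_right]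
  have := mul_le_mul_of_nonneg_left (hx (grad u (x + shiftVec ε l) - grad u x)) (c.ζ_nonneg x)
  calc _ = c.ζ x * (c₀ * ‖grad u (x + shiftVec ε l) - grad u x‖ ^ 2) := by
        rw [show c.ζ x = c.η x ^ 2 from rfl]; ring
    _ ≤ _ := this

lemma memLp_rate (hP : P.Admissible) (hl : ‖shiftVec ε l‖ ≤ h) (hε : 0 < ε) (b : Bool)
    (ht : t ∈ Icc 0 P.T) {v : E (d + 1) → ℝ} (hv : MemLp v 2 (volume.restrict (P.bulk ε b))) :
    MemLp (fun x => P.f b t (x + shiftVec ε l) (v x) - P.f b t x (v x)) 2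
      ((volume.restrict (P.bulk ε b)).restrict c.cS) := by
  have := hP.isFiniteMeasure_bulk hε b
  obtain ⟨L, hL⟩ := hP.f_lipschitz b
  refine MemLp.sub ?_ ((hP.memLp_f hε b ht hv).restrict _)
  refine memLp_superposition (π := fun x => x + shiftVec ε l) hP.isCompact_Om
    isClosed_closure.measurableSet (hP.f_contOn b ht) (hL t ht) (by fun_prop) ?_ (hv.restrict _)
  filter_upwards [ae_restrict_mem c.isOpen_cS.measurableSet,
    ae_restrict_of_ae (ae_restrict_mem (hP.isOpen_bulk ε b).measurableSet)] with x h1 h2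
  exact subset_closure (bulk_subset_Om hε b ((c.bulk_shift hε hl b x h1).2 h2))

lemma bulk_reaction (hP : P.Admissible) (hl : ‖shiftVec ε l‖ ≤ h)
    (hφ : c.IsTest (shiftVec ε l) u φ) (ht : t ∈ Icc 0 P.T) (b : Bool) {L : ℝ≥0}
    (hL : ∀ x ∈ closure P.Om, LipschitzWith L (P.f b t x)) :
    ∫ x in P.bulk ε b, P.f b t x (val u x) * val φ x ≤
      (L + 1 / 2) * c.bulkCutSq (shiftVec ε l) (val u) b +
        1 / 2 * c.rateSq (shiftVec ε l) t (val u) b := by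
  have hv := (memLp_val u).ofWvol b
  have hS := c.isOpen_cS.measurableSet
  have hμ := c.shiftInv_bulk hP hε hl b
  have e : ∫ x in P.bulk ε b, P.f b t x (val u x) * val φ x =
      ∫ x in P.bulk ε b, P.f b t x (val u x) * backDiff (shiftVec ε l)
        (fun x => c.η x ^ 2 * (val u (x + shiftVec ε l) - val u x)) x := by
    refine integral_congr_ae ?_
    filter_upwards [ae_bulk hφ.val_eq b] with x hx
    rw [hx]
  rw [e]
  refine (le_abs_self _).trans (hμ.abs_integral_mul_backDiff_le hS c.measurable_η
    (fun _ hx => c.η_zero hx) c.abs_η_le (hP.memLp_f hε b ht hv) hv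
    (c.memLp_rate hP hl hε b ht hv) ?_)
  filter_upwards [ae_restrict_mem hS,
    ae_restrict_of_ae (ae_restrict_mem (hP.isOpen_bulk ε b).measurableSet)] with x h1 h2
  have hx := subset_closure (bulk_subset_Om hε b ((c.bulk_shift hε hl b x h1).2 h2))
  have := (hL _ hx).dist_le_mul (val u (x + shiftVec ε l)) (val u x)
  rw [Real.dist_eq, Real.dist_eq] at this
  refine le_trans ?_ (add_le_add_left this _)
  exact (abs_sub_le _ (P.f b t (x + shiftVec ε l) (val u x)) _)

lemma chan_reaction (hP : P.Admissible) (hm : P.Margin ρ) (hρ : 0 < ρ)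
    (hl : ‖shiftVec ε l‖ ≤ h) (hφ : c.IsTest (shiftVec ε l) u φ) (ht : t ∈ Icc 0 P.T) {L : ℝ≥0}
    (hL : ∀ y ∈ closure P.Zs, LipschitzWith L (P.g t y)) :
    ∫ x in P.chan ε, P.g t (cellPt ε x) (val u x) * val φ x ≤
      (L + 1 / 2) * c.chanSq (shiftVec ε l) (val u) := by
  have hε' : 0 < ε⁻¹ := inv_pos.2 hε
  have hv := (memLp_val u).ofWvol_chan hε'
  have hS := c.isOpen_cS.measurableSet
  have hμ := c.shiftInv_chan hP hm hρ hε hl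
  have e : ∫ x in P.chan ε, P.g t (cellPt ε x) (val u x) * val φ x =
      ∫ x in P.chan ε, P.g t (cellPt ε x) (val u x) * backDiff (shiftVec ε l)
        (fun x => c.η x ^ 2 * (val u (x + shiftVec ε l) - val u x)) x := by
    refine integral_congr_ae ?_
    filter_upwards [ae_chan hε' hφ.val_eq] with x hx
    rw [hx]
  rw [e]
  refine (le_abs_self _).trans ((hμ.abs_integral_mul_backDiff_le hS c.measurable_η
    (fun _ hx => c.η_zero hx) c.abs_η_le (hP.memLp_g hm hρ hε ht hv) hv
    (r := fun _ => 0) (L := L) MemLp.zero' ?_).trans (by simp [chanSq]))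
  filter_upwards [ae_restrict_of_ae (ae_restrict_mem (hP.isOpen_chan hε).measurableSet)] with x hx
  rw [cellPt_add_shiftVec hε, abs_zero, add_zero, ← Real.dist_eq, ← Real.dist_eq]
  exact (hL _ (subset_closure (hm.cellPt_mem hρ hε subset_closure hx))).dist_le_mul _ _

/-- The lateral boundary term is controlled by the trace of the cut off difference of `u`. -/
lemma boundary_reaction (hP : P.Admissible) (hm : P.Margin ρ) (hρ : 0 < ρ)
    (hl : ‖shiftVec ε l‖ ≤ h) (hφ : c.IsTest (shiftVec ε l) u φ) (ht : t ∈ Icc 0 P.T) {L : ℝ≥0}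
    (hL : ∀ y ∈ closure (lateral P.Zs), LipschitzWith L (P.hN t y)) (h1 : HasTrace u)
    (h2 : HasTrace φ) :
    |∫ x in P.chanN ε, P.hN t (cellPt ε x) (trN u x) * trN φ x ∂μHE[d]| ≤
      (L + 1 / 2) * ∫ x in P.chanN ε,
        c.η x ^ 2 * ‖trN u (x + shiftVec ε l) - trN u x‖ ^ 2 ∂μHE[d] := by
  have hS := c.isOpen_cS.measurableSet
  have hN := c.shiftInv_chanN hm hρ hε hl
  have hU := c.shiftInv_chan hP hm hρ hε hl
  have hUm := (hP.isOpen_chan hε).measurableSet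
  have hUS : ∀ x ∈ c.cS, (x + shiftVec ε l ∈ P.chan ε ↔ x ∈ P.chan ε) :=
    c.copies_shift hm hρ hε hl subset_closure
  have hb : MemLp (trN u) 2 (μHE[d].restrict (P.chanN ε)) := h1.isTrace.1
  have hdζ : ∀ x ∈ P.chan ε, gradient c.ζ x = 0 := fun x hx => by
    rw [c.gradient_ζ, c.gradient_η_chan hP hm hε hx, smul_zero]
  have htr := h1.isTrace.backDiff_mulDiff hS hUm hUS hU hN c.contDiff_ζ
    (fun _ hx => c.ζ_zero hx) (fun _ hx => c.gradient_ζ_eq_zero hx) c.abs_ζ_le hdζ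
    (aestronglyMeasurable_val u) (aestronglyMeasurable_grad u)
  have hg : ∀ x ∈ P.chan ε, backDiff (shiftVec ε l)
      (diffGrad c.ζ (shiftVec ε l) (val u) (grad u)) x = backDiff (shiftVec ε l)
        (fun x => c.ζ x • (grad u (x + shiftVec ε l) - grad u x)) x := by
    intro x hx
    have hg' : ∀ y, gradient c.ζ y = 0 → diffGrad c.ζ (shiftVec ε l) (val u) (grad u) y =
        c.ζ y • (grad u (y + shiftVec ε l) - grad u y) := fun y hy => by
      rw [diffGrad, hy, smul_zero, add_zero]
    rw [backDiff, backDiff, hg' x (hdζ x hx), hg' (x - shiftVec ε l)]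
    by_cases hy : x - shiftVec ε l ∈ c.cS
    · refine hdζ _ ((hUS _ hy).1 ?_)
      rwa [sub_add_cancel]
    · exact c.gradient_ζ_eq_zero hy
  have hgc : grad φ =ᵐ[volume.restrict (P.chan ε)] backDiff (shiftVec ε l)
        (fun x => c.ζ x • (grad u (x + shiftVec ε l) - grad u x)) := by
    filter_upwards [ae_chan hε hφ.grad_eq, ae_restrict_mem hUm] with x hx hxc
    rw [hx, hg x hxc]
  have hvc := ae_chan (inv_pos.2 hε) hφ.val_eq
  have hb' := hP.isTrace_unique hm hρ hε (aestronglyMeasurable_val φ)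
    (aestronglyMeasurable_grad φ) h2.isTrace (htr.congr hvc hgc (Filter.EventuallyEq.refl _ _))
  have e : ∫ x in P.chanN ε, P.hN t (cellPt ε x) (trN u x) * trN φ x ∂μHE[d] =
      ∫ x in P.chanN ε, P.hN t (cellPt ε x) (trN u x) * backDiff (shiftVec ε l)
        (fun x => c.η x ^ 2 * (trN u (x + shiftVec ε l) - trN u x)) x ∂μHE[d] := by
    refine integral_congr_ae ?_
    filter_upwards [hb'] with x hx
    rw [hx]
    rfl
  rw [e]
  refine (hN.abs_integral_mul_backDiff_le hS c.measurable_η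
    (fun _ hx => c.η_zero hx) c.abs_η_le (hP.memLp_hN hm hρ hε ht hb) hb
    (r := fun _ => 0) (L := L) MemLp.zero' ?_).trans (by simp)
  filter_upwards [ae_restrict_of_ae (ae_restrict_mem (measurableSet_chanN hε))] with x hx
  rw [cellPt_add_shiftVec hε, abs_zero, add_zero, ← Real.dist_eq, ← Real.dist_eq]
  exact (hL _ (subset_closure (hm.cellPt_mem hρ hε lateral_subset_closure hx))).dist_le_mul _ _

/-- The trace inequality for the cut off difference of `u`.  The cut-off does not contribute to the
gradient, because it is constant on each channel. -/
lemma trace_diff_le (hP : P.Admissible) (hm : P.Margin ρ) (hρ : 0 < ρ)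
    (hl : ‖shiftVec ε l‖ ≤ h) (h1 : HasTrace u) {A B : ℝ} (hA : 0 ≤ A) (hB : 0 ≤ B)
    (hAB : ∀ v G b, AEStronglyMeasurable v (volume.restrict (P.chan ε)) →
      AEStronglyMeasurable G (volume.restrict (P.chan ε)) →
      IsTrace (P.chan ε) (P.chanN ε) v G b →
      eLpNorm b 2 (μHE[d].restrict (P.chanN ε)) ≤
        ENNReal.ofReal A * eLpNorm v 2 (volume.restrict (P.chan ε)) +
        ENNReal.ofReal B * eLpNorm G 2 (volume.restrict (P.chan ε))) :
    ∫ x in P.chanN ε, c.η x ^ 2 * ‖trN u (x + shiftVec ε l) - trN u x‖ ^ 2 ∂μHE[d] ≤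
      2 * A ^ 2 * c.chanSq (shiftVec ε l) (val u) +
        2 * B ^ 2 * c.chanSq (shiftVec ε l) (grad u) := by
  have hS := c.isOpen_cS.measurableSet
  have hN := c.shiftInv_chanN hm hρ hε hl
  have hU := c.shiftInv_chan hP hm hρ hε hl
  have hG := (memLp_grad u).ofWvol_chan hε
  have hv := (memLp_val u).ofWvol_chan (inv_pos.2 hε)
  have hη0 : ∀ x ∉ c.cS, c.η x = 0 := fun _ hx => c.η_zero hx
  have hb : MemLp (trN u) 2 (μHE[d].restrict (P.chanN ε)) := h1.isTrace.1
  have htr := h1.isTrace.mulDiff hS (hP.isOpen_chan hε).measurableSet hU hN c.smooth hη0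
    c.abs_η_le (fun x hx => c.gradient_η_chan hP hm hε hx)
    (aestronglyMeasurable_val u) (aestronglyMeasurable_grad u)
  have hG' := hU.memLp_mulDiff hS c.measurable_η hη0 c.abs_η_le hG
  have hv' := hU.memLp_mulDiff hS c.measurable_η hη0 c.abs_η_le hv
  have hb' := hN.memLp_mulDiff hS c.measurable_η hη0 c.abs_η_le hb
  have key := hAB _ _ _ hv'.1 hG'.1 htr
  have eN : ∀ {F : Type} [NormedAddCommGroup F] [NormedSpace ℝ F] (w : E (d + 1) → F)
      (x : E (d + 1)), c.η x ^ 2 * ‖w (x + shiftVec ε l) - w x‖ ^ 2 =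
        ‖c.η x • (w (x + shiftVec ε l) - w x)‖ ^ 2 := fun w x => by
    rw [norm_smul, mul_pow, Real.norm_eq_abs, sq_abs]
  simp only [chanSq, eN]
  rw [integral_sq_norm_eq hG', integral_sq_norm_eq hv', integral_sq_norm_eq hb']
  have hfin : ENNReal.ofReal A * eLpNorm (fun x => c.η x • (val u (x + shiftVec ε l) - val u x)) 2
      (volume.restrict (P.chan ε)) ≠ ⊤ := ENNReal.mul_ne_top ENNReal.ofReal_ne_top hv'.2.ne
  have hfin' : ENNReal.ofReal B * eLpNorm (fun x => c.η x •
      (grad u (x + shiftVec ε l) - grad u x)) 2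
      (volume.restrict (P.chan ε)) ≠ ⊤ := ENNReal.mul_ne_top ENNReal.ofReal_ne_top hG'.2.ne
  have key' := ENNReal.toReal_mono (ENNReal.add_ne_top.2 ⟨hfin, hfin'⟩) key
  rw [ENNReal.toReal_add hfin hfin', ENNReal.toReal_mul, ENNReal.toReal_mul,
    ENNReal.toReal_ofReal hA, ENNReal.toReal_ofReal hB] at key'
  set a := (eLpNorm (fun x => c.η x • (val u (x + shiftVec ε l) - val u x)) 2
      (volume.restrict (P.chan ε))).toReal
  set b := (eLpNorm (fun x => c.η x • (grad u (x + shiftVec ε l) - grad u x)) 2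
      (volume.restrict (P.chan ε))).toReal
  refine (pow_le_pow_left₀ ENNReal.toReal_nonneg key' 2).trans ?_
  nlinarith [sq_nonneg (A * a - B * b)]

end Cutoff

end Problem

end

section

/-! ### The differential inequality for the differences -/

namespace Problem
variable {d : ℕ} {P : Problem d}

namespace Cutoff

variable {h ε ρ M : ℝ} (c : Cutoff P h ε ρ M)

lemma chanSq_nonneg (s : E (d + 1)) {F : Type*} [NormedAddCommGroup F] (v : E (d + 1) → F) :
    0 ≤ c.chanSq s v := integral_nonneg fun _ => by positivity

lemma bulkCutSq_nonneg (s : E (d + 1)) (v : E (d + 1) → ℝ) (b : Bool) :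
    0 ≤ c.bulkCutSq s v b := integral_nonneg fun _ => by positivity

lemma bulkSq_nonneg (s : E (d + 1)) (v : E (d + 1) → ℝ) (b : Bool) :
    0 ≤ c.bulkSq s v b := integral_nonneg fun _ => by positivity

lemma rateSq_nonneg (s : E (d + 1)) (t : ℝ) (v : E (d + 1) → ℝ) (b : Bool) :
    0 ≤ c.rateSq s t v b := integral_nonneg fun _ => by positivity

lemma energy_nonneg (hε : 0 < ε) (s : E (d + 1)) (v : E (d + 1) → ℝ) : 0 ≤ c.energy s v :=
  add_nonneg (Finset.sum_nonneg fun b _ => c.bulkCutSq_nonneg s v b)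
    (mul_nonneg (inv_pos.2 hε).le (c.chanSq_nonneg s v))

end Cutoff

/-- The differential inequality for the cut off differences.  The parameter in the trace inequality
is chosen so that the gradient part of the boundary term is absorbed by the diffusion. -/
lemma Admissible.exists_tested_le (hP : P.Admissible) {ρ : ℝ} (hm : P.Margin ρ) (hρ : 0 < ρ)
    (h M : ℝ) : ∃ C c₀ : ℝ, 0 ≤ C ∧ 0 < c₀ ∧ ∀ (ε : ℝ) (hε : 0 < ε) (c : Cutoff P h ε ρ M)
      (l : Fin d → ℤ), ‖shiftVec ε l‖ ≤ h → ∀ t ∈ Icc 0 P.T, ∀ u φ : P.Heps ε hε,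
      c.IsTest (shiftVec ε l) u φ → ∀ β, IsBoundaryTerm t u φ β → ∀ W : ℝ,
      W + P.volForm t u φ + β = 0 →
      W + c₀ * (ε * c.chanSq (shiftVec ε l) (grad u)) ≤
        C * (c.energy (shiftVec ε l) (val u) + (∑ b, c.bulkSq (shiftVec ε l) (val u) b) +
          ∑ b, c.rateSq (shiftVec ε l) t (val u) b) := by
  obtain ⟨c₀, hc₀, hco⟩ := hP.DM_coercive
  choose Lf hLf using hP.f_lipschitz
  obtain ⟨Lg, hLg⟩ := hP.g_lipschitz
  obtain ⟨Lh, hLh⟩ := hP.hN_lipschitz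
  -- the trace inequality yields `2 θ² ε ‖η ∇δu‖²`, which `c₀ / 2` times the diffusion is to absorb
  set θ : ℝ := √(c₀ / (4 * (Lh + 1 / 2)))
  have hθ2 : θ ^ 2 = c₀ / (4 * (Lh + 1 / 2)) := Real.sq_sqrt (by positivity)
  have hθ : 0 < θ := Real.sqrt_pos.2 (by positivity)
  obtain ⟨Cθ, hCθ, htr⟩ := hP.exists_isTrace_le hm hρ θ hθ
  set K : ℝ := (Lg + 1 / 2) + (Lh + 1 / 2) * (2 * Cθ ^ 2)
  set C : ℝ := 1 / 2 + (∑ b, ((Lf b : ℝ) + 1 / 2)) + (∑ b, P.D b * M ^ 2) + K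
  have hD := fun b => (hP.D_pos b).le
  have hK : 0 ≤ K := by positivity
  have hCf : ∀ b, (Lf b : ℝ) + 1 / 2 ≤ C := fun b => by
    have h1 := Finset.single_le_sum (f := fun b => (Lf b : ℝ) + 1 / 2)
      (fun b _ => by positivity) (Finset.mem_univ b)
    have h2 : 0 ≤ ∑ b, P.D b * M ^ 2 := Finset.sum_nonneg fun b _ =>
      mul_nonneg (hD b) (sq_nonneg M)
    simp only [C]
    linarith
  have hCD : ∀ b, P.D b * M ^ 2 ≤ C := fun b => by
    have h1 := Finset.single_le_sum (f := fun b => P.D b * M ^ 2)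
      (fun b _ => mul_nonneg (hD b) (sq_nonneg M)) (Finset.mem_univ b)
    have h2 : 0 ≤ ∑ b, ((Lf b : ℝ) + 1 / 2) := Finset.sum_nonneg fun b _ => by positivity
    simp only [C]
    linarith
  have h1 : 0 ≤ ∑ b, ((Lf b : ℝ) + 1 / 2) := Finset.sum_nonneg fun b _ => by positivity
  have h2 : 0 ≤ ∑ b, P.D b * M ^ 2 := Finset.sum_nonneg fun b _ =>
      mul_nonneg (hD b) (sq_nonneg M)
  have hCK : K ≤ C := by simp only [C]; linarith
  have hCh : 1 / 2 ≤ C := by simp only [C]; linarith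
  refine ⟨C, c₀ / 2, by linarith, by positivity, ?_⟩
  intro ε hε c l hl t ht u φ hφ β hβ W hW
  set s := shiftVec ε l
  set V := c.chanSq s (val u)
  set X := c.chanSq s (grad u)
  have hV : 0 ≤ V := c.chanSq_nonneg _ _
  have hX : 0 ≤ X := c.chanSq_nonneg _ _
  -- the boundary term
  have hβ' : -β ≤ (Lh + 1 / 2) * (2 * Cθ ^ 2) * (ε⁻¹ * V) + c₀ / 2 * (ε * X) := by
    rcases hβ with rfl | ⟨h1, h2, rfl⟩
    · rw [neg_zero]; positivity
    · refine (neg_le_abs _).trans ((c.boundary_reaction hP hm hρ hl hφ ht (hLh t ht) h1 h2).trans ?_)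
      have hb := c.trace_diff_le hP hm hρ hl h1 (div_nonneg hCθ (Real.sqrt_nonneg ε))
        (mul_nonneg hθ.le (Real.sqrt_nonneg ε)) (htr ε hε)
      rw [div_pow, mul_pow, Real.sq_sqrt hε.le, hθ2] at hb
      refine (mul_le_mul_of_nonneg_left hb (by positivity)).trans_eq ?_
      have : (Lh : ℝ) + 1 / 2 ≠ 0 := by positivity
      simp only [V, X, s]
      field_simp
      ring
  -- the remaining terms
  have hdiff := mul_le_mul_of_nonneg_left (c.chan_diffusion hP hm hρ hl hφ hco) hε.le
  have hg := mul_le_mul_of_nonneg_left (c.chan_reaction hP hm hρ hl hφ ht (hLg t ht))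
    (inv_pos.2 hε).le
  have hbd : -(∑ b, P.D b * M ^ 2 * c.bulkSq s (val u) b) ≤
      ∑ b, P.D b * (∫ x in P.bulk ε b, inner ℝ (grad u x) (grad φ x)) := by
    rw [← Finset.sum_neg_distrib]
    refine Finset.sum_le_sum fun b _ => ?_
    have := mul_le_mul_of_nonneg_left (c.bulk_diffusion hP hl hφ b) (hD b)
    linarith
  have hf : (∑ b, ∫ x in P.bulk ε b, P.f b t x (val u x) * val φ x) ≤
      ∑ b, ((Lf b + 1 / 2) * c.bulkCutSq s (val u) b + 1 / 2 * c.rateSq s t (val u) b) :=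
    Finset.sum_le_sum fun b _ => c.bulk_reaction hP hl hφ ht b (hLf b t ht)
  have hf' : ∑ b, ((Lf b + 1 / 2) * c.bulkCutSq s (val u) b + 1 / 2 * c.rateSq s t (val u) b) ≤
      C * ∑ b, c.bulkCutSq s (val u) b + C * ∑ b, c.rateSq s t (val u) b := by
    rw [Finset.mul_sum, Finset.mul_sum, ← Finset.sum_add_distrib]
    refine Finset.sum_le_sum fun b _ => add_le_add ?_ ?_
    · exact mul_le_mul_of_nonneg_right (hCf b) (c.bulkCutSq_nonneg _ _ _)
    · exact mul_le_mul_of_nonneg_right hCh (c.rateSq_nonneg _ _ _ _)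
  have hbd' : ∑ b, P.D b * M ^ 2 * c.bulkSq s (val u) b ≤ C * ∑ b, c.bulkSq s (val u) b := by
    rw [Finset.mul_sum]
    exact Finset.sum_le_sum fun b _ =>
      mul_le_mul_of_nonneg_right (hCD b) (c.bulkSq_nonneg _ _ _)
  have hVC : K * (ε⁻¹ * V) ≤ C * (ε⁻¹ * V) := mul_le_mul_of_nonneg_right hCK (by positivity)
  have hKV : K * (ε⁻¹ * V) = ε⁻¹ * ((Lg + 1 / 2) * V) +
      (Lh + 1 / 2) * (2 * Cθ ^ 2) * (ε⁻¹ * V) := by simp only [K]; ring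
  rw [volForm] at hW
  rw [Cutoff.energy]
  linarith

end Problem

end

section

/-! ### Grönwall's inequality for an energy balance -/

/-- An integrable function is integrated against an upper bound that need not be measurable. -/
lemma integral_le_toReal_lintegral {α : Type*} [MeasurableSpace α] {μ : Measure α} {A : α → ℝ}
    {Q : α → ℝ≥0∞} (hA : Integrable A μ) (h : ∀ᵐ t ∂μ, ENNReal.ofReal (A t) ≤ Q t)
    (hQ : ∫⁻ t, Q t ∂μ ≠ ⊤) : ∫ t, A t ∂μ ≤ (∫⁻ t, Q t ∂μ).toReal := by
  refine (integral_mono hA hA.pos_part fun t => le_max_left (A t) 0).trans ?_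
  rw [integral_eq_lintegral_of_nonneg_ae (f := fun t => max (A t) 0)
    (Filter.Eventually.of_forall fun t => le_max_right _ _) hA.pos_part.1]
  refine ENNReal.toReal_mono hQ (lintegral_mono_ae (h.mono fun t ht => ?_))
  rcases le_total 0 (A t) with h0 | h0
  · rwa [max_eq_left h0]
  · simp [max_eq_right h0]

/-- Grönwall's inequality for an energy balance, with a dissipation term `X` and a source that is
integrated over the whole time interval. -/
lemma energy_dissipation_le {T C : ℝ} (hT : 0 < T) (hC : 0 ≤ C) {e X w : ℝ → ℝ}
    {Q : ℝ → ℝ≥0∞} (he : Continuous e) (he0 : ∀ t, 0 ≤ e t) (hX0 : ∀ t, 0 ≤ X t)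
    (hX : IntegrableOn X (Ioo 0 T)) (hw : IntegrableOn w (Ioo 0 T))
    (hbal : ∀ a b, 0 < a → a ≤ b → b < T → e b - e a = 2 * ∫ t in a..b, w t)
    (hle : ∀ᵐ t ∂volume.restrict (Ioo 0 T), ENNReal.ofReal (w t + X t - C * e t) ≤ Q t)
    (hQ : ∫⁻ t in Ioo 0 T, Q t ≠ ⊤) :
    (∀ t ∈ Ioo 0 T, e t ≤ (e 0 + 2 * (∫⁻ t in Ioo 0 T, Q t).toReal) * Real.exp (2 * C * T)) ∧
      ∫ t in Ioo 0 T, X t ≤ (e 0 + 2 * (∫⁻ t in Ioo 0 T, Q t).toReal) *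
        (1 + 2 * C * T * Real.exp (2 * C * T)) := by
  set q := (∫⁻ t in Ioo 0 T, Q t).toReal
  have hq : 0 ≤ q := ENNReal.toReal_nonneg
  have hwI : ∀ b ∈ Icc 0 T, IntervalIntegrable w volume 0 b := fun b hb => by
    rw [intervalIntegrable_iff_integrableOn_Ioo_of_le hb.1]
    exact hw.mono_set (Ioo_subset_Ioo_right hb.2)
  have hXI : ∀ b ∈ Icc 0 T, IntervalIntegrable X volume 0 b := fun b hb => by
    rw [intervalIntegrable_iff_integrableOn_Ioo_of_le hb.1]
    exact hX.mono_set (Ioo_subset_Ioo_right hb.2)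
  have hTT : T ∈ Icc 0 T := ⟨hT.le, le_rfl⟩
  -- the balance extends to the closed interval by continuity
  have hbal0 : ∀ b ∈ Icc 0 T, e b - e 0 = 2 * ∫ t in (0 : ℝ)..b, w t := by
    have hcont : ContinuousOn (fun b => e b - 2 * ∫ t in (0 : ℝ)..b, w t) (Icc 0 T) := by
      refine he.continuousOn.sub (continuousOn_const.mul ?_)
      have := intervalIntegral.continuousOn_primitive_interval'
        (hwI T hTT) (left_mem_uIcc)
      rwa [uIcc_of_le hT.le] at this
    have heq : EqOn (fun b => e b - 2 * ∫ t in (0 : ℝ)..b, w t)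
        (fun _ => e (T / 2) - 2 * ∫ t in (0 : ℝ)..(T / 2), w t) (Ioo 0 T) := by
      have hmid : T / 2 ∈ Ioo 0 T := ⟨by linarith, by linarith⟩
      have hab : ∀ a b, a ∈ Ioo 0 T → b ∈ Ioo 0 T → a ≤ b →
          e b - 2 * (∫ t in (0 : ℝ)..b, w t) = e a - 2 * ∫ t in (0 : ℝ)..a, w t := by
        intro a b ha hb hab
        have h1 := hbal a b ha.1 hab hb.2
        have h2 := intervalIntegral.integral_interval_sub_left
          (hwI b (Ioo_subset_Icc_self hb)) (hwI a (Ioo_subset_Icc_self ha))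
        linarith
      intro b hb
      rcases le_total b (T / 2) with h | h
      · exact (hab b _ hb hmid h).symm
      · exact hab _ b hmid hb h
    have heq' := heq.of_subset_closure hcont continuousOn_const Ioo_subset_Icc_self
      (closure_Ioo hT.ne).ge
    intro b hb
    have h1 := heq' hb
    have h2 := heq' (left_mem_Icc.2 hT.le)
    simp only [intervalIntegral.integral_same, mul_zero] at h1 h2
    linarith
  have hmain : ∀ b ∈ Icc 0 T, e b + 2 * (∫ t in (0 : ℝ)..b, X t) ≤
      (e 0 + 2 * q) + 2 * C * ∫ t in (0 : ℝ)..b, e t := by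
    intro b hb
    have heI : IntervalIntegrable e volume 0 b := he.intervalIntegrable _ _
    have h1 : ∫ t in (0 : ℝ)..b, (w t + X t - C * e t) ≤ q := by
      rw [intervalIntegral.integral_of_le hb.1, integral_Ioc_eq_integral_Ioo]
      have hsub : Ioo 0 b ⊆ Ioo 0 T := Ioo_subset_Ioo_right hb.2
      refine (integral_le_toReal_lintegral (Q := Q) ?_ (ae_restrict_of_ae_restrict_of_subset hsub hle)
        (ne_top_of_le_ne_top hQ (lintegral_mono_set hsub))).trans
        (ENNReal.toReal_mono hQ (lintegral_mono_set hsub))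
      have := ((hwI b hb).add (hXI b hb)).sub (heI.const_mul C)
      rwa [intervalIntegrable_iff_integrableOn_Ioo_of_le hb.1] at this
    rw [intervalIntegral.integral_sub ((hwI b hb).add (hXI b hb)) (heI.const_mul C),
      intervalIntegral.integral_add (hwI b hb) (hXI b hb),
      intervalIntegral.integral_const_mul] at h1
    have h2 := hbal0 b hb
    linarith
  have hA : 0 ≤ e 0 + 2 * q := add_nonneg (he0 0) (by positivity)
  have hgr : ∀ t ∈ Ioo 0 T, e t ≤ (e 0 + 2 * q) * Real.exp (2 * C * t) := fun t ht => by
    refine le_mul_exp_of_le_add_integral he (by positivity) (fun b hb => ?_) ht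
    have h1 := hmain b (Ioo_subset_Icc_self hb)
    have h2 : 0 ≤ ∫ t in (0 : ℝ)..b, X t :=
      intervalIntegral.integral_nonneg hb.1.le fun t _ => hX0 t
    linarith
  have hgr' : ∀ t ∈ Ioo 0 T, e t ≤ (e 0 + 2 * q) * Real.exp (2 * C * T) := fun t ht =>
    (hgr t ht).trans (by gcongr; exact ht.2.le)
  refine ⟨hgr', ?_⟩
  have h1 := hmain T hTT
  have h2 : ∫ t in (0 : ℝ)..T, e t ≤ ∫ _t in (0 : ℝ)..T, (e 0 + 2 * q) * Real.exp (2 * C * T) := by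
    refine intervalIntegral.integral_mono_on_of_le_Ioo hT.le (he.intervalIntegrable _ _)
      (by simp) hgr'
  rw [intervalIntegral.integral_const, sub_zero, smul_eq_mul] at h2
  have h3 : ∫ t in Ioo 0 T, X t = ∫ t in (0 : ℝ)..T, X t := by
    rw [intervalIntegral.integral_of_le hT.le, integral_Ioc_eq_integral_Ioo]
  have h4 : 0 ≤ ∫ t in (0 : ℝ)..T, X t :=
    intervalIntegral.integral_nonneg hT.le fun t _ => hX0 t
  have h5 := mul_le_mul_of_nonneg_left h2 (show 0 ≤ 2 * C by positivity)
  rw [h3]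
  nlinarith [he0 T]

end

section

/-! ### Continuity in time of the oscillation of the reaction rates -/

namespace Problem
variable {d : ℕ} {P : Problem d}

/-- A bound for the bulk reaction rates that is uniform in time and space. -/
lemma Admissible.exists_f_bound (hP : P.Admissible) (b : Bool) {L : ℝ≥0}
    (hL : ∀ t ∈ Icc 0 P.T, ∀ x ∈ closure P.Om, LipschitzWith L (P.f b t x)) :
    ∃ B : ℝ, ∀ t ∈ Icc 0 P.T, ∀ x ∈ closure P.Om, ∀ z, |P.f b t x z| ≤ B + L * |z| := by
  have hK : IsCompact (Icc 0 P.T ×ˢ closure P.Om) := isCompact_Icc.prod hP.isCompact_Om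
  obtain ⟨B, hB⟩ := exists_abs_le_of_lipschitz (F := fun p : ℝ × E (d + 1) => P.f b p.1 p.2) hK
    ((hP.f_cont b).comp (f := fun p : (ℝ × E (d + 1)) × ℝ => (p.1.1, p.1.2, p.2)) (by fun_prop)
      fun p hp => ⟨hp.1.1, hp.1.2, mem_univ _⟩) (fun p hp => hL _ hp.1 _ hp.2)
  exact ⟨B, fun t ht x hx z => hB (t, x) ⟨ht, hx⟩ z⟩

namespace Cutoff

variable {h ε ρ M : ℝ} (c : Cutoff P h ε ρ M)
variable {l : Fin d → ℤ}

/-- The oscillation of the reaction rates at a fixed function depends continuously on time. -/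
lemma continuousOn_rateSq_left (hP : P.Admissible) (hε : 0 < ε) (hl : ‖shiftVec ε l‖ ≤ h)
    (b : Bool) {v : E (d + 1) → ℝ} (hv : MemLp v 2 (volume.restrict (P.bulk ε b))) :
    ContinuousOn (fun t => c.rateSq (shiftVec ε l) t v b) (Icc 0 P.T) := by
  have := hP.isFiniteMeasure_bulk hε b
  obtain ⟨L, hL⟩ := hP.f_lipschitz b
  obtain ⟨B, hB⟩ := hP.exists_f_bound b hL
  have hmem : ∀ᵐ x ∂(volume.restrict (P.bulk ε b)).restrict c.cS,
      x ∈ closure P.Om ∧ x + shiftVec ε l ∈ closure P.Om := by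
    filter_upwards [ae_restrict_mem c.isOpen_cS.measurableSet,
      ae_restrict_of_ae (ae_restrict_mem (hP.isOpen_bulk ε b).measurableSet)] with x h1 h2
    exact ⟨subset_closure (bulk_subset_Om hε b h2),
      subset_closure (bulk_subset_Om hε b ((c.bulk_shift hε hl b x h1).2 h2))⟩
  have hdom : MemLp (fun x => 2 * (B + L * |v x|)) 2
      ((volume.restrict (P.bulk ε b)).restrict c.cS) :=
    (((memLp_const B).add (hv.norm.const_mul (L : ℝ))).const_mul 2).restrict _
  refine continuousOn_of_dominated (bound := fun x => (2 * (B + L * |v x|)) ^ 2)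
    (fun t ht => ((c.memLp_rate hP hl hε b ht hv).1.pow 2)) (fun t ht => ?_)
    hdom.integrable_sq ?_
  · filter_upwards [hmem] with x hx
    rw [norm_pow, Real.norm_eq_abs]
    refine pow_le_pow_left₀ (abs_nonneg _) ((abs_sub _ _).trans ?_) 2
    have h1 := hB t ht _ hx.1 (v x)
    have h2 := hB t ht _ hx.2 (v x)
    linarith
  · filter_upwards [hmem] with x hx
    have hc : ∀ y ∈ closure P.Om, ContinuousOn (fun t => P.f b t y (v x)) (Icc 0 P.T) :=
      fun y hy => (hP.f_cont b).comp (f := fun t : ℝ => (t, y, v x)) (by fun_prop)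
        fun t ht => ⟨ht, hy, mem_univ _⟩
    exact ((hc _ hx.2).sub (hc _ hx.1)).pow 2

/-- The oscillation of the reaction rates along a continuous curve in `𝓛_ε` depends continuously on
time. -/
lemma continuousOn_rateSq (hP : P.Admissible) (hε : 0 < ε) (hl : ‖shiftVec ε l‖ ≤ h)
    (b : Bool) {v : ℝ → P.Leps ε} (hv : ContinuousOn v (Icc 0 P.T)) :
    ContinuousOn (fun t => c.rateSq (shiftVec ε l) t (v t) b) (Icc 0 P.T) := by
  obtain ⟨L, hL⟩ := hP.f_lipschitz b
  set ν := (volume.restrict (P.bulk ε b)).restrict c.cS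
  have hw : ∀ w : P.Leps ε, MemLp w 2 (volume.restrict (P.bulk ε b)) := fun w =>
    (Lp.memLp w).ofWvol b
  have hν : ν ≤ (1 : ℝ≥0∞) • P.wvol ε ε⁻¹ :=
    Measure.restrict_le_self.trans (P.bulk_le_wvol ε ε⁻¹ b)
  obtain ⟨R, hR⟩ := exists_clm_restrict (F := ℝ) ENNReal.one_ne_top hν
  have hr := fun (t : ℝ) (ht : t ∈ Icc 0 P.T) (w : P.Leps ε) => c.memLp_rate hP hl hε b ht (hw w)
  have hmem : ∀ᵐ x ∂ν, x ∈ closure P.Om ∧ x + shiftVec ε l ∈ closure P.Om := by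
    filter_upwards [ae_restrict_mem c.isOpen_cS.measurableSet,
      ae_restrict_of_ae (ae_restrict_mem (hP.isOpen_bulk ε b).measurableSet)] with x h1 h2
    exact ⟨subset_closure (bulk_subset_Om hε b h2),
      subset_closure (bulk_subset_Om hε b ((c.bulk_shift hε hl b x h1).2 h2))⟩
  have hsq : ∀ t (ht : t ∈ Icc 0 P.T) (w : P.Leps ε),
      √(c.rateSq (shiftVec ε l) t w b) = ‖(hr t ht w).toLp‖ := fun t ht w => by
    have := integral_sq_norm_eq (hr t ht w)
    simp only [Real.norm_eq_abs, sq_abs] at this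
    rw [rateSq, this, Real.sqrt_sq ENNReal.toReal_nonneg, Lp.norm_toLp]
  have hlip : ∀ t ∈ Icc 0 P.T, LipschitzOnWith (2 * L * ‖R‖₊)
      (fun w : P.Leps ε => √(c.rateSq (shiftVec ε l) t w b)) univ := by
    intro t ht
    refine (LipschitzWith.of_dist_le_mul fun w w' => ?_).lipschitzOnWith
    rw [hsq t ht w, hsq t ht w', Real.dist_eq]
    refine (abs_norm_sub_norm_le _ _).trans ?_
    have h1 : ‖(hr t ht w).toLp - (hr t ht w').toLp‖ ≤ (2 * L) * ‖R (w - w')‖ := by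
      refine Lp.norm_le_mul_norm_of_ae_le_mul ?_
      filter_upwards [Lp.coeFn_sub (hr t ht w).toLp (hr t ht w').toLp, (hr t ht w).coeFn_toLp,
        (hr t ht w').coeFn_toLp, hR (w - w'),
        ae_restrict_of_ae (ae_bulk (Lp.coeFn_sub w w') b), hmem] with x e1 e2 e3 e4 e5 hx
      rw [e1, Pi.sub_apply, e2, e3, e4, e5, Pi.sub_apply]
      have i1 := (hL t ht _ hx.1).dist_le_mul (w x) (w' x)
      have i2 := (hL t ht _ hx.2).dist_le_mul (w x) (w' x)
      rw [Real.dist_eq, Real.dist_eq] at i1 i2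
      rw [Real.norm_eq_abs, Real.norm_eq_abs]
      calc _ = |(P.f b t (x + shiftVec ε l) (w x) - P.f b t (x + shiftVec ε l) (w' x)) -
            (P.f b t x (w x) - P.f b t x (w' x))| := by congr 1; ring
        _ ≤ _ := abs_sub _ _
        _ ≤ 2 * L * |w x - w' x| := by linarith
    refine h1.trans ?_
    rw [dist_eq_norm]
    have := R.le_opNorm (w - w')
    calc 2 * (L : ℝ) * ‖R (w - w')‖ ≤ 2 * L * (‖R‖ * ‖w - w'‖) := by gcongr
      _ = _ := by push_cast; ring
  have hcont : ContinuousOn (fun p : ℝ × P.Leps ε => √(c.rateSq (shiftVec ε l) p.1 p.2 b))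
      (Icc 0 P.T ×ˢ univ) :=
    continuousOn_prod_of_continuousOn_lipschitzOnWith' _ (2 * L * ‖R‖₊) hlip
      (fun w _ => (c.continuousOn_rateSq_left hP hε hl b (hw w)).sqrt)
  have hcomp : ContinuousOn (fun t => √(c.rateSq (shiftVec ε l) t (v t) b)) (Icc 0 P.T) :=
    hcont.comp (f := fun t => (t, v t)) (continuousOn_id.prodMk hv) fun t ht => ⟨ht, mem_univ _⟩
  refine (hcomp.pow 2).congr fun t _ => ?_
  exact (Real.sq_sqrt (c.rateSq_nonneg _ _ _ _)).symm

end Cutoff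
end Problem

end

section

/-! ### Comparison of the localized norms with the norms of the estimate -/

lemma ofReal_integral_le {α : Type*} [MeasurableSpace α] {μ : Measure α} {f : α → ℝ}
    (hf : ∀ x, 0 ≤ f x) : ENNReal.ofReal (∫ x, f x ∂μ) ≤ ∫⁻ x, ENNReal.ofReal (f x) ∂μ := by
  by_cases hi : Integrable f μ
  · rw [ofReal_integral_eq_lintegral_ofReal hi (Filter.Eventually.of_forall hf)]
  · simp [integral_undef hi]

namespace Problem
variable {d : ℕ} {P : Problem d}

lemma sq_normLpL2_two {F : Type*} [NormedAddCommGroup F] (U : Set (E (d + 1)))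
    (v : ℝ → E (d + 1) → F) : P.normLpL2 2 U v ^ 2 =
      ∫⁻ t in Ioo 0 P.T, ∫⁻ x in U, ENNReal.ofReal (‖v t x‖ ^ 2) := by
  simp only [← sq_eLpNorm_two]
  rw [normLpL2, eLpNorm_eq_lintegral_rpow_enorm_toReal (by simp) (by simp)]
  simp only [ENNReal.toReal_ofNat, ENNReal.rpow_ofNat, one_div, enorm_eq_self]
  rw [← ENNReal.rpow_natCast, ← ENNReal.rpow_mul]
  norm_num

lemma ae_wvol_mem (hP : P.Admissible) {ε : ℝ} (hε : 0 < ε) (a : ℝ) :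
    ∀ᵐ x ∂P.wvol ε a, x ∈ P.chan ε ∨ ∃ b, x ∈ P.bulk ε b := by
  have hb : ∀ b, ∀ᵐ x ∂volume.restrict (P.bulk ε b), x ∈ P.chan ε ∨ ∃ b, x ∈ P.bulk ε b :=
    fun b => (ae_restrict_mem (hP.isOpen_bulk ε b).measurableSet).mono fun x hx => Or.inr ⟨b, hx⟩
  rw [wvol, ae_add_measure_iff, ae_add_measure_iff]
  exact ⟨⟨hb true, hb false⟩, Measure.ae_smul_measure
    ((ae_restrict_mem (hP.isOpen_chan hε).measurableSet).mono fun x hx => Or.inl hx) _⟩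

namespace Cutoff

variable {h ε ρ M : ℝ} (c : Cutoff P h ε ρ M)
variable {hε : 0 < ε} {l : Fin d → ℤ} {u : P.Heps ε hε} {t : ℝ}

lemma ofReal_bulkSq_le (hP : P.Admissible) (hl : ‖shiftVec ε l‖ ≤ h) (b : Bool) :
    ENNReal.ofReal (c.bulkSq (shiftVec ε l) (val u) b) ≤
      ∫⁻ x in P.bulkI ε h b, ENNReal.ofReal (‖shiftDiff ε l (ext u) x‖ ^ 2) := by
  have hS := c.isOpen_cS.measurableSet
  have hSb : MeasurableSet (c.cS ∩ P.bulk ε b) := hS.inter (hP.isOpen_bulk ε b).measurableSet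
  refine (ofReal_integral_le fun x => sq_nonneg _).trans ?_
  rw [Measure.restrict_restrict hS]
  refine le_trans (le_of_eq ?_) (lintegral_mono_set (c.bulk_inter_subset_bulkI hε b))
  refine setLIntegral_congr_fun hSb fun x hx => ?_
  have h1 := hP.bulk_subset_Oe ε b hx.2
  have h2 := hP.bulk_subset_Oe ε b ((c.bulk_shift hε hl b x hx.1).2 hx.2)
  simp only [shiftDiff, ext, indicator_of_mem h1, indicator_of_mem h2, Real.norm_eq_abs, sq_abs]

lemma ofReal_rateSq_le (hP : P.Admissible) (b : Bool) :
    ENNReal.ofReal (c.rateSq (shiftVec ε l) t (val u) b) ≤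
      ∫⁻ x in P.bulkI ε h b, ENNReal.ofReal (‖P.f b t (x + shiftVec ε l) (ext u x) -
        P.f b t x (ext u x)‖ ^ 2) := by
  have hS := c.isOpen_cS.measurableSet
  have hSb : MeasurableSet (c.cS ∩ P.bulk ε b) := hS.inter (hP.isOpen_bulk ε b).measurableSet
  refine (ofReal_integral_le fun x => sq_nonneg _).trans ?_
  rw [Measure.restrict_restrict hS]
  refine le_trans (le_of_eq ?_) (lintegral_mono_set (c.bulk_inter_subset_bulkI hε b))
  refine setLIntegral_congr_fun hSb fun x hx => ?_
  have h1 := hP.bulk_subset_Oe ε b hx.2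
  simp only [ext, indicator_of_mem h1, Real.norm_eq_abs, sq_abs]

/-- The cut-off equals one on the smaller family of channels. -/
lemma lintegral_chanHat_le (hP : P.Admissible) (hm : P.Margin ρ) (hρ : 0 < ρ) (hε : 0 < ε)
    (hl : ‖shiftVec ε l‖ ≤ h) {F : Type*} [NormedAddCommGroup F] [NormedSpace ℝ F]
    {v : E (d + 1) → F} (hv : MemLp v 2 (volume.restrict (P.chan ε))) :
    ∫⁻ x in P.chanHat ε (2 * h), ENNReal.ofReal (‖shiftDiff ε l ((P.Oe ε).indicator v) x‖ ^ 2) ≤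
      ENNReal.ofReal (c.chanSq (shiftVec ε l) v) := by
  have hmeas : MeasurableSet (P.chanHat ε (2 * h)) :=
    ((hP.isOpen_chan hε).inter (isOpen_cyl isOpen_interior isOpen_Ioo)).measurableSet
  rw [chanSq, ofReal_integral_eq_lintegral_ofReal ((c.shiftInv_chan hP hm hρ hε hl).integrable_sq_mulDiff
    c.isOpen_cS.measurableSet c.measurable_η (fun _ hx => c.η_zero hx) c.abs_η_le hv)
    (Filter.Eventually.of_forall fun x => by positivity)]
  refine le_trans (le_of_eq ?_) (lintegral_mono_set (inter_subset_left :
    P.chanHat ε (2 * h) ⊆ P.chan ε))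
  refine setLIntegral_congr_fun hmeas fun x hx => ?_
  have hη := c.eq_one_of_mem_chanHat hm hρ hε hx
  have hxS : x ∈ c.cS := by
    by_contra hn
    rw [c.η_zero hn] at hη
    exact zero_ne_one hη
  have h1 := hP.chan_subset_Oe hε hx.1
  have h2 := hP.chan_subset_Oe hε ((c.copies_shift hm hρ hε hl subset_closure x hxS).2 hx.1)
  simp only [shiftDiff, indicator_of_mem h1, indicator_of_mem h2, hη, one_pow, one_mul]

lemma integrable_energy (hP : P.Admissible) (hm : P.Margin ρ) (hρ : 0 < ρ) (hε : 0 < ε)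
    (hl : ‖shiftVec ε l‖ ≤ h) (v : P.Leps ε) :
    Integrable (fun x => c.η x ^ 2 * ‖v (x + shiftVec ε l) - v x‖ ^ 2) (P.wvol ε ε⁻¹) :=
  (c.shiftInv_wvol hP hm hρ hε hl ε⁻¹).integrable_sq_mulDiff c.isOpen_cS.measurableSet
    c.measurable_η (fun _ hx => c.η_zero hx) c.abs_η_le (Lp.memLp v)

lemma energy_eq (hP : P.Admissible) (hm : P.Margin ρ) (hρ : 0 < ρ) (hε : 0 < ε)
    (hl : ‖shiftVec ε l‖ ≤ h) (v : P.Leps ε) : c.energy (shiftVec ε l) v =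
      ∫ x, c.η x ^ 2 * ‖v (x + shiftVec ε l) - v x‖ ^ 2 ∂P.wvol ε ε⁻¹ :=
  (P.integral_wvol ε (inv_pos.2 hε) (c.integrable_energy hP hm hρ hε hl v)).symm

lemma ofReal_energy_le (hP : P.Admissible) (hm : P.Margin ρ) (hρ : 0 < ρ) (hε : 0 < ε)
    (hl : ‖shiftVec ε l‖ ≤ h) {v : P.Leps ε} {v₀ : E (d + 1) → ℝ} (hv : v =ᵐ[P.wvol ε ε⁻¹] v₀) :
    ENNReal.ofReal (c.energy (shiftVec ε l) v) ≤ P.normLI ε h (shiftDiff ε l v₀) ^ 2 := by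
  classical
  rw [normLI, sq_eLpNorm_two, c.energy_eq hP hm hρ hε hl]
  refine (ofReal_integral_le fun x => by positivity).trans ?_
  refine le_trans (lintegral_mono_ae ?_) (lintegral_indicator_le _ _)
  filter_upwards [hv, (c.shiftInv_wvol hP hm hρ hε hl ε⁻¹).ae c.isOpen_cS.measurableSet hv,
    ae_wvol_mem hP hε ε⁻¹] with x h1 h2 h3
  by_cases hx : x ∈ c.cS
  · have hmem : x ∈ P.bulkHat ε h true ∪ P.chanHat ε h ∪ P.bulkHat ε h false := by
      rcases h3 with h3 | ⟨b, h3⟩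
      · exact Or.inl (Or.inr (c.chan_inter_subset hP hε ⟨hx, h3⟩))
      · have := c.bulk_inter_subset hε b ⟨hx, h3⟩
        cases b
        · exact Or.inr this
        · exact Or.inl (Or.inl this)
    rw [indicator_of_mem hmem, h1, h2 hx]
    refine ENNReal.ofReal_le_ofReal ?_
    have h1 : c.η x ^ 2 ≤ 1 := by
      rw [← sq_abs]; exact pow_le_one₀ (abs_nonneg _) (c.abs_η_le x)
    exact mul_le_of_le_one_left (by positivity) h1
  · simp [c.η_zero hx]

end Cutoff
end Problem

end

section

/-! ### The energy identity on a time interval -/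

lemma sq_add_sq_le_add_sq (a b : ℝ≥0∞) : a ^ 2 + b ^ 2 ≤ (a + b) ^ 2 := by
  rw [add_sq]
  gcongr
  exact le_self_add

lemma memLp_apply {α V : Type*} [MeasurableSpace α] {m : Measure α} [NormedAddCommGroup V]
    [NormedSpace ℝ V] {A : α → StrongDual ℝ V} (hA : MemLp A 2 m) (φ : V) :
    MemLp (fun t => A t φ) 2 m := by
  refine (hA.norm.mul_const ‖φ‖).mono
    ((ContinuousLinearMap.apply ℝ ℝ φ).continuous.comp_aestronglyMeasurable hA.1)
    (Filter.Eventually.of_forall fun t => ?_)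
  rw [norm_mul, norm_norm, norm_norm]
  exact (A t).le_opNorm φ

/-- Extension by zero. -/
lemma exists_memLp_extension {V : Type*} [NormedAddCommGroup V] {T : ℝ} {w : ℝ → V}
    (hw : MemLp w 2 (volume.restrict (Ioo 0 T))) :
    ∃ w' : ℝ → V, MemLp w' 2 volume ∧ ∀ t ∈ Ioo 0 T, w' t = w t :=
  ⟨_, (memLp_indicator_iff_restrict measurableSet_Ioo).2 hw, fun _ ht => indicator_of_mem ht _⟩

/-- The energy identity for functions that are given on the time interval only. -/
lemma inner_sub_inner_eq_of_restrict {L H : Type*} [NormedAddCommGroup L] [InnerProductSpace ℝ L]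
    [NormedAddCommGroup H] [NormedSpace ℝ H] {T : ℝ} (j : H →L[ℝ] L) {v : ℝ → L}
    (hv : Continuous v) {u : ℝ → H} {w : ℝ → StrongDual ℝ H}
    (hu : MemLp u 2 (volume.restrict (Ioo 0 T))) (hw : MemLp w 2 (volume.restrict (Ioo 0 T)))
    {K : L →L[ℝ] L} (hK : ∀ x y, inner ℝ (K x) y = inner ℝ x (K y)) {KH : H →L[ℝ] H}
    (hKj : ∀ φ, j (KH φ) = K (j φ)) (huv : ∀ᵐ t ∂volume.restrict (Ioo 0 T), v t = j (u t))
    (hinc : ∀ φ s t, 0 < s → s ≤ t → t < T → inner ℝ (v t - v s) (j φ) = ∫ τ in s..t, w τ φ) :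
    IntegrableOn (fun t => w t (KH (u t))) (Ioo 0 T) ∧ ∀ a b, 0 < a → a ≤ b → b < T →
      inner ℝ (v b) (K (v b)) - inner ℝ (v a) (K (v a)) = 2 * ∫ t in a..b, w t (KH (u t)) := by
  refine ⟨(abs_integral_apply_le hw (KH.comp_memLp' hu)).1, fun a b ha hab hb => ?_⟩
  have hmem : ∀ {x y τ : ℝ}, 0 < x → x ≤ y → y < T → τ ∈ uIcc x y → τ ∈ Ioo 0 T :=
    fun hx hxy hy hτ => by
      rw [uIcc_of_le hxy] at hτ
      exact ⟨hx.trans_le hτ.1, hτ.2.trans_lt hy⟩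
  obtain ⟨u', hu', huu⟩ := exists_memLp_extension hu
  obtain ⟨w', hw', hww⟩ := exists_memLp_extension (V := StrongDual ℝ H) hw
  rw [inner_sub_inner_eq_two_mul_integral (T := T) j hv hu' hw' hK hKj ?_ ?_ ha hab hb]
  · congr 1
    refine intervalIntegral.integral_congr fun t ht => ?_
    simp only [huu t (hmem ha hab hb ht), hww t (hmem ha hab hb ht)]
  · filter_upwards [huv, ae_restrict_mem measurableSet_Ioo] with t h1 h2
    rw [h1, huu t h2]
  · intro φ s t hs hst ht
    rw [hinc φ s t hs hst ht]
    refine intervalIntegral.integral_congr fun τ hτ => ?_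
    simp only [hww τ (hmem hs hst ht hτ)]

namespace Problem
variable {d : ℕ} {P : Problem d}

/-- The increments of the continuous representative of a weak solution are given by the time
derivative. -/
lemma IsTimeDeriv.inner_sub {ε : ℝ} {hε : 0 < ε} {u : ℝ → P.Heps ε hε}
    {w : ℝ → StrongDual ℝ (P.Heps ε hε)} (h : P.IsTimeDeriv u w)
    (hw : MemLp w 2 (volume.restrict (Ioo 0 P.T))) {v : ℝ → P.Leps ε} (hv : Continuous v)
    (huv : ∀ᵐ t ∂volume.restrict (Ioo 0 P.T), v t = val (u t)) (φ : P.Heps ε hε) {a b : ℝ}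
    (ha : 0 < a) (hab : a ≤ b) (hb : b < P.T) :
    inner ℝ (v b - v a) (val φ) = ∫ t in a..b, w t φ := by
  have hfin : IsFiniteMeasure (volume.restrict (Ioo 0 P.T)) := by infer_instance
  have hq : IntegrableOn (fun t => w t φ) (Ioo 0 P.T) :=
    (memLp_apply hw φ).integrable one_le_two
  have := sub_eq_integral_of_weakDeriv (p := fun t => inner ℝ (v t) (val φ))
    (hv.inner continuous_const) hq (fun ψ h1 h2 h3 => ?_) ha hab hb
  · rw [← this, inner_sub_left]
  · rw [← h ψ h1 h2 h3 φ]
    refine integral_congr_ae (huv.mono fun t ht => ?_)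
    simp only [ht]

namespace Cutoff

variable {h ε ρ M : ℝ} (c : Cutoff P h ε ρ M) {l : Fin d → ℤ}

/-- `chanSq` is the squared norm of a continuous linear image of the gradient. -/
lemma exists_chanSq_eq (hP : P.Admissible) (hm : P.Margin ρ) (hρ : 0 < ρ) (hε : 0 < ε)
    (hl : ‖shiftVec ε l‖ ≤ h) :
    ∃ T : P.Geps ε →L[ℝ] Lp (E (d + 1)) 2 (volume.restrict (P.chan ε)),
      ∀ G : P.Geps ε, c.chanSq (shiftVec ε l) G = ‖T G‖ ^ 2 := by
  obtain ⟨T, hT⟩ := (c.shiftInv_chan hP hm hρ hε hl).exists_clm_locDiff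
    c.isOpen_cS.measurableSet ENNReal.ofReal_ne_top (P.chan_le_wvol ε hε) (M := 1)
    (a := fun x => c.η x • ContinuousLinearMap.id ℝ (E (d + 1)))
    (c.smooth.continuous.smul continuous_const).stronglyMeasurable
    (fun x hx => by rw [c.η_zero hx]; exact zero_smul ℝ _)
    (fun x => by
      rw [norm_smul, Real.norm_eq_abs]
      exact mul_le_one₀ (c.abs_η_le x) (norm_nonneg _) ContinuousLinearMap.norm_id_le)
  refine ⟨T, fun G => ?_⟩
  rw [Lp.norm_def, ← integral_sq_norm_eq (Lp.memLp _)]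
  refine integral_congr_ae ((hT G).mono fun x hx => ?_)
  simp only [hx, locDiff, _root_.smul_apply, ContinuousLinearMap.id_apply, norm_smul, mul_pow,
    Real.norm_eq_abs, sq_abs]

/-- `bulkSq` is the squared norm of a continuous linear image of the function. -/
lemma exists_bulkSq_eq (hP : P.Admissible) (hε : 0 < ε)
    (hl : ‖shiftVec ε l‖ ≤ h) (b : Bool) :
    ∃ T : P.Leps ε →L[ℝ] Lp ℝ 2 (volume.restrict (P.bulk ε b)),
      ∀ v : P.Leps ε, c.bulkSq (shiftVec ε l) v b = ‖T v‖ ^ 2 := by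
  classical
  have hS := c.isOpen_cS.measurableSet
  obtain ⟨T, hT⟩ := (c.shiftInv_bulk hP hε hl b).exists_clm_locDiff
    hS ENNReal.one_ne_top (P.bulk_le_wvol ε ε⁻¹ b) (M := 1)
    (a := c.cS.indicator fun _ => ContinuousLinearMap.id ℝ ℝ)
    (stronglyMeasurable_const.indicator hS)
    (fun x hx => indicator_of_notMem hx _)
    (fun x => by by_cases hx : x ∈ c.cS <;> simp [hx])
  refine ⟨T, fun v => ?_⟩
  rw [Lp.norm_def, ← integral_sq_norm_eq (Lp.memLp _), bulkSq, ← integral_indicator hS]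
  refine integral_congr_ae ((hT v).mono fun x hx => ?_)
  by_cases hxS : x ∈ c.cS <;> simp [hx, locDiff, hxS]

end Cutoff

end Problem

end

section

/-! ### The energy balance for the differences of a weak solution -/

namespace Problem
variable {d : ℕ} {P : Problem d}

namespace Cutoff

variable {h ε ρ M : ℝ} (c : Cutoff P h ε ρ M) {l : Fin d → ℤ}

/-- The sources of the energy balance are controlled by the bulk terms of the shift estimate. -/
lemma lintegral_sources_le (hP : P.Admissible) (hε : 0 < ε) (hl : ‖shiftVec ε l‖ ≤ h)
    {u : ℝ → P.Heps ε hε} {v : ℝ → P.Leps ε} (hv : Continuous v)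
    (huv : ∀ᵐ t ∂volume.restrict (Ioo 0 P.T), v t = val (u t)) :
    ∫⁻ t in Ioo 0 P.T, ∑ b, (ENNReal.ofReal (c.bulkSq (shiftVec ε l) (v t) b) +
      ENNReal.ofReal (c.rateSq (shiftVec ε l) t (v t) b)) ≤
      (bulkShiftNorm h u l + rateShiftNorm h u l) ^ 2 := by
  have hm1 : ∀ b, AEMeasurable (fun t => ENNReal.ofReal (c.bulkSq (shiftVec ε l) (v t) b))
      (volume.restrict (Ioo 0 P.T)) := fun b => by
    obtain ⟨T, hT⟩ := c.exists_bulkSq_eq hP hε hl b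
    simp only [hT]
    have : Continuous fun t => ‖T (v t)‖ ^ 2 := ((T.continuous.comp hv).norm).pow 2
    exact this.measurable.ennreal_ofReal.aemeasurable
  have hm2 : ∀ b, AEMeasurable (fun t => ENNReal.ofReal (c.rateSq (shiftVec ε l) t (v t) b))
      (volume.restrict (Ioo 0 P.T)) := fun b =>
    (((c.continuousOn_rateSq hP hε hl b hv.continuousOn).mono
      Ioo_subset_Icc_self).aemeasurable measurableSet_Ioo).ennreal_ofReal
  have hb : ∀ b, ∫⁻ t in Ioo 0 P.T, (ENNReal.ofReal (c.bulkSq (shiftVec ε l) (v t) b) +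
      ENNReal.ofReal (c.rateSq (shiftVec ε l) t (v t) b)) ≤
      (P.normLpL2 2 (P.bulkI ε h b) (fun t => shiftDiff ε l (ext (u t)))) ^ 2 +
      (P.normLpL2 2 (P.bulkI ε h b) (fun t x =>
        P.f b t (x + shiftVec ε l) (ext (u t) x) - P.f b t x (ext (u t) x))) ^ 2 := fun b => by
    rw [lintegral_add_left' (hm1 b), sq_normLpL2_two, sq_normLpL2_two]
    refine add_le_add (lintegral_mono_ae ?_) (lintegral_mono_ae ?_)
    · filter_upwards [huv] with t ht
      rw [ht]
      exact c.ofReal_bulkSq_le hP hl b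
    · filter_upwards [huv] with t ht
      rw [ht]
      exact c.ofReal_rateSq_le hP b
  refine (lintegral_finsetSum' _ fun b _ => (hm1 b).add (hm2 b)).trans_le ?_
  refine (Finset.sum_le_sum fun b _ => hb b).trans ?_
  rw [Finset.sum_add_distrib, bulkShiftNorm, rateShiftNorm]
  simp only [Fintype.sum_bool]
  refine le_trans ?_ (sq_add_sq_le_add_sq _ _)
  exact add_le_add (sq_add_sq_le_add_sq _ _) (sq_add_sq_le_add_sq _ _)

/-- The energy balance for the cut off differences of a weak solution: their energy changes at the
rate `2 W`, where `-W` is the value of the spatial terms of the weak formulation, tested with the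
cut off second difference. -/
lemma exists_energy_balance (hP : P.Admissible) (hm : P.Margin ρ) (hρ : 0 < ρ) (hε : 0 < ε)
    (hl : ‖shiftVec ε l‖ ≤ h) {u : ℝ → P.Heps ε hε} (hu : P.IsWeakSolution ε hε u) :
    ∃ (v : ℝ → P.Leps ε) (W : ℝ → ℝ), Continuous v ∧
      (∀ᵐ t ∂volume.restrict (Ioo 0 P.T), v t = val (u t)) ∧
      v 0 =ᵐ[P.wvol ε ε⁻¹] P.init ε ∧ IntegrableOn W (Ioo 0 P.T) ∧
      (Continuous fun t => c.energy (shiftVec ε l) (v t)) ∧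
      (∀ a b, 0 < a → a ≤ b → b < P.T → c.energy (shiftVec ε l) (v b) -
        c.energy (shiftVec ε l) (v a) = 2 * ∫ t in a..b, W t) ∧
      ∀ᵐ t ∂volume.restrict (Ioo 0 P.T), ∃ φ β, c.IsTest (shiftVec ε l) (u t) φ ∧
        IsBoundaryTerm t (u t) φ β ∧ W t + P.volForm t (u t) φ + β = 0 := by
  have hT := hP.T_pos
  obtain ⟨hu2, ⟨w, hw, hwd, heq⟩, v₀, hv₀, huv₀, hinit⟩ := hu
  obtain ⟨K, KH, hK, hKv, hKg⟩ := c.exists_testOperators hP hm hρ hε hl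
  -- the continuous representative, extended to the whole time axis
  obtain ⟨v, hv, hvv⟩ : ∃ v : ℝ → P.Leps ε, Continuous v ∧ ∀ t ∈ Icc 0 P.T, v t = v₀ t :=
    ⟨IccExtend hT.le ((Icc 0 P.T).domRestrict v₀),
      (continuousOn_iff_continuous_domRestrict.1 hv₀).Icc_extend', fun t ht => by
        rw [IccExtend_of_mem _ _ ht]; rfl⟩
  have hIoo : ∀ᵐ t ∂volume.restrict (Ioo 0 P.T), t ∈ Ioo 0 P.T :=
    ae_restrict_mem measurableSet_Ioo
  have huv : ∀ᵐ t ∂volume.restrict (Ioo 0 P.T), v t = val (u t) := by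
    filter_upwards [huv₀, hIoo] with t h1 h2
    rw [hvv t (Ioo_subset_Icc_self h2), h1]
  have hen : ∀ z : P.Leps ε, inner ℝ z (K z) = c.energy (shiftVec ε l) z := fun z => by
    rw [c.inner_testOperator hP hm hρ hε hl hK, c.energy_eq hP hm hρ hε hl]
    refine integral_congr_ae (Filter.Eventually.of_forall fun x => ?_)
    simp only [Real.norm_eq_abs, sq_abs]
    rw [show c.ζ x = c.η x ^ 2 from rfl, ← sq]
  obtain ⟨hint, hbal⟩ := inner_sub_inner_eq_of_restrict (valL P ε hε) hv hu2 hw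
    (fun x y => c.testOperator_symm hP hm hρ hε hl hK x y) (KH := KH)
    (fun φ => by rw [valL_apply, valL_apply, hKv]) huv
    (fun φ a b ha hab hb => hwd.inner_sub hw hv huv φ ha hab hb)
  refine ⟨v, fun t => w t (KH (u t)), hv, huv, ?_, hint, ?_, fun a b ha hab hb => ?_, ?_⟩
  · rw [hvv 0 (left_mem_Icc.2 hT.le)]
    exact hinit
  · simp only [← hen]
    exact hv.inner (K.continuous.comp hv)
  · rw [← hen, ← hen]
    exact hbal a b ha hab hb
  · have hum : AEStronglyMeasurable u (volume.restrict (Ioo 0 P.T)) := hu2.1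
    have heq' : ∀ φ : P.Heps ε hε, ∀ᵐ t ∂volume.restrict (Ioo 0 P.T),
        w t φ + P.volForm t (u t) φ +
          (∫ x in P.chanN ε, P.hN t (cellPt ε x) (trN (u t) x) * trN φ x ∂μHE[d]) = 0 := by
      intro φ
      filter_upwards [heq φ] with t ht
      rw [volForm]
      simp only [cellPt]
      linarith
    have htested := hP.tested_equation hm hρ hum heq' KH
    refine htested.mono fun t ht => ?_
    obtain ⟨β, hβ, hW⟩ := ht
    exact ⟨KH (u t), β, ⟨by rw [hKv]; exact hK _, hKg _⟩, hβ, hW⟩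

end Cutoff

end Problem

end

section

/-! ### The shift estimate -/

namespace Problem
variable {d : ℕ} {P : Problem d}

/-- The energy estimate for the cut off differences, with `S` the right-hand side of the shift estimate
up to a constant. -/
lemma Admissible.exists_energy_estimate (hP : P.Admissible) {ρ : ℝ} (hm : P.Margin ρ)
    (hρ : 0 < ρ) (h M : ℝ) : ∃ k : ℝ, 0 < k ∧ ∀ (ε : ℝ) (hε : 0 < ε) (c : Cutoff P h ε ρ M)
      (l : Fin d → ℤ), ‖shiftVec ε l‖ ≤ h → ∀ u : ℝ → P.Heps ε hε, P.IsWeakSolution ε hε u →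
      ∀ S : ℝ≥0∞, S = P.normLI ε h (shiftDiff ε l (P.init ε)) + bulkShiftNorm h u l +
        rateShiftNorm h u l →
      (∀ᵐ t ∂volume.restrict (Ioo 0 P.T),
        ENNReal.ofReal (c.energy (shiftVec ε l) (val (u t))) ≤ ENNReal.ofReal k * S ^ 2) ∧
      ∫⁻ t in Ioo 0 P.T, ENNReal.ofReal (ε * c.chanSq (shiftVec ε l) (grad (u t))) ≤
        ENNReal.ofReal k * S ^ 2 := by
  obtain ⟨C, c₀, hC, hc₀, hest⟩ := hP.exists_tested_le hm hρ h M
  have hT := hP.T_pos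
  obtain ⟨e₁, he₁, he₁e⟩ : ∃ e₁ : ℝ, 0 < e₁ ∧ Real.exp (2 * C * P.T) = e₁ :=
    ⟨_, Real.exp_pos _, rfl⟩
  obtain ⟨r₂, hr₂, hr₂e⟩ : ∃ r₂ : ℝ, 0 < r₂ ∧ (1 + 2 * C * P.T * e₁) / c₀ = r₂ :=
    ⟨_, by positivity, rfl⟩
  have hk : 0 < (1 + 2 * C) * (e₁ + r₂) := by positivity
  refine ⟨_, hk, ?_⟩
  intro ε hε c l hl u hu S hS
  obtain ⟨TX, hTX⟩ := c.exists_chanSq_eq hP hm hρ hε hl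
  obtain ⟨v, W, hv, huv, hinit, hW, hec, hbal, htest⟩ :=
    c.exists_energy_balance hP hm hρ hε hl hu
  have hu2 : MemLp u 2 (volume.restrict (Ioo 0 P.T)) := hu.1
  have hq := c.lintegral_sources_le hP hε hl hv huv
  obtain ⟨Q, hQe⟩ : ∃ Q : ℝ → ℝ≥0∞, ∀ t, Q t =
    ∑ b, (ENNReal.ofReal (c.bulkSq (shiftVec ε l) (v t) b) +
      ENNReal.ofReal (c.rateSq (shiftVec ε l) t (v t) b)) := ⟨_, fun t => rfl⟩
  simp only [← hQe] at hq
  have hS2 : P.normLI ε h (shiftDiff ε l (P.init ε)) ^ 2 + ∫⁻ t in Ioo 0 P.T, Q t ≤ S ^ 2 := by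
    rw [hS, add_assoc]
    exact (add_le_add_right hq _).trans (sq_add_sq_le_add_sq _ _)
  -- if the sources are not integrable, then the right-hand side of the estimate is infinite
  by_cases hqt : ∫⁻ t in Ioo 0 P.T, Q t = ⊤
  · have : S ^ 2 = ⊤ := top_le_iff.1 (le_trans (by rw [hqt, add_top]) hS2)
    have hkt : ENNReal.ofReal ((1 + 2 * C) * (e₁ + r₂)) * S ^ 2 = ⊤ := by
      rw [this, ENNReal.mul_top (by simpa using hk)]
    rw [hkt]
    exact ⟨Filter.Eventually.of_forall fun t => le_top, le_top⟩
  have hXint : IntegrableOn (fun t => ε * c.chanSq (shiftVec ε l) (grad (u t))) (Ioo 0 P.T) := by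
    simp only [hTX]
    have hT2 : MemLp (fun t => TX (grad (u t))) 2 (volume.restrict (Ioo 0 P.T)) :=
      (TX.comp (gradL P ε hε)).comp_memLp' hu2
    exact (hT2.integrable_norm_pow (by norm_num)).const_mul ε
  have hX0 : ∀ t, 0 ≤ ε * c.chanSq (shiftVec ε l) (grad (u t)) := fun t =>
    mul_nonneg hε.le (c.chanSq_nonneg _ _)
  have hle : ∀ᵐ t ∂volume.restrict (Ioo 0 P.T), ENNReal.ofReal (W t +
      c₀ * (ε * c.chanSq (shiftVec ε l) (grad (u t))) - C * c.energy (shiftVec ε l) (v t)) ≤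
        ENNReal.ofReal C * Q t := by
    filter_upwards [htest, ae_restrict_mem measurableSet_Ioo, huv] with t h1 h2 h3
    obtain ⟨φ, β, hφ, hβ, hWt⟩ := h1
    have := hest ε hε c l hl t (Ioo_subset_Icc_self h2) (u t) φ hφ β hβ _ hWt
    rw [hQe, h3]
    rw [Finset.sum_add_distrib, ← ENNReal.ofReal_sum_of_nonneg fun b _ => c.bulkSq_nonneg _ _ _,
      ← ENNReal.ofReal_sum_of_nonneg fun b _ => c.rateSq_nonneg _ _ _ _,
      ← ENNReal.ofReal_add (Finset.sum_nonneg fun b _ => c.bulkSq_nonneg _ _ _)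
        (Finset.sum_nonneg fun b _ => c.rateSq_nonneg _ _ _ _), ← ENNReal.ofReal_mul hC]
    refine ENNReal.ofReal_le_ofReal ?_
    linarith
  have hQ : ∫⁻ t in Ioo 0 P.T, ENNReal.ofReal C * Q t =
      ENNReal.ofReal C * ∫⁻ t in Ioo 0 P.T, Q t :=
    lintegral_const_mul' _ _ ENNReal.ofReal_ne_top
  have hQt : ENNReal.ofReal C * (∫⁻ t in Ioo 0 P.T, Q t) ≠ ⊤ :=
    ENNReal.mul_ne_top ENNReal.ofReal_ne_top hqt
  obtain ⟨hE, hX⟩ := energy_dissipation_le (Q := fun t => ENNReal.ofReal C * Q t)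
    hT hC hec (fun t => c.energy_nonneg hε _ _)
    (fun t => mul_nonneg hc₀.le (hX0 t)) (hXint.const_mul c₀) hW hbal hle (by rwa [hQ])
  rw [hQ, he₁e] at hE hX
  obtain ⟨A, hAe⟩ : ∃ A : ℝ, A = c.energy (shiftVec ε l) (v 0) +
    2 * (ENNReal.ofReal C * ∫⁻ t in Ioo 0 P.T, Q t).toReal := ⟨_, rfl⟩
  rw [← hAe] at hE hX
  have hA0 : 0 ≤ A := hAe ▸ add_nonneg (c.energy_nonneg hε _ _) (by positivity)
  have hA : ENNReal.ofReal A ≤ ENNReal.ofReal (1 + 2 * C) * S ^ 2 := by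
    have h1 := c.ofReal_energy_le hP hm hρ hε hl hinit
    calc ENNReal.ofReal A ≤ P.normLI ε h (shiftDiff ε l (P.init ε)) ^ 2 +
          2 * (ENNReal.ofReal C * ∫⁻ t in Ioo 0 P.T, Q t) := by
          rw [hAe]
          refine ENNReal.ofReal_add_le.trans (add_le_add h1 ?_)
          rw [ENNReal.ofReal_mul zero_le_two, ENNReal.ofReal_toReal hQt, ENNReal.ofReal_ofNat]
      _ ≤ 1 * S ^ 2 + 2 * (ENNReal.ofReal C * S ^ 2) := by
          rw [one_mul]
          exact add_le_add (le_self_add.trans hS2)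
            (mul_le_mul_right (mul_le_mul_right (le_add_self.trans hS2) _) _)
      _ = ENNReal.ofReal (1 + 2 * C) * S ^ 2 := by
          rw [ENNReal.ofReal_add one_pos.le (by positivity), ENNReal.ofReal_mul zero_le_two,
            ENNReal.ofReal_one, ENNReal.ofReal_ofNat]
          ring
  have hfin : ∀ r : ℝ, r ≤ e₁ + r₂ →
      ENNReal.ofReal (A * r) ≤ ENNReal.ofReal ((1 + 2 * C) * (e₁ + r₂)) * S ^ 2 := fun r hr => by
    rw [ENNReal.ofReal_mul hA0]
    calc _ ≤ (ENNReal.ofReal (1 + 2 * C) * S ^ 2) * ENNReal.ofReal (e₁ + r₂) := by gcongr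
      _ = _ := by
          rw [ENNReal.ofReal_mul (by positivity)]; ring
  constructor
  · filter_upwards [ae_restrict_mem measurableSet_Ioo, huv] with t h1 h2
    rw [← h2]
    exact (ENNReal.ofReal_le_ofReal (hE t h1)).trans (hfin _ (by linarith))
  · rw [← ofReal_integral_eq_lintegral_ofReal hXint (Filter.Eventually.of_forall hX0)]
    rw [integral_const_mul] at hX
    refine le_trans (ENNReal.ofReal_le_ofReal ?_) (hfin r₂ (by linarith))
    rw [← hr₂e, ← mul_div_assoc, le_div_iff₀ hc₀, mul_comm]
    exact hX

/-- If the reaction rates are horizontally homogeneous, their horizontal oscillation vanishes. -/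
lemma HorizontallyHomogeneous.rateShiftNorm_eq_zero (hH : P.HorizontallyHomogeneous)
    (hP : P.Admissible) {h ε : ℝ} {hε : 0 < ε} {l : Fin d → ℤ} (hl : ‖shiftVec ε l‖ ≤ h)
    (u : ℝ → P.Heps ε hε) : rateShiftNorm h u l = 0 := by
  have hmeas : ∀ b, MeasurableSet (P.bulkI ε h b) := fun b => by
    have hI : IsOpen (P.SigI h) :=
      hP.sig_lipschitz.1.inter (isOpen_lt continuous_const (Metric.continuous_infDist_pt _))
    exact ((hP.isOpen_bulk ε b).inter (isOpen_cyl hI isOpen_Ioo)).measurableSet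
  refine Finset.sum_eq_zero fun b _ => ?_
  rw [← pow_eq_zero_iff two_ne_zero, sq_normLpL2_two]
  refine (setLIntegral_congr_fun measurableSet_Ioo fun t ht => ?_).trans lintegral_zero
  refine (setLIntegral_congr_fun (hmeas b) fun x hx => ?_).trans lintegral_zero
  have hx1 : x ∈ P.Om := bulk_subset_Om hε b hx.1
  have hv : vert (x + shiftVec ε l) = vert x := by simp [vert, shiftVec, mkPt]
  have hx2 : x + shiftVec ε l ∈ P.Om := by
    refine ⟨?_, by rw [hv]; exact hx1.2⟩
    rw [bar_add]
    exact SigI.add_mem hx.2.1 ((norm_bar_le _).trans hl)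
  simp [hH b t (Ioo_subset_Icc_self ht) _ (subset_closure hx2) _ (subset_closure hx1) hv]

/-- The estimate of the differences in the channels by the cut off differences. -/
lemma Cutoff.chanShiftNorm_le {h ε ρ M : ℝ} (c : Cutoff P h ε ρ M) (hP : P.Admissible)
    (hm : P.Margin ρ) (hρ : 0 < ρ) {hε : 0 < ε} {l : Fin d → ℤ} (hl : ‖shiftVec ε l‖ ≤ h)
    {u : ℝ → P.Heps ε hε} {k : ℝ} {S : ℝ≥0∞} (hk : 0 ≤ k)
    (h1 : ∀ᵐ t ∂volume.restrict (Ioo 0 P.T),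
      ENNReal.ofReal (c.energy (shiftVec ε l) (val (u t))) ≤ ENNReal.ofReal k * S ^ 2)
    (h2 : ∫⁻ t in Ioo 0 P.T, ENNReal.ofReal (ε * c.chanSq (shiftVec ε l) (grad (u t))) ≤
        ENNReal.ofReal k * S ^ 2) :
    chanShiftNorm h u l ≤ ENNReal.ofReal (2 * √k) * S := by
  have hε' : 0 < ε⁻¹ := inv_pos.2 hε
  have hks : ENNReal.ofReal k = ENNReal.ofReal (√k) ^ 2 := by
    rw [← ENNReal.ofReal_pow (Real.sqrt_nonneg k), Real.sq_sqrt hk]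
  have hes : ENNReal.ofReal ε = ENNReal.ofReal (√ε) ^ 2 := by
    rw [← ENNReal.ofReal_pow (Real.sqrt_nonneg ε), Real.sq_sqrt hε.le]
  rw [two_mul, ENNReal.ofReal_add (Real.sqrt_nonneg k) (Real.sqrt_nonneg k), add_mul]
  refine add_le_add ?_ ?_
  · have hinf : P.normLpL2 ⊤ (P.chanHat ε (2 * h)) (fun t => shiftDiff ε l (ext (u t))) ≤
        ENNReal.ofReal (√ε) * (ENNReal.ofReal (√k) * S) := by
      rw [normLpL2, eLpNorm_exponent_top]
      refine essSup_le_of_ae_le _ (h1.mono fun t ht => ?_)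
      simp only [enorm_eq_self]
      rw [← ENNReal.pow_le_pow_left_iff two_ne_zero, sq_eLpNorm_two]
      refine (c.lintegral_chanHat_le hP hm hρ hε hl
        ((memLp_val (u t)).ofWvol_chan hε')).trans ?_
      have h3 : c.chanSq (shiftVec ε l) (val (u t)) ≤ ε * c.energy (shiftVec ε l) (val (u t)) := by
        rw [Cutoff.energy, mul_add, mul_inv_cancel_left₀ hε.ne']
        exact le_add_of_nonneg_left (mul_nonneg hε.le
          (Finset.sum_nonneg fun b _ => c.bulkCutSq_nonneg _ _ _))
      refine (ENNReal.ofReal_le_ofReal h3).trans ?_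
      rw [ENNReal.ofReal_mul hε.le, mul_pow, mul_pow, ← hes, ← hks]
      gcongr
    refine (mul_le_mul_right hinf _).trans_eq ?_
    rw [← mul_assoc, ← ENNReal.ofReal_mul (by positivity), one_div_mul_cancel
      (Real.sqrt_pos.2 hε).ne', ENNReal.ofReal_one, one_mul]
  · rw [← ENNReal.pow_le_pow_left_iff two_ne_zero, mul_pow, mul_pow, ← hes, ← hks,
      sq_normLpL2_two]
    refine le_trans ?_ h2
    rw [← lintegral_const_mul' _ _ ENNReal.ofReal_ne_top]
    refine lintegral_mono fun t => ?_
    rw [ENNReal.ofReal_mul hε.le]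
    gcongr
    exact c.lintegral_chanHat_le hP hm hρ hε hl ((memLp_grad (u t)).ofWvol_chan hε)

end Problem

end

end

end Channels

theorem mainTheorem4 {d : ℕ} (hd : 1 ≤ d) (P : Channels.Problem d) (hP : P.Admissible)
    (h : ℝ) (hh : 0 < h) :
    ∃ C : ℝ, 0 < C ∧ ∀ (ε : ℝ) (hε : 0 < ε), (∃ m : ℕ, ε⁻¹ = m) → ε < P.H →
      ∀ u : ℝ → P.Heps ε hε, P.IsWeakSolution ε hε u →
      ∀ l : Fin d → ℤ, ‖Channels.shiftVec ε l‖ < h →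
        (P.HorizontallyHomogeneous →
          Channels.Problem.chanShiftNorm h u l ≤ ENNReal.ofReal C *
            (ENNReal.ofReal ε + P.normLI ε h (Channels.shiftDiff ε l (P.init ε)) +
              Channels.Problem.bulkShiftNorm h u l)) ∧
        Channels.Problem.chanShiftNorm h u l ≤ ENNReal.ofReal C *
          (ENNReal.ofReal ε + P.normLI ε h (Channels.shiftDiff ε l (P.init ε)) +
            Channels.Problem.bulkShiftNorm h u l + Channels.Problem.rateShiftNorm h u l) := by
  obtain ⟨ρ, hρ, hρ2, hm⟩ := hP.exists_margin
  obtain ⟨M, -, hcut⟩ := Channels.Problem.exists_cutoff P hh hρ hρ2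
  obtain ⟨k, hk, hest⟩ := hP.exists_energy_estimate hm hρ h M
  refine ⟨2 * √k, by positivity, fun ε hε _ _ u hu l hl => ?_⟩
  obtain ⟨c⟩ := hcut ε hε
  obtain ⟨h1, h2⟩ := hest ε hε c l hl.le u hu _ rfl
  have key := c.chanShiftNorm_le hP hm hρ hl.le hk.le h1 h2
  have hmain : Channels.Problem.chanShiftNorm h u l ≤ ENNReal.ofReal (2 * √k) *
      (ENNReal.ofReal ε + P.normLI ε h (Channels.shiftDiff ε l (P.init ε)) +
        Channels.Problem.bulkShiftNorm h u l + Channels.Problem.rateShiftNorm h u l) := by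
    refine key.trans (mul_le_mul_right ?_ _)
    rw [add_assoc (ENNReal.ofReal ε), add_assoc (ENNReal.ofReal ε)]
    exact le_add_self
  refine ⟨fun hH => ?_, hmain⟩
  rwa [hH.rateShiftNorm_eq_zero hP hl.le u, add_zero] at hmain
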